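/- Let $S$ be a closed connected oriented surface, let $\mathcal L$ be a connected oriented surface, and let $q:\mathcal L\to S$ be an orientation-preserving regular covering whose deck transformation group is infinite cyclic, generated by $h$. (For example $S=S_g$ with $g\ge 3$, $\mathcal L$ the infinite ladder surface, $h=h_{g-1}$ the standard handle shift and $q=q_g$.) For an oriented surface $X$ let $\mathrm{Map}(X)$ be the group of isotopy classes of orientation-preserving homeomorphisms of $X$, with the quotient of the compact-open topology on $\mathrm{Homeo}^+(X)$. A homeomorphism $\tilde f$ of $\mathcal L$ is a lift of a homeomorphism $f$ of $S$ if $q\circ\tilde f=f\circ q$; let $\mathrm{LMod}_q(S)\le\mathrm{Map}(S)$ be the subgroup of the classes represented by a homeomorphism that has a lift $\tilde f\in\mathrm{Homeo}^+(\mathcal L)$. A twist homeomorphism about a simple closed curve $c$ is a left-handed twist of some closed annulus with core $c$, extended by the identity; its class is the Dehn twist $T_c$. Products are ordered, $\prod_{i=-k}^{k}T_i=T_{-k}T_{-k+1}\cdots T_k$. (1) Let $\gamma\subset S$ be an essential simple closed curve with $T_\gamma\in\mathrm{LMod}_q(S)$ and let $q^{-1}(\gamma)$ be the disjoint union of the simple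 closed curves $\gamma_i$, $i\in\mathbb Z$ (indexed in any way). Then $\lim_{k\to\infty}\prod_{i=-k}^{k}T_{\gamma_i}$ exists in $\mathrm{Map}(\mathcal L)$ and is the lift of $T_\gamma$: every twist homeomorphism $t$ about $\gamma$ has a lift $\tilde t$ that fixes every point of $\mathcal L$ lying over a fixed point of $t$, and that represents the limit. (2) Let $\gamma_1,\dots,\gamma_r\subset S$ be essential simple closed curves with $T_{\gamma_j}\in\mathrm{LMod}_q(S)$, let $n_1,\dots,n_r\in\mathbb Z$, and let $q^{-1}(\gamma_j)$ be the disjoint union of the simple closed curves $\gamma_{j,i}$, $i\in\mathbb Z$. Put $F=T_{\gamma_1}^{n_1}\cdots T_{\gamma_r}^{n_r}$. Then the limit $$\widetilde F=\lim_{k\to\infty}\Big(\prod_{i=-k}^{k}T_{\gamma_{1,i}}^{n_1}\Big)\cdots\Big(\prod_{i=-k}^{k}T_{\gamma_{r,i}}^{n_r}\Big)$$ exists in $\mathrm{Map}(\mathcal L)$, and it is a lift of $F$: every $f\in\mathrm{Homeo}^+(S)$ representing $F$ has a lift that represents $\widetilde F$. Moreover, let $t_j$ be a twist homeomorphism about $\gamma_j$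 for each $j$, let $x_0\in S$ be a point fixed by each of $t_1^{n_1},\dots,t_r^{n_r}$, let $\tilde x_0\in q^{-1}(x_0)$, and let $f\in\mathrm{Homeo}^+(S)$ be isotopic to $t_1^{n_1}\circ\dots\circ t_r^{n_r}$ through orientation-preserving homeomorphisms fixing $x_0$. Then $f$ has exactly one lift $\tilde f\in\mathrm{Homeo}^+(\mathcal L)$ with $\tilde f(\tilde x_0)=\tilde x_0$, and $\tilde f$ represents $\widetilde F$. -/

import Mathlib

open Topology Filter

/-! ### Orientations of topological surfaces -/

/-- `g : ℂ → ℂ` preserves the orientation of the plane at `z`: on every small circle about `z` the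
function `g - g z` has no zero and has winding number `+1` about `0`, i.e. it has a continuous
argument `ϑ` that increases by `2π` along the circle. -/
def PlanarOrientationPreservingAt (g : ℂ → ℂ) (z : ℂ) : Prop :=
  ∀ᶠ r : ℝ in 𝓝[>] 0, ∃ ϑ : ℝ → ℝ, Continuous ϑ ∧
    (∀ s, ϑ (s + 2 * Real.pi) = ϑ s + 2 * Real.pi) ∧
    ∀ s : ℝ, g (z + r * Complex.exp (s * Complex.I)) ≠ g z ∧
      g (z + r * Complex.exp (s * Complex.I)) - g z =
        ‖g (z + r * Complex.exp (s * Complex.I)) - g z‖ * Complex.exp (ϑ s * Complex.I)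

/-- `f` preserves orientation at `x`, read in the preferred charts at `x` and at `f x`. -/
def OrientationPreservingAt {X Y : Type*} [TopologicalSpace X] [ChartedSpace ℂ X]
    [TopologicalSpace Y] [ChartedSpace ℂ Y] (f : X → Y) (x : X) : Prop :=
  PlanarOrientationPreservingAt
    (fun w => chartAt ℂ (f x) (f ((chartAt ℂ x).symm w))) (chartAt ℂ x x)

/-- An oriented (topological, boundaryless) surface: a Hausdorff space with an atlas of charts in
the plane, all of whose transition maps preserve orientation. -/
class OrientedSurface (X : Type*) [TopologicalSpace X] [ChartedSpace ℂ X] : Prop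
    extends T2Space X where
  orientation_compat : ∀ e ∈ atlas ℂ X, ∀ e' ∈ atlas ℂ X, ∀ x ∈ e.source ∩ e'.source,
    PlanarOrientationPreservingAt (fun w => e' (e.symm w)) (e x)

/-- A positively oriented open disc in an oriented surface. -/
def IsPositiveDisc {X : Type*} [TopologicalSpace X] [ChartedSpace ℂ X] (φ : ℂ → X) : Prop :=
  IsOpenEmbedding φ ∧ ∀ z, OrientationPreservingAt φ z

/-! ### Homeomorphisms and mapping classes -/

/-- The compact-open topology on the group of homeomorphisms. -/
instance homeoCompactOpen (X : Type*) [TopologicalSpace X] : TopologicalSpace (X ≃ₜ X) :=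
  TopologicalSpace.induced (fun f => (⟨f, f.continuous⟩ : C(X, X))) inferInstance

/-- `Homeo⁺(X)`: the homeomorphisms that carry positively oriented discs, and only these, to
positively oriented discs. -/
def HomeoPlus (X : Type*) [TopologicalSpace X] [ChartedSpace ℂ X] : Subgroup (X ≃ₜ X) where
  carrier := {f | ∀ φ : ℂ → X, IsPositiveDisc φ ↔ IsPositiveDisc (f ∘ φ)}
  one_mem' := fun _ => Iff.rfl
  mul_mem' := fun {f g} hf hg φ => (hg φ).trans (hf (g ∘ φ))
  inv_mem' := fun {f} hf φ => by
    have h := hf ((f⁻¹ : X ≃ₜ X) ∘ φ)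
    have e : f ∘ ((f⁻¹ : X ≃ₜ X) ∘ φ) = φ := by
      funext z
      exact f.apply_symm_apply (φ z)
    rw [e] at h
    exact h.symm

theorem homeoPlus_continuous_mul_left {X : Type*} [TopologicalSpace X] [ChartedSpace ℂ X]
    (g : HomeoPlus X) : Continuous (fun f : HomeoPlus X => g * f) := by
  refine Continuous.subtype_mk (continuous_induced_rng.2 ?_) _
  have h1 : Continuous (fun f : HomeoPlus X => (⟨f.1, f.1.continuous⟩ : C(X, X))) :=
    (continuous_induced_dom (f := fun f : X ≃ₜ X => (⟨f, f.continuous⟩ : C(X, X)))).comp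
      continuous_subtype_val
  exact (ContinuousMap.continuous_postcomp (⟨g.1, g.1.continuous⟩ : C(X, X))).comp h1

theorem homeoPlus_continuous_mul_right {X : Type*} [TopologicalSpace X] [ChartedSpace ℂ X]
    (g : HomeoPlus X) : Continuous (fun f : HomeoPlus X => f * g) := by
  refine Continuous.subtype_mk (continuous_induced_rng.2 ?_) _
  have h1 : Continuous (fun f : HomeoPlus X => (⟨f.1, f.1.continuous⟩ : C(X, X))) :=
    (continuous_induced_dom (f := fun f : X ≃ₜ X => (⟨f, f.continuous⟩ : C(X, X)))).comp
      continuous_subtype_val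
  exact (ContinuousMap.continuous_precomp (⟨g.1, g.1.continuous⟩ : C(X, X))).comp h1

/-- The homeomorphisms isotopic to the identity: those joined to it by a path in `Homeo⁺(X)`. -/
def isotopicToOne (X : Type*) [TopologicalSpace X] [ChartedSpace ℂ X] :
    Subgroup (HomeoPlus X) where
  carrier := {f | Joined 1 f}
  one_mem' := Joined.refl 1
  mul_mem' := fun {f g} hf hg => by
    have h := hg.map (homeoPlus_continuous_mul_left f)
    simp only [mul_one] at h
    exact Joined.trans hf h
  inv_mem' := fun {f} hf => by
    have h := hf.map (homeoPlus_continuous_mul_left f⁻¹)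
    simp only [mul_one, inv_mul_cancel] at h
    exact h.symm

instance isotopicToOne_normal (X : Type*) [TopologicalSpace X] [ChartedSpace ℂ X] :
    (isotopicToOne X).Normal where
  conj_mem := fun f hf g => by
    have h := Joined.map (Joined.map hf (homeoPlus_continuous_mul_left g))
      (homeoPlus_continuous_mul_right g⁻¹)
    simp only [mul_one, mul_inv_cancel] at h
    exact h

/-- The mapping class group `Map(X) = Homeo⁺(X) / isotopy`; as a quotient group it carries the
quotient of the compact-open topology. -/
abbrev MapClassGroup (X : Type*) [TopologicalSpace X] [ChartedSpace ℂ X] : Type _ :=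
  HomeoPlus X ⧸ isotopicToOne X

/-- The mapping class of a homeomorphism. -/
def mapClass {X : Type*} [TopologicalSpace X] [ChartedSpace ℂ X] (f : HomeoPlus X) :
    MapClassGroup X :=
  QuotientGroup.mk f

/-! ### Curves and Dehn twists -/

/-- A simple closed curve, as a subset of `X`. -/
def IsSimpleClosedCurve {X : Type*} [TopologicalSpace X] (c : Set X) : Prop :=
  ∃ p : C(Circle, X), IsEmbedding p ∧ Set.range p = c

/-- An essential simple closed curve: one that is not homotopic to a point. -/
def IsEssentialCurve {X : Type*} [TopologicalSpace X] (c : Set X) : Prop :=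
  ∃ p : C(Circle, X), IsEmbedding p ∧ Set.range p = c ∧ ¬ p.Nullhomotopic

/-- The closed planar annulus `1 ≤ |z| ≤ 2`. -/
def closedAnnulus : Set ℂ := {z | 1 ≤ ‖z‖ ∧ ‖z‖ ≤ 2}

/-- `t` is a left-handed Dehn twist homeomorphism along the curve `c`: for some orientation
preserving embedding `a` of the closed annulus `1 ≤ |z| ≤ 2` whose core circle `|z| = 3/2` is
carried onto `c`, the map `t` is the left twist `(ρ, θ) ↦ (ρ, θ + 2π(ρ - 1))` on the embedded
annulus and the identity outside of it. -/
def IsDehnTwistHomeo {X : Type*} [TopologicalSpace X] [ChartedSpace ℂ X] (c : Set X)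
    (t : HomeoPlus X) : Prop :=
  ∃ a : ℂ → X, ContinuousOn a closedAnnulus ∧ Set.InjOn a closedAnnulus ∧
    (∀ z, 1 < ‖z‖ → ‖z‖ < 2 → OrientationPreservingAt a z) ∧
    a '' Metric.sphere (0 : ℂ) (3 / 2) = c ∧
    (∀ z ∈ closedAnnulus,
      t.1 (a z) = a (z * Complex.exp ((2 * Real.pi * (‖z‖ - 1) : ℝ) * Complex.I))) ∧
    ∀ x, x ∉ a '' closedAnnulus → t.1 x = x

/-- `τ` is the Dehn twist `T_c` in the mapping class group. -/
def IsDehnTwist {X : Type*} [TopologicalSpace X] [ChartedSpace ℂ X] (c : Set X)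
    (τ : MapClassGroup X) : Prop :=
  ∃ t : HomeoPlus X, IsDehnTwistHomeo c t ∧ mapClass t = τ

/-! ### Infinite cyclic covers and lifts -/

/-- `q : L → S` is an orientation preserving regular covering whose deck transformation group is
the infinite cyclic group generated by `h`. -/
structure IsInfiniteCyclicCover {L S : Type*} [TopologicalSpace L] [ChartedSpace ℂ L]
    [TopologicalSpace S] [ChartedSpace ℂ S] (q : L → S) (h : L ≃ₜ L) : Prop where
  isCoveringMap : IsCoveringMap q
  surjective : Function.Surjective q
  orientationPreserving : ∀ x, OrientationPreservingAt q x
  fiber_eq_orbit : ∀ x y : L, q x = q y ↔ ∃ n : ℤ, (h ^ n) x = y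
  infinite_order : ∀ n : ℤ, h ^ n = 1 → n = 0

/-- `f'` is a lift of the homeomorphism `f` under `q`. -/
def IsHomeoLift {L S : Type*} [TopologicalSpace L] [ChartedSpace ℂ L]
    [TopologicalSpace S] [ChartedSpace ℂ S] (q : L → S) (f' : HomeoPlus L) (f : HomeoPlus S) :
    Prop :=
  ∀ x, q (f'.1 x) = f.1 (q x)

/-- The liftable mapping class group `LMod_q(S)`: the mapping classes of `S` that are represented
by a homeomorphism which lifts under `q`. -/
def LMod {L S : Type*} [TopologicalSpace L] [ChartedSpace ℂ L]
    [TopologicalSpace S] [ChartedSpace ℂ S] (q : L → S) : Subgroup (MapClassGroup S) where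
  carrier := {F | ∃ (f : HomeoPlus S) (f' : HomeoPlus L), mapClass f = F ∧ IsHomeoLift q f' f}
  one_mem' := ⟨1, 1, rfl, fun _ => rfl⟩
  mul_mem' := by
    rintro _ _ ⟨f, f', rfl, hf⟩ ⟨g, g', rfl, hg⟩
    refine ⟨f * g, f' * g', rfl, fun x => ?_⟩
    exact (hf (g'.1 x)).trans (congrArg f.1 (hg x))
  inv_mem' := by
    rintro _ ⟨f, f', rfl, hf⟩
    refine ⟨f⁻¹, f'⁻¹, rfl, fun x => ?_⟩
    have h := hf (f'.1.symm x)
    rw [f'.1.apply_symm_apply] at h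
    exact (f.1.symm_apply_eq.2 h).symm

/-- The preimage `q⁻¹(c)` is the family of pairwise disjoint simple closed curves `c' i`. -/
def IsPreimageFamily {L S : Type*} [TopologicalSpace L] (q : L → S) (c : Set S)
    (c' : ℤ → Set L) : Prop :=
  (∀ i, IsSimpleClosedCurve (c' i)) ∧ Pairwise (fun i j => Disjoint (c' i) (c' j)) ∧
    q ⁻¹' c = ⋃ i, c' i

/-- The ordered product `∏_{i=-k}^{k} T i` in a group. -/
def windowProd {G : Type*} [Group G] (T : ℤ → G) (k : ℕ) : G :=
  ((List.range (2 * k + 1)).map (fun j => T ((j : ℤ) - (k : ℤ)))).prod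

/-! Let `t` be a twist supported on a closed annulus `K` with core `γ`. The universal cover of `K`,
a strip, maps to `L`, and one turn along the core acts there as some deck transformation `h ^ m`.
Since `q⁻¹(γ)` consists of simple closed curves, a translate of the lifted core closes up, and
because `h` has infinite order this forces `m = 0` (`IsInfiniteCyclicCover.curve_over_core`). Hence
`K` has a section `σ` (`IsInfiniteCyclicCover.exists_section`): `q⁻¹(K)` is the disjoint union of
the sheets `h ^ n (σ K)`, and the curves `γ_i` are exactly the cores of the sheets, each once.

A homeomorphism `f` supported on `K` can be copied to any set `N` of sheets and extended by the
identity (`sheetLift`). The result is multiplicative in `f`, disjoint unions of sets of sheets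
become products, and for the set of all sheets it is a lift of `f`; over fixed points of `f` it is
always the identity. The copy of `t` on one sheet is a twist about the corresponding `γ_i`, so a
window product is represented by the copy of `t` on a finite set of sheets. As the sheets are
locally finite, these copies eventually agree on each compact set with the full lift, hence converge
to it in the compact-open topology (`tendsto_sheetLift`), and the quotient map to mapping classes is
continuous.

It remains to see that nothing depends on the chosen twist homeomorphism
(`IsOrientedBand.joinedIn_twists`). Given annuli `α` and `β` with the same core, the twist in `α` is
first concentrated to the right of the core, then moved across the core inside an annulus glued from
the right half of `α` and the left half of `β`, then spread out in `β`. Each move is a straight-line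
homotopy of shears in one annulus (`IsBand.joinedIn`) and keeps a boundary point fixed. In `L` this
identifies the copy of `t` on a sheet with the given Dehn twist. In `S` the three isotopies lift
(`IsInfiniteCyclicCover.exists_lift_of_path`), and their fixed points ensure that a lift which is
the identity over fixed points is carried to one of the same kind
(`IsInfiniteCyclicCover.mapClass_lift_twist_eq`).

For products of powers, composition on `Homeo⁺(L)` is continuous, so the limit of the products is
the product of the lifts. Any other representative is reached by lifting an isotopy, and a lift with
a prescribed value at one point of the connected surface `L` is unique.

Orientations are handled through local degrees, that is, winding numbers of images of small circles.
They show that lifts preserve orientation, that the interior of an oriented annulus is open, and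
that the coordinate change between two annuli with the same core either preserves or reverses both
the sides and the direction of the core. In the second case a half turn of one annulus, which does
not change its twist, restores the first. -/

/-! ### Winding numbers of loops in the punctured plane -/

/-- A `2π`-periodic loop `c` avoids `0` and has winding number `d` about it. -/
def HasWinding (c : ℝ → ℂ) (d : ℤ) : Prop :=
  ∃ ϑ : ℝ → ℝ, Continuous ϑ ∧ (∀ s, ϑ (s + 2 * Real.pi) = ϑ s + d * (2 * Real.pi)) ∧
    ∀ s, c s ≠ 0 ∧ c s = ‖c s‖ * Complex.exp (ϑ s * Complex.I)

/-- A continuous integer-valued function on a preconnected space is constant. -/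
theorem eq_of_continuous_intCast {T : Type*} [TopologicalSpace T] [PreconnectedSpace T]
    {f : T → ℝ} (hf : Continuous f) (k : T → ℤ) (hk : ∀ t, f t = k t) (t t' : T) : k t = k t' := by
  have hk' : Continuous k := by
    rw [Int.isClosedEmbedding_coe_real.isEmbedding.continuous_iff]
    exact hf.congr hk
  exact PreconnectedSpace.constant ‹_› hk'

theorem exp_mul_I_eq_iff {a b : ℝ} :
    Complex.exp (a * Complex.I) = Complex.exp (b * Complex.I) ↔
      ∃ n : ℤ, a = b + n * (2 * Real.pi) := by
  rw [Complex.exp_eq_exp_iff_exists_int]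
  refine exists_congr fun n => ⟨fun h => ?_, fun h => ?_⟩
  · have := congrArg Complex.im h
    simpa using this
  · rw [h]; push_cast; ring

/-- Two continuous arguments of the same loop differ by an integer multiple of `2π` that depends
continuously on the parameter, hence by a constant, so they grow equally over a period. -/
theorem HasWinding.unique {c : ℝ → ℂ} {d d' : ℤ} (h : HasWinding c d) (h' : HasWinding c d') :
    d = d' := by
  obtain ⟨ϑ, hϑ, hper, hc⟩ := h
  obtain ⟨η, hη, hper', hc'⟩ := h'
  have key : ∀ s, ∃ n : ℤ, ϑ s = η s + n * (2 * Real.pi) := fun s => by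
    rw [← exp_mul_I_eq_iff]
    have h1 := (hc s).2.symm.trans (hc' s).2
    have h2 : (‖c s‖ : ℂ) ≠ 0 := by simpa using (hc s).1
    exact mul_left_cancel₀ h2 h1
  choose k hk using key
  have hcont : Continuous fun s => (ϑ s - η s) / (2 * Real.pi) := by fun_prop
  have := eq_of_continuous_intCast hcont k
    (fun s => by rw [hk]; field_simp; ring) (0 + 2 * Real.pi) 0
  have h1 := hk (0 + 2 * Real.pi)
  rw [hper, hper', this, hk 0] at h1
  have hpi := Real.pi_pos
  have h2 : (d : ℝ) * (2 * Real.pi) = d' * (2 * Real.pi) := by linarith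
  exact_mod_cast mul_right_cancel₀ (by positivity) h2

/-- The loop lifts through the covering `exp`; the imaginary part of the lift is the argument. -/
theorem exists_hasWinding {c : ℝ → ℂ} (hc : Continuous c)
    (hper : ∀ s, c (s + 2 * Real.pi) = c s) (h0 : ∀ s, c s ≠ 0) : ∃ d, HasWinding c d := by
  obtain ⟨l, ⟨-, hl⟩, -⟩ := Complex.isCoveringMapOn_exp.existsUnique_continuousMap_lifts
    (⟨c, hc⟩ : C(ℝ, ℂ)) (a₀ := 0) (e₀ := Complex.log (c 0)) (Complex.exp_log (h0 0)) h0
  have hl' : ∀ s, Complex.exp (l s) = c s := fun s => congrFun hl s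
  have key : ∀ s, ∃ n : ℤ, l (s + 2 * Real.pi) = l s + n * (2 * Real.pi * Complex.I) := fun s => by
    rw [← Complex.exp_eq_exp_iff_exists_int, hl', hl', hper]
  choose k hk using key
  have hcont : Continuous fun s : ℝ => ((l (s + 2 * Real.pi)).im - (l s).im) / (2 * Real.pi) := by
    fun_prop
  have hkc := eq_of_continuous_intCast hcont k (fun s => by
    rw [hk]; simp)
  refine ⟨k 0, fun s => (l s).im, by fun_prop, fun s => ?_, fun s => ⟨h0 s, ?_⟩⟩
  · beta_reduce; rw [hk, hkc s 0]; simp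
  · rw [← hl' s, Complex.norm_exp, Complex.ofReal_exp, ← Complex.exp_add, Complex.re_add_im]

theorem HasWinding.ne_zero {c : ℝ → ℂ} {d : ℤ} (h : HasWinding c d) (s : ℝ) : c s ≠ 0 := by
  obtain ⟨ϑ, -, -, hc⟩ := h
  exact (hc s).1

/-- A loop that stays closer to `c` than `c` is to the origin has the same winding number. -/
theorem HasWinding.of_close {c c' : ℝ → ℂ} {d : ℤ} (h : HasWinding c d) (hc : Continuous c)
    (hc' : Continuous c') (hper : ∀ s, c (s + 2 * Real.pi) = c s)
    (hper' : ∀ s, c' (s + 2 * Real.pi) = c' s) (hclose : ∀ s, ‖c' s - c s‖ < ‖c s‖) :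
    HasWinding c' d := by
  have h0 := h.ne_zero
  obtain ⟨ϑ, hϑ, hϑper, hϑc⟩ := h
  -- The quotient lies in the unit disc about `1`, where `arg` is continuous, so `arg (c' / c)` is a
  -- periodic correction to the argument of `c`.
  have hslit : ∀ s, c' s / c s ∈ Complex.slitPlane := fun s => by
    refine Complex.mem_slitPlane_of_norm_lt_one (z := c' s / c s - 1) ?_ |> fun h => by simpa using h
    rw [div_sub_one (h0 s), norm_div, div_lt_one (norm_pos_iff.2 (h0 s))]
    exact hclose s
  refine ⟨fun s => ϑ s + (c' s / c s).arg, ?_, fun s => ?_, fun s => ?_⟩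
  · refine hϑ.add (continuous_iff_continuousAt.2 fun s => ?_)
    exact (Complex.continuousAt_arg (hslit s)).comp (f := fun s => c' s / c s)
      (hc'.continuousAt.div hc.continuousAt (h0 s))
  · beta_reduce; rw [hϑper, hper, hper']; ring
  · have hne : c' s ≠ 0 := fun h => by
      have := hclose s
      rw [h, zero_sub, norm_neg] at this
      exact lt_irrefl _ this
    refine ⟨hne, ?_⟩
    have h1 := Complex.norm_mul_exp_arg_mul_I (c' s / c s)
    have h2 := (hϑc s).2
    have h3 : c' s = c s * (c' s / c s) := by field_simp [h0 s]
    have h4 : (‖c' s‖ : ℂ) = ‖c s‖ * ‖c' s / c s‖ := by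
      rw [← Complex.ofReal_mul, ← norm_mul, ← h3]
    rw [h4, Complex.ofReal_add, add_mul, Complex.exp_add, mul_mul_mul_comm, ← h2, h1]
    exact h3

/-- Winding numbers are locally constant in continuous families of loops. -/
theorem eventually_hasWinding_iff {T : Type*} [TopologicalSpace T] {C : T → ℝ → ℂ} {t₀ : T}
    (hC : ∀ s, ContinuousAt (Function.uncurry C) (t₀, s))
    (hcont : ∀ᶠ t in 𝓝 t₀, Continuous (C t))
    (hper : ∀ᶠ t in 𝓝 t₀, ∀ s, C t (s + 2 * Real.pi) = C t s)
    (h0 : ∀ᶠ t in 𝓝 t₀, ∀ s, C t s ≠ 0) :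
    ∀ᶠ t in 𝓝 t₀, ∀ d, HasWinding (C t) d ↔ HasWinding (C t₀) d := by
  have hpi := Real.pi_pos
  have hclose : ∀ᶠ t in 𝓝 t₀, ∀ s ∈ Set.Icc 0 (2 * Real.pi), ‖C t s - C t₀ s‖ < ‖C t₀ s‖ := by
    refine isCompact_Icc.eventually_forall_of_forall_eventually fun s _ => ?_
    have h1 : ContinuousAt (fun p : T × ℝ => ‖C p.1 p.2 - C t₀ p.2‖) (t₀, s) :=
      ((hC s).sub ((hcont.self_of_nhds).continuousAt.comp continuousAt_snd)).norm
    have h2 : ContinuousAt (fun p : T × ℝ => ‖C t₀ p.2‖) (t₀, s) :=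
      ((hcont.self_of_nhds).continuousAt.comp continuousAt_snd).norm
    refine h1.eventually_lt h2 ?_
    simpa using h0.self_of_nhds s
  filter_upwards [hclose, hcont, hper, h0] with t h1 h2 h3 h4 d
  have hall : ∀ s, ‖C t s - C t₀ s‖ < ‖C t₀ s‖ := fun s => by
    obtain ⟨y, hy, hys⟩ := Function.Periodic.exists_mem_Ico₀ (f := fun s => (C t s, C t₀ s))
      (c := 2 * Real.pi) (fun s => by simp only [h3, hper.self_of_nhds]) (by positivity) s
    simp only [Prod.mk.injEq] at hys
    rw [hys.1, hys.2]
    exact h1 y (Set.Ico_subset_Icc_self hy)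
  have hfwd : ∀ d, HasWinding (C t₀) d → HasWinding (C t) d := fun d h =>
    h.of_close hcont.self_of_nhds h2 hper.self_of_nhds h3 hall
  refine ⟨fun h => ?_, hfwd d⟩
  obtain ⟨d', hd'⟩ := exists_hasWinding hcont.self_of_nhds hper.self_of_nhds h0.self_of_nhds
  rwa [h.unique (hfwd d' hd')]

/-- Homotopy invariance of the winding number. -/
theorem HasWinding.homotopy {T : Type*} [TopologicalSpace T] [PreconnectedSpace T] {C : T → ℝ → ℂ}
    (hC : Continuous (Function.uncurry C)) (hper : ∀ t s, C t (s + 2 * Real.pi) = C t s)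
    (h0 : ∀ t s, C t s ≠ 0) {t t' : T} {d : ℤ} (h : HasWinding (C t) d) : HasWinding (C t') d := by
  have hev : ∀ t₀, ∀ᶠ t in 𝓝 t₀, ∀ d, HasWinding (C t) d ↔ HasWinding (C t₀) d := fun t₀ =>
    eventually_hasWinding_iff (fun _ => hC.continuousAt)
      (.of_forall fun t => hC.comp (Continuous.prodMk_right t)) (.of_forall hper) (.of_forall h0)
  have hclopen : IsClopen {t | HasWinding (C t) d} := by
    refine ⟨isOpen_compl_iff.1 (isOpen_iff_mem_nhds.2 fun t₀ ht₀ => ?_),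
      isOpen_iff_mem_nhds.2 fun t₀ ht₀ => ?_⟩
    · filter_upwards [hev t₀] with t ht h
      exact ht₀ ((ht d).1 h)
    · filter_upwards [hev t₀] with t ht
      exact (ht d).2 ht₀
  exact (Set.ext_iff.1 (hclopen.eq_univ ⟨t, h⟩) t').2 trivial

theorem hasWinding_const {w : ℂ} (hw : w ≠ 0) : HasWinding (fun _ => w) 0 :=
  ⟨fun _ => w.arg, continuous_const, fun s => by simp, fun s =>
    ⟨hw, (Complex.norm_mul_exp_arg_mul_I w).symm⟩⟩

/-- Two loops that are nowhere in opposite directions have the same winding number. -/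
theorem HasWinding.of_segment {c c' : ℝ → ℂ} {d : ℤ} (h : HasWinding c d) (hc : Continuous c)
    (hc' : Continuous c') (hper : ∀ s, c (s + 2 * Real.pi) = c s)
    (hper' : ∀ s, c' (s + 2 * Real.pi) = c' s)
    (hseg : ∀ s, ∀ u ∈ Set.Icc (0 : ℝ) 1, (1 - u) * c s + u * c' s ≠ 0) : HasWinding c' d := by
  have := HasWinding.homotopy (T := unitInterval) (t := 0) (t' := 1) (d := d)
    (C := fun u s => (1 - (u : ℝ)) * c s + (u : ℝ) * c' s) (by fun_prop)
    (fun t s => by rw [hper, hper']) (fun t s => hseg s t t.2) (by simpa using h)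
  simpa using this

/-- The image under `F` of a loop of winding number `d` in a punctured disc. -/
theorem HasWinding.comp {c : ℝ → ℂ} {d m : ℤ} {R ρ : ℝ} {F : ℂ → ℂ} (h : HasWinding c d)
    (hc : Continuous c) (hper : ∀ s, c (s + 2 * Real.pi) = c s) (hR : ∀ s, ‖c s‖ ≤ R)
    (hF : ∀ w, w ≠ 0 → ‖w‖ ≤ R → ContinuousAt F w) (hF0 : ∀ w, w ≠ 0 → ‖w‖ ≤ R → F w ≠ 0)
    (hρ : 0 < ρ) (hρR : ρ ≤ R)
    (hm : HasWinding (fun s => F (ρ * Complex.exp (s * Complex.I))) m) :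
    HasWinding (fun s => F (c s)) (d * m) := by
  obtain ⟨ϑ, hϑ, hϑper, hϑc⟩ := h
  have hpos : ∀ s, 0 < ‖c s‖ := fun s => norm_pos_iff.2 (hϑc s).1
  -- Interpolate the logarithm of the modulus and the argument linearly: `u = 1` gives `c`, `u = 0`
  -- gives the circle of radius `ρ` run `d` times, and the modulus stays in `(0, R]`.
  let W : unitInterval → ℝ → ℂ := fun u s =>
    Real.exp (u * Real.log ‖c s‖ + (1 - u) * Real.log ρ) *
      Complex.exp ((u * ϑ s + (1 - u) * (d * s) : ℝ) * Complex.I)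
  have hlog : Continuous fun s => Real.log ‖c s‖ := hc.norm.log fun s => (hpos s).ne'
  have hW : Continuous (Function.uncurry W) := by
    have h1 : Continuous fun p : unitInterval × ℝ => Real.log ‖c p.2‖ := hlog.comp continuous_snd
    simp only [W, Function.uncurry_def]
    fun_prop (disch := exact fun x => (hpos _).ne')
  have hnorm : ∀ u s, ‖W u s‖ = Real.exp (u * Real.log ‖c s‖ + (1 - u) * Real.log ρ) := fun u s => by
    simp only [W, norm_mul, Complex.norm_exp_ofReal_mul_I, mul_one, Complex.norm_real, Real.norm_eq_abs,
      Real.abs_exp]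
  have hW0 : ∀ u s, W u s ≠ 0 := fun u s => by
    rw [← norm_pos_iff, hnorm]; positivity
  have hWR : ∀ u s, ‖W u s‖ ≤ R := fun u s => by
    have hRpos := hρ.trans_le hρR
    rw [hnorm, ← Real.le_log_iff_exp_le hRpos]
    have h1 := Real.log_le_log (hpos s) (hR s)
    have h2 := Real.log_le_log hρ hρR
    have := u.2.1
    have := u.2.2
    nlinarith
  have hend := HasWinding.homotopy (T := unitInterval) (t := 0) (t' := 1) (d := d * m)
    (C := fun u s => F (W u s))
    (continuous_iff_continuousAt.2 fun p =>
      (hF _ (hW0 p.1 p.2) (hWR p.1 p.2)).comp (f := fun p : unitInterval × ℝ => W p.1 p.2)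
        hW.continuousAt) (fun u s => ?_) (fun u s => hF0 _ (hW0 u s) (hWR u s)) ?_
  · refine (funext fun s => congrArg F ?_ : (fun s => F (W 1 s)) = fun s => F (c s)) ▸ hend
    simp only [W]
    rw [(hϑc s).2]
    simp [Real.exp_log (hpos s)]
  · congr 1
    simp only [W]
    rw [hper]
    congr 1
    rw [exp_mul_I_eq_iff]
    exact ⟨d, by rw [hϑper]; ring⟩
  · obtain ⟨η, hη, hηper, hηc⟩ := hm
    have hηd : ∀ (n : ℤ) s, η (s + n * (2 * Real.pi)) = η s + n * (m * (2 * Real.pi)) := fun n s => by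
      have h1 : Function.Periodic (fun s => η s - m * s) (2 * Real.pi) := fun s => by
        simp only [hηper]; ring
      have h2 := h1.int_mul n s
      linarith
    refine ⟨fun s => η (d * s), by fun_prop, fun s => ?_, fun s => ?_⟩
    · beta_reduce; rw [mul_add, hηd]; push_cast; ring
    · have := hηc (d * s)
      simp only [W]
      simpa [Real.exp_log hρ] using this

/-! ### Local degree of planar maps -/

theorem planarOrientationPreservingAt_iff {g : ℂ → ℂ} {z : ℂ} :
    PlanarOrientationPreservingAt g z ↔ ∀ᶠ r : ℝ in 𝓝[>] 0,
      HasWinding (fun s => g (z + r * Complex.exp (s * Complex.I)) - g z) 1 := by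
  simp only [PlanarOrientationPreservingAt, HasWinding, Int.cast_one, one_mul, sub_ne_zero]

theorem norm_ofReal_mul_exp {r : ℝ} (hr : 0 ≤ r) (s : ℝ) :
    ‖(r : ℂ) * Complex.exp (s * Complex.I)‖ = r := by
  rw [norm_mul, Complex.norm_exp_ofReal_mul_I, mul_one, Complex.norm_real, Real.norm_of_nonneg hr]

theorem exp_add_two_pi_mul_I (s : ℝ) :
    Complex.exp ((s + 2 * Real.pi : ℝ) * Complex.I) = Complex.exp (s * Complex.I) :=
  exp_mul_I_eq_iff.2 ⟨1, by simp⟩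

theorem circle_mem_closedBall (z : ℂ) {r R : ℝ} (hr : 0 ≤ r) (hrR : r ≤ R) (s : ℝ) :
    z + r * Complex.exp (s * Complex.I) ∈ Metric.closedBall z R := by
  rw [Metric.mem_closedBall, dist_eq_norm, add_sub_cancel_left, norm_ofReal_mul_exp hr]
  exact hrR

theorem continuous_circleLoop {g : ℂ → ℂ} {z : ℂ} {r R : ℝ}
    (hg : ∀ w ∈ Metric.closedBall z R, ContinuousAt g w) (hr : 0 ≤ r) (hrR : r ≤ R) :
    Continuous fun s : ℝ => g (z + r * Complex.exp (s * Complex.I)) - g z := by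
  refine Continuous.sub (continuous_iff_continuousAt.2 fun s => ?_) continuous_const
  exact (hg _ (circle_mem_closedBall z hr hrR s)).comp
    (f := fun s : ℝ => z + r * Complex.exp (s * Complex.I)) (by fun_prop)

theorem circleLoop_periodic (g : ℂ → ℂ) (z : ℂ) (r s : ℝ) :
    g (z + r * Complex.exp ((s + 2 * Real.pi : ℝ) * Complex.I)) - g z =
      g (z + r * Complex.exp (s * Complex.I)) - g z := by
  rw [exp_add_two_pi_mul_I]

/-- One small circle decides whether `g` preserves orientation. -/
theorem planarOrientationPreservingAt_iff_hasWinding {g : ℂ → ℂ} {z : ℂ} {r R : ℝ}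
    (hg : ∀ w ∈ Metric.closedBall z R, ContinuousAt g w)
    (hinj : ∀ w ∈ Metric.closedBall z R, g w = g z → w = z) (hr : 0 < r) (hrR : r ≤ R) :
    PlanarOrientationPreservingAt g z ↔
      HasWinding (fun s => g (z + r * Complex.exp (s * Complex.I)) - g z) 1 := by
  have key : ∀ r' ∈ Set.Ioc 0 R, ∀ r'' ∈ Set.Ioc 0 R,
      HasWinding (fun s => g (z + r' * Complex.exp (s * Complex.I)) - g z) 1 →
      HasWinding (fun s => g (z + r'' * Complex.exp (s * Complex.I)) - g z) 1 := by
    intro r' hr' r'' hr'' h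
    have : PreconnectedSpace (Set.Ioc (0 : ℝ) R) :=
      isPreconnected_iff_preconnectedSpace.1 isPreconnected_Ioc
    refine HasWinding.homotopy (T := Set.Ioc (0 : ℝ) R) (t := ⟨r', hr'⟩) (t' := ⟨r'', hr''⟩)
      (C := fun ρ s => g (z + (ρ : ℝ) * Complex.exp (s * Complex.I)) - g z) ?_ ?_ ?_ h
    · refine Continuous.sub (continuous_iff_continuousAt.2 fun p => ?_) continuous_const
      exact (hg _ (circle_mem_closedBall z p.1.2.1.le p.1.2.2 p.2)).comp
        (f := fun p : Set.Ioc (0 : ℝ) R × ℝ => z + (p.1 : ℝ) * Complex.exp (p.2 * Complex.I))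
        (by fun_prop)
    · exact fun t s => circleLoop_periodic g z t s
    · intro t s h0
      have h1 := hinj _ (circle_mem_closedBall z t.2.1.le t.2.2 s) (sub_eq_zero.1 h0)
      have h2 := norm_ofReal_mul_exp t.2.1.le s
      rw [add_eq_left.1 h1, norm_zero] at h2
      exact t.2.1.ne h2
  rw [planarOrientationPreservingAt_iff]
  constructor
  · intro h
    obtain ⟨r', h1, h2⟩ := (h.and (Ioc_mem_nhdsGT (hr.trans_le hrR))).exists
    exact key r' h2 r ⟨hr, hrR⟩ h1
  · intro h
    filter_upwards [Ioc_mem_nhdsGT (hr.trans_le hrR)] with r' hr'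
    exact key r ⟨hr, hrR⟩ r' hr' h

theorem exists_closedBall_of_eventually {p : ℂ → Prop} {z : ℂ} (h : ∀ᶠ w in 𝓝 z, p w) :
    ∃ R > 0, ∀ w ∈ Metric.closedBall z R, p w :=
  Metric.nhds_basis_closedBall.eventually_iff.1 h

/-- All sufficiently small circles are covered by the definition, and they fill a punctured disc on
which `g` avoids the value `g z`. -/
theorem PlanarOrientationPreservingAt.eventually_ne {g : ℂ → ℂ} {z : ℂ}
    (h : PlanarOrientationPreservingAt g z) : ∀ᶠ w in 𝓝 z, g w = g z → w = z := by
  rw [planarOrientationPreservingAt_iff] at h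
  obtain ⟨R, hR, h⟩ := mem_nhdsGT_iff_exists_Ioo_subset.1 h
  filter_upwards [Metric.ball_mem_nhds z hR] with w hw hgw
  by_contra hne
  have hpos : 0 < ‖w - z‖ := norm_pos_iff.2 (sub_ne_zero.2 hne)
  have := (h ⟨hpos, by simpa [dist_eq_norm] using hw⟩).ne_zero (w - z).arg
  rw [Complex.norm_mul_exp_arg_mul_I] at this
  simp [hgw] at this

theorem PlanarOrientationPreservingAt.congr {g g' : ℂ → ℂ} {z : ℂ}
    (h : PlanarOrientationPreservingAt g z) (hgg : g =ᶠ[𝓝 z] g') :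
    PlanarOrientationPreservingAt g' z := by
  rw [planarOrientationPreservingAt_iff] at h ⊢
  obtain ⟨R, hR, hgg'⟩ := exists_closedBall_of_eventually hgg
  filter_upwards [h, Ioc_mem_nhdsGT hR] with r hr hrR
  rw [← hgg.self_of_nhds]
  simpa only [← hgg' _ (circle_mem_closedBall z hrR.1.le hrR.2 _)] using hr

/-- Local degrees multiply under composition. The radius `R` depends on `f` alone, so the circle
around `g z` that measures the degree of `f` may be fixed before the circle around `z`. -/
theorem planar_winding_comp {f g : ℂ → ℂ} {z : ℂ} (hg : ∀ᶠ w in 𝓝 z, ContinuousAt g w)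
    (hf : ∀ᶠ w in 𝓝 (g z), ContinuousAt f w) (hf0 : ∀ᶠ w in 𝓝 (g z), f w = f (g z) → w = g z) :
    ∃ R > 0, ∀ᶠ r : ℝ in 𝓝[>] 0, ∀ (d m : ℤ) (ρ : ℝ), 0 < ρ → ρ ≤ R →
      HasWinding (fun s => g (z + r * Complex.exp (s * Complex.I)) - g z) d →
      HasWinding (fun s => f (g z + ρ * Complex.exp (s * Complex.I)) - f (g z)) m →
      HasWinding (fun s => f (g (z + r * Complex.exp (s * Complex.I))) - f (g z)) (d * m) := by
  obtain ⟨R, hR, hfR⟩ := exists_closedBall_of_eventually (hf.and hf0)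
  refine ⟨R, hR, ?_⟩
  obtain ⟨R', hR', hgR⟩ := exists_closedBall_of_eventually
    (hg.and (hg.self_of_nhds.eventually (Metric.closedBall_mem_nhds (g z) hR)))
  filter_upwards [Ioc_mem_nhdsGT hR'] with r hr d m ρ hρ hρR hd hm
  have hmem := circle_mem_closedBall z hr.1.le hr.2
  have hF : ∀ w : ℂ, ‖w‖ ≤ R → g z + w ∈ Metric.closedBall (g z) R := fun w hw => by
    simpa [dist_eq_norm] using hw
  have := hd.comp (F := fun w => f (g z + w) - f (g z)) (R := R)
    (continuous_circleLoop (fun w hw => (hgR w hw).1) hr.1.le hr.2)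
    (fun s => circleLoop_periodic g z r s)
    (fun s => by simpa [dist_eq_norm] using (hgR _ (hmem s)).2)
    (fun w _ hw => ContinuousAt.sub
      (ContinuousAt.comp (f := fun w => g z + w) (hfR _ (hF w hw)).1 (by fun_prop))
      continuousAt_const)
    (fun w hw0 hw h0 => hw0 (by simpa using (hfR _ (hF w hw)).2 (sub_eq_zero.1 h0)))
    hρ hρR hm
  simpa using this

theorem PlanarOrientationPreservingAt.comp {f g : ℂ → ℂ} {z : ℂ}
    (hfo : PlanarOrientationPreservingAt f (g z)) (hgo : PlanarOrientationPreservingAt g z)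
    (hf : ∀ᶠ w in 𝓝 (g z), ContinuousAt f w) (hg : ∀ᶠ w in 𝓝 z, ContinuousAt g w) :
    PlanarOrientationPreservingAt (fun w => f (g w)) z := by
  obtain ⟨R, hR, h⟩ := planar_winding_comp hg hf hfo.eventually_ne
  rw [planarOrientationPreservingAt_iff] at hfo hgo ⊢
  obtain ⟨ρ, hρ, hρR⟩ := (hfo.and (Ioc_mem_nhdsGT hR)).exists
  filter_upwards [h, hgo] with r hr hgr
  simpa using hr 1 1 ρ hρR.1 hρR.2 hgr hρ

/-- The loop of `g` misses the origin because that of `f ∘ g` does; its degree `d` then satisfies `d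
* 1 = 1`. -/
theorem PlanarOrientationPreservingAt.of_comp_left {f g : ℂ → ℂ} {z : ℂ}
    (hfg : PlanarOrientationPreservingAt (fun w => f (g w)) z)
    (hfo : PlanarOrientationPreservingAt f (g z))
    (hf : ∀ᶠ w in 𝓝 (g z), ContinuousAt f w) (hg : ∀ᶠ w in 𝓝 z, ContinuousAt g w) :
    PlanarOrientationPreservingAt g z := by
  obtain ⟨R, hR, h⟩ := planar_winding_comp hg hf hfo.eventually_ne
  rw [planarOrientationPreservingAt_iff] at hfo hfg ⊢
  obtain ⟨ρ, hρ, hρR⟩ := (hfo.and (Ioc_mem_nhdsGT hR)).exists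
  obtain ⟨R', hR', hgR⟩ := exists_closedBall_of_eventually hg
  filter_upwards [h, hfg, Ioc_mem_nhdsGT hR'] with r hr hfgr hrR
  obtain ⟨d, hd⟩ := exists_hasWinding (continuous_circleLoop hgR hrR.1.le hrR.2)
    (circleLoop_periodic g z r)
    (fun s h0 => hfgr.ne_zero s (by simp only [sub_eq_zero.1 h0, sub_self]))
  have := (hr d 1 ρ hρR.1 hρR.2 hd hρ).unique hfgr
  rw [mul_one] at this
  exact this ▸ hd

/-- Here `f` must be assumed not to repeat the value `f (g z)` nearby, in order that its small loops
have a degree `m`; then `1 * m = 1`. -/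
theorem PlanarOrientationPreservingAt.of_comp_right {f g : ℂ → ℂ} {z : ℂ}
    (hfg : PlanarOrientationPreservingAt (fun w => f (g w)) z)
    (hgo : PlanarOrientationPreservingAt g z)
    (hf : ∀ᶠ w in 𝓝 (g z), ContinuousAt f w) (hf0 : ∀ᶠ w in 𝓝 (g z), f w = f (g z) → w = g z)
    (hg : ∀ᶠ w in 𝓝 z, ContinuousAt g w) :
    PlanarOrientationPreservingAt f (g z) := by
  obtain ⟨R, hR, h⟩ := planar_winding_comp hg hf hf0
  obtain ⟨R', hR', hfR⟩ := exists_closedBall_of_eventually (hf.and hf0)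
  rw [planarOrientationPreservingAt_iff] at hfg hgo ⊢
  obtain ⟨r, hr, hfgr, hgr⟩ := (h.and (hfg.and hgo)).exists
  filter_upwards [Ioc_mem_nhdsGT hR, Ioc_mem_nhdsGT hR'] with ρ hρ hρ'
  have hmem := circle_mem_closedBall (g z) hρ'.1.le hρ'.2
  obtain ⟨m, hm⟩ := exists_hasWinding
    (continuous_circleLoop (fun w hw => (hfR w hw).1) hρ'.1.le hρ'.2)
    (circleLoop_periodic f (g z) ρ)
    (fun s h0 => by
      have h1 := (hfR _ (hmem s)).2 (sub_eq_zero.1 h0)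
      have h2 := norm_ofReal_mul_exp hρ.1.le s
      rw [add_eq_left.1 h1, norm_zero] at h2
      exact hρ.1.ne h2)
  have := (hr 1 m ρ hρ.1 hρ.2 hgr hm).unique hfgr
  rw [one_mul] at this
  subst this
  exact hm

/-- Invariance of domain for orientation preserving maps. -/
theorem PlanarOrientationPreservingAt.image_mem_nhds {g : ℂ → ℂ} {z : ℂ} {V : Set ℂ}
    (h : PlanarOrientationPreservingAt g z) (hg : ∀ᶠ w in 𝓝 z, ContinuousAt g w) (hV : V ∈ 𝓝 z) :
    g '' V ∈ 𝓝 (g z) := by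
  obtain ⟨R, hR, hgR⟩ := exists_closedBall_of_eventually (hg.and hV)
  rw [planarOrientationPreservingAt_iff] at h
  obtain ⟨r, hr, hrR⟩ := (h.and (Ioc_mem_nhdsGT hR)).exists
  have hcont := continuous_circleLoop (fun w hw => (hgR w hw).1) hrR.1.le hrR.2
  have hper := circleLoop_periodic g z r
  obtain ⟨s₀, -, hs₀⟩ := isCompact_Icc.exists_isMinOn (s := Set.Icc (0 : ℝ) (2 * Real.pi))
    ⟨0, by simp [Real.pi_pos.le]⟩ hcont.norm.continuousOn
  set μ := ‖g (z + r * Complex.exp (s₀ * Complex.I)) - g z‖ with hμ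
  have hμpos : 0 < μ := norm_pos_iff.2 (hr.ne_zero s₀)
  have hμle : ∀ s : ℝ, μ ≤ ‖g (z + r * Complex.exp (s * Complex.I)) - g z‖ := fun s => by
    obtain ⟨y, hy, hys⟩ := Function.Periodic.exists_mem_Ico₀
      (f := fun s : ℝ => g (z + r * Complex.exp (s * Complex.I)) - g z) hper
      (by have := Real.pi_pos; positivity) s
    rw [hys]
    exact hs₀ (Set.Ico_subset_Icc_self hy)
  filter_upwards [Metric.ball_mem_nhds (g z) hμpos] with w hw
  by_contra hnot
  have hne : ∀ v ∈ Metric.closedBall z R, g v - w ≠ 0 := fun v hv h0 =>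
    hnot ⟨v, (hgR v hv).2, sub_eq_zero.1 h0⟩
  have hmul : ∀ t : unitInterval, 0 ≤ (t : ℝ) * r ∧ t * r ≤ R := fun t =>
    ⟨mul_nonneg t.2.1 hrR.1.le, (mul_le_of_le_one_left hrR.1.le t.2.2).trans hrR.2⟩
  have h1 : HasWinding (fun s => g (z + r * Complex.exp (s * Complex.I)) - w) 1 := by
    refine hr.of_close hcont ?_ hper (fun s => by rw [exp_add_two_pi_mul_I]) fun s => ?_
    · simpa using hcont.add_const (g z - w)
    · refine lt_of_lt_of_le ?_ (hμle s)
      rwa [sub_sub_sub_cancel_left, ← dist_eq_norm, dist_comm, ← Metric.mem_ball]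
  -- If `w` were omitted, shrinking the circle to its centre would be a homotopy in the complement
  -- of `w` from a loop of winding number `1` to a constant loop.
  have h0 := HasWinding.homotopy (T := unitInterval) (t := 1) (t' := 0) (d := 1)
    (C := fun t s => g (z + (t * r : ℝ) * Complex.exp (s * Complex.I)) - w)
    (Continuous.sub (continuous_iff_continuousAt.2 fun p =>
      (hgR _ (circle_mem_closedBall z (hmul p.1).1 (hmul p.1).2 p.2)).1.comp
        (f := fun p : unitInterval × ℝ => z + (p.1 * r : ℝ) * Complex.exp (p.2 * Complex.I))
        (by fun_prop)) continuous_const)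
    (fun t s => by rw [exp_add_two_pi_mul_I])
    (fun t s => hne _ (circle_mem_closedBall z (hmul t).1 (hmul t).2 s)) (by simpa using h1)
  have h2 := hasWinding_const (hne z (Metric.mem_closedBall_self hR.le))
  exact one_ne_zero (HasWinding.unique (by simpa using h0) h2)

theorem planarOrientationPreservingAt_id (z : ℂ) : PlanarOrientationPreservingAt (fun w => w) z := by
  rw [planarOrientationPreservingAt_iff]
  filter_upwards [self_mem_nhdsWithin] with r hr
  have hr : 0 < r := hr
  refine ⟨fun s => s, continuous_id, fun s => by simp, fun s => ⟨?_, ?_⟩⟩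
  · beta_reduce
    rw [add_sub_cancel_left, ← norm_pos_iff, norm_ofReal_mul_exp hr.le]
    exact hr
  · beta_reduce
    rw [add_sub_cancel_left, norm_ofReal_mul_exp hr.le]

/-! ### Orientation preserving maps of surfaces -/

section Readings

variable {X Y Z : Type*} [TopologicalSpace X] [TopologicalSpace Y] [TopologicalSpace Z]

theorem eventually_continuousAt_reading {e : OpenPartialHomeomorph X ℂ}
    {e' : OpenPartialHomeomorph Y ℂ} {f : X → Y} {x : X} (hx : x ∈ e.source)
    (hfx : f x ∈ e'.source) (hf : ∀ᶠ x' in 𝓝 x, ContinuousAt f x') :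
    ∀ᶠ w in 𝓝 (e x), ContinuousAt (fun w => e' (f (e.symm w))) w := by
  have h1 : ∀ᶠ x' in 𝓝 x, ContinuousAt f x' ∧ f x' ∈ e'.source :=
    hf.and (hf.self_of_nhds.eventually (e'.open_source.mem_nhds hfx))
  have h2 := (e.continuousAt_symm (e.map_source hx)).eventually
    ((e.left_inv hx).symm ▸ h1 : ∀ᶠ x' in 𝓝 (e.symm (e x)), _)
  filter_upwards [h2, e.open_target.mem_nhds (e.map_source hx)] with w hw hwt
  exact (e'.continuousAt hw.2).comp (f := fun w => f (e.symm w))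
    (ContinuousAt.comp (f := e.symm) hw.1 (e.continuousAt_symm hwt))

/-- Inserting a chart of the middle space does not change the germ; this reduces statements on
compositions of surface maps to planar ones. -/
theorem reading_comp_eventuallyEq {f : X → Y} {g : Y → Z} {x : X} (hf : ContinuousAt f x)
    {e : OpenPartialHomeomorph X ℂ} (e₁ : OpenPartialHomeomorph Y ℂ)
    (e' : OpenPartialHomeomorph Z ℂ) (hx : x ∈ e.source) (hfx : f x ∈ e₁.source) :
    (fun w => e' (g (e₁.symm (e₁ (f (e.symm w)))))) =ᶠ[𝓝 (e x)] fun w => e' (g (f (e.symm w))) := by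
  have h1 := (e.continuousAt_symm (e.map_source hx)).eventually
    ((e.left_inv hx).symm ▸ hf.eventually (e₁.open_source.mem_nhds hfx) :
      ∀ᶠ x' in 𝓝 (e.symm (e x)), f x' ∈ e₁.source)
  filter_upwards [h1] with w hw
  rw [e₁.left_inv hw]

theorem eventually_continuousAt_transition {e e' : OpenPartialHomeomorph X ℂ} {x : X}
    (hx : x ∈ e.source) (hx' : x ∈ e'.source) :
    ∀ᶠ w in 𝓝 (e x), ContinuousAt (fun w => e' (e.symm w)) w :=
  eventually_continuousAt_reading (f := fun x => x) hx hx' (.of_forall fun _ => continuousAt_id)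

end Readings

section Surfaces

variable {X Y Z : Type*} [TopologicalSpace X] [ChartedSpace ℂ X] [TopologicalSpace Y]
  [ChartedSpace ℂ Y] [TopologicalSpace Z] [ChartedSpace ℂ Z]

theorem OrientationPreservingAt.congr {f f' : X → Y} {x : X} (h : OrientationPreservingAt f x)
    (hff : f =ᶠ[𝓝 x] f') : OrientationPreservingAt f' x := by
  have hx := mem_chart_source ℂ x
  have h1 := (chartAt ℂ x).continuousAt_symm ((chartAt ℂ x).map_source hx)
  refine PlanarOrientationPreservingAt.congr h ?_
  rw [hff.self_of_nhds]
  filter_upwards [h1.eventually (((chartAt ℂ x).left_inv hx).symm ▸ hff :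
    ∀ᶠ x' in 𝓝 ((chartAt ℂ x).symm (chartAt ℂ x x)), _)] with w hw
  rw [hw]

theorem OrientationPreservingAt.comp {g : Y → Z} {f : X → Y} {x : X}
    (hg : OrientationPreservingAt g (f x)) (hf : OrientationPreservingAt f x)
    (hgc : ∀ᶠ y in 𝓝 (f x), ContinuousAt g y) (hfc : ∀ᶠ y in 𝓝 x, ContinuousAt f y) :
    OrientationPreservingAt (fun y => g (f y)) x := by
  have hx := mem_chart_source ℂ x
  have hy := mem_chart_source ℂ (f x)
  have hl := (chartAt ℂ x).left_inv hx
  refine PlanarOrientationPreservingAt.congr ?_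
    (reading_comp_eventuallyEq hfc.self_of_nhds (chartAt ℂ (f x)) (chartAt ℂ (g (f x))) hx hy)
  refine PlanarOrientationPreservingAt.comp
    (f := fun w => chartAt ℂ (g (f x)) (g ((chartAt ℂ (f x)).symm w)))
    (g := fun w => chartAt ℂ (f x) (f ((chartAt ℂ x).symm w))) ?_ hf ?_
    (eventually_continuousAt_reading hx hy hfc)
  · simpa only [hl, OrientationPreservingAt] using hg
  · simpa only [hl] using eventually_continuousAt_reading hy (mem_chart_source ℂ _) hgc

theorem OrientationPreservingAt.of_comp_left {g : Y → Z} {f : X → Y} {x : X}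
    (h : OrientationPreservingAt (fun y => g (f y)) x)
    (hg : OrientationPreservingAt g (f x))
    (hgc : ∀ᶠ y in 𝓝 (f x), ContinuousAt g y) (hfc : ∀ᶠ y in 𝓝 x, ContinuousAt f y) :
    OrientationPreservingAt f x := by
  have hx := mem_chart_source ℂ x
  have hy := mem_chart_source ℂ (f x)
  have hl := (chartAt ℂ x).left_inv hx
  refine PlanarOrientationPreservingAt.of_comp_left
    (f := fun w => chartAt ℂ (g (f x)) (g ((chartAt ℂ (f x)).symm w)))
    (g := fun w => chartAt ℂ (f x) (f ((chartAt ℂ x).symm w)))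
    (PlanarOrientationPreservingAt.congr h (reading_comp_eventuallyEq hfc.self_of_nhds
      (chartAt ℂ (f x)) (chartAt ℂ (g (f x))) hx hy).symm) ?_ ?_
    (eventually_continuousAt_reading hx hy hfc)
  · simpa only [hl, OrientationPreservingAt] using hg
  · simpa only [hl] using eventually_continuousAt_reading hy (mem_chart_source ℂ _) hgc

theorem OrientationPreservingAt.of_comp_right {g : Y → Z} {f : X → Y} {x : X}
    (h : OrientationPreservingAt (fun y => g (f y)) x)
    (hf : OrientationPreservingAt f x)
    (hgc : ∀ᶠ y in 𝓝 (f x), ContinuousAt g y) (hgi : ∀ᶠ y in 𝓝 (f x), g y = g (f x) → y = f x)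
    (hfc : ∀ᶠ y in 𝓝 x, ContinuousAt f y) :
    OrientationPreservingAt g (f x) := by
  have hx := mem_chart_source ℂ x
  have hy := mem_chart_source ℂ (f x)
  have hz := mem_chart_source ℂ (g (f x))
  have hl := (chartAt ℂ x).left_inv hx
  have hly := (chartAt ℂ (f x)).left_inv hy
  have := PlanarOrientationPreservingAt.of_comp_right
    (f := fun w => chartAt ℂ (g (f x)) (g ((chartAt ℂ (f x)).symm w)))
    (g := fun w => chartAt ℂ (f x) (f ((chartAt ℂ x).symm w))) (z := chartAt ℂ x x)
    (PlanarOrientationPreservingAt.congr h (reading_comp_eventuallyEq hfc.self_of_nhds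
      (chartAt ℂ (f x)) (chartAt ℂ (g (f x))) hx hy).symm) hf ?_ ?_
    (eventually_continuousAt_reading hx hy hfc)
  · simpa only [hl, OrientationPreservingAt] using this
  · simpa only [hl] using eventually_continuousAt_reading hy (mem_chart_source ℂ _) hgc
  · simp only [hl, hly]
    have h0 := (chartAt ℂ (f x)).continuousAt_symm ((chartAt ℂ (f x)).map_source hy)
    rw [ContinuousAt, hly] at h0
    filter_upwards [h0.eventually (hgi.and (hgc.self_of_nhds.eventually
        ((chartAt ℂ (g (f x))).open_source.mem_nhds hz))), (chartAt ℂ (f x)).open_target.mem_nhds ((chartAt ℂ (f x)).map_source hy)]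
      with w hw hwt hgw
    have h2 := hw.1 ((chartAt ℂ (g (f x))).injOn hw.2 hz hgw)
    exact ((chartAt ℂ (f x)).right_inv hwt).symm.trans (congrArg _ h2)

theorem orientationPreservingAt_id (x : X) : OrientationPreservingAt (fun y : X => y) x := by
  have hx := mem_chart_source ℂ x
  refine PlanarOrientationPreservingAt.congr (planarOrientationPreservingAt_id _) ?_
  filter_upwards [(chartAt ℂ x).open_target.mem_nhds ((chartAt ℂ x).map_source hx)] with w hw
  exact ((chartAt ℂ x).right_inv hw).symm

/-- Near the point, the new coordinate expression is the old one composed on both sides with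
transition maps of the atlases, which have degree one. -/
theorem planarOrientationPreservingAt_change [OrientedSurface X] [OrientedSurface Y]
    {e₁ e₂ : OpenPartialHomeomorph X ℂ} {e₁' e₂' : OpenPartialHomeomorph Y ℂ}
    (h₁ : e₁ ∈ atlas ℂ X) (h₂ : e₂ ∈ atlas ℂ X) (h₁' : e₁' ∈ atlas ℂ Y) (h₂' : e₂' ∈ atlas ℂ Y)
    {f : X → Y} {x : X} (hx₁ : x ∈ e₁.source) (hx₂ : x ∈ e₂.source)
    (hy₁ : f x ∈ e₁'.source) (hy₂ : f x ∈ e₂'.source)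
    (hf : ∀ᶠ x' in 𝓝 x, ContinuousAt f x')
    (h : PlanarOrientationPreservingAt (fun w => e₁' (f (e₁.symm w))) (e₁ x)) :
    PlanarOrientationPreservingAt (fun w => e₂' (f (e₂.symm w))) (e₂ x) := by
  have hl₂ := e₂.left_inv hx₂
  have hl₁ := e₁.left_inv hx₁
  have hA : PlanarOrientationPreservingAt (fun w => e₁' (f (e₁.symm (e₁ (e₂.symm w))))) (e₂ x) := by
    refine PlanarOrientationPreservingAt.comp (f := fun w => e₁' (f (e₁.symm w)))
      (g := fun w => e₁ (e₂.symm w)) ?_ (OrientedSurface.orientation_compat e₂ h₂ e₁ h₁ x ⟨hx₂, hx₁⟩)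
      ?_ (eventually_continuousAt_transition hx₂ hx₁)
    · simpa only [hl₂] using h
    · simpa only [hl₂] using eventually_continuousAt_reading hx₁ hy₁ hf
  have hB := hA.congr (reading_comp_eventuallyEq (f := fun x => x) (g := f) (e := e₂)
    continuousAt_id e₁ e₁' hx₂ hx₁)
  refine PlanarOrientationPreservingAt.congr ?_ (reading_comp_eventuallyEq (f := f)
    (g := fun y => y) hf.self_of_nhds (e := e₂) e₁' e₂' hx₂ hy₁)
  refine PlanarOrientationPreservingAt.comp (f := fun w => e₂' (e₁'.symm w))
      (g := fun w => e₁' (f (e₂.symm w))) ?_ hB ?_ (eventually_continuousAt_reading hx₂ hy₁ hf)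
  · simpa only [hl₂] using OrientedSurface.orientation_compat e₁' h₁' e₂' h₂' (f x) ⟨hy₁, hy₂⟩
  · simpa only [hl₂] using eventually_continuousAt_transition hy₁ hy₂

theorem orientationPreservingAt_iff_of_charts [OrientedSurface X] [OrientedSurface Y]
    {e : OpenPartialHomeomorph X ℂ} {e' : OpenPartialHomeomorph Y ℂ} (he : e ∈ atlas ℂ X)
    (he' : e' ∈ atlas ℂ Y) {f : X → Y} {x : X} (hx : x ∈ e.source) (hfx : f x ∈ e'.source)
    (hf : ∀ᶠ x' in 𝓝 x, ContinuousAt f x') :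
    OrientationPreservingAt f x ↔ PlanarOrientationPreservingAt (fun w => e' (f (e.symm w))) (e x) :=
  ⟨planarOrientationPreservingAt_change (chart_mem_atlas ℂ x) he (chart_mem_atlas ℂ (f x)) he'
      (mem_chart_source ℂ x) hx (mem_chart_source ℂ (f x)) hfx hf,
    planarOrientationPreservingAt_change he (chart_mem_atlas ℂ x) he' (chart_mem_atlas ℂ (f x))
      hx (mem_chart_source ℂ x) hfx (mem_chart_source ℂ (f x)) hf⟩

/-- The local degree is locally constant in continuous families of injective maps. -/
theorem eventually_orientationPreservingAt_iff [OrientedSurface X] [OrientedSurface Y]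
    {T : Type*} [TopologicalSpace T] {F : T → X → Y} (hF : Continuous (Function.uncurry F))
    (hinj : ∀ t, Function.Injective (F t)) {x : T → X} (hx : Continuous x) (t₀ : T) :
    ∀ᶠ t in 𝓝 t₀, OrientationPreservingAt (F t) (x t) ↔ OrientationPreservingAt (F t₀) (x t₀) := by
  set e := chartAt ℂ (x t₀)
  set e' := chartAt ℂ (F t₀ (x t₀))
  have hxe : x t₀ ∈ e.source := mem_chart_source ℂ _
  have hye : F t₀ (x t₀) ∈ e'.source := mem_chart_source ℂ _
  have hsymm : ContinuousAt e.symm (e (x t₀)) := e.continuousAt_symm (e.map_source hxe)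
  have hFc : ∀ t, Continuous (F t) := fun t => hF.comp (Continuous.prodMk_right t)
  have hG : ∀ t w, w ∈ e.target → ContinuousAt (fun p : T × ℂ => F p.1 (e.symm p.2)) (t, w) :=
    fun t w hw => hF.continuousAt.comp (f := fun p : T × ℂ => (p.1, e.symm p.2))
      (continuousAt_fst.prodMk ((e.continuousAt_symm hw).comp continuousAt_snd))
  have hW : ∀ᶠ p : T × ℂ in 𝓝 (t₀, e (x t₀)), p.2 ∈ e.target ∧ F p.1 (e.symm p.2) ∈ e'.source := by
    refine (continuousAt_snd.eventually (e.open_target.mem_nhds (e.map_source hxe))).and ?_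
    refine (hG t₀ _ (e.map_source hxe)).eventually (e'.open_source.mem_nhds ?_)
    simpa only [e.left_inv hxe] using hye
  rw [nhds_prod_eq, eventually_prod_iff] at hW
  obtain ⟨pT, hpT, pw, hpw, hW⟩ := hW
  obtain ⟨R, hR, hpw⟩ := Metric.eventually_nhds_iff_ball.1 hpw
  have hN : ∀ᶠ t in 𝓝 t₀, pT t ∧ x t ∈ e.source ∧ e (x t) ∈ Metric.ball (e (x t₀)) (R / 2) :=
    hpT.and ((hx.continuousAt.eventually (e.open_source.mem_nhds hxe)).and
      (((e.continuousAt hxe).comp hx.continuousAt).eventually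
        (Metric.ball_mem_nhds _ (half_pos hR))))
  have hball : ∀ t, e (x t) ∈ Metric.ball (e (x t₀)) (R / 2) →
      ∀ w ∈ Metric.closedBall (e (x t)) (R / 4), pw w := fun t ht w hw => by
    refine hpw w ?_
    rw [Metric.mem_ball] at ht ⊢
    rw [Metric.mem_closedBall] at hw
    linarith [dist_triangle w (e (x t)) (e (x t₀))]
  let g : T → ℂ → ℂ := fun t w => e' (F t (e.symm w))
  have hR4 : 0 < R / 4 := by positivity
  have hgc : ∀ t w, pT t → pw w → ContinuousAt (fun p : T × ℂ => g p.1 p.2) (t, w) :=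
    fun t w ht hw => ContinuousAt.comp (f := fun p : T × ℂ => F p.1 (e.symm p.2))
      (e'.continuousAt (hW ht hw).2) (hG t w (hW ht hw).1)
  have hgc' : ∀ t w, pT t → pw w → ContinuousAt (g t) w :=
    fun t w ht hw => (hgc t w ht hw).comp (f := fun w => (t, w)) (by fun_prop)
  have hginj : ∀ t, pT t → ∀ w w', pw w → pw w' → g t w = g t w' → w = w' := by
    intro t ht w w' hw hw' h
    exact e.symm.injOn (hW ht hw).1 (hW ht hw').1
      (hinj t (e'.injOn (hW ht hw).2 (hW ht hw').2 h))
  -- The charts at `t₀` and the single radius `R / 4` serve for all nearby `t`, so the local degree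
  -- becomes the winding number of one continuous family of loops.
  let C : T → ℝ → ℂ := fun t s =>
    g t (e (x t) + (R / 4 : ℝ) * Complex.exp (s * Complex.I)) - g t (e (x t))
  have hC : ∀ᶠ t in 𝓝 t₀, OrientationPreservingAt (F t) (x t) ↔ HasWinding (C t) 1 := by
    filter_upwards [hN] with t ⟨ht, hxt, hxR⟩
    have hpx : pw (e (x t)) := hball t hxR _ (Metric.mem_closedBall_self hR4.le)
    have hFx : F t (x t) ∈ e'.source := by
      have := (hW ht hpx).2
      rwa [e.left_inv hxt] at this
    rw [orientationPreservingAt_iff_of_charts (chart_mem_atlas ℂ _) (chart_mem_atlas ℂ _) hxt hFx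
      (.of_forall fun _ => (hFc t).continuousAt)]
    exact planarOrientationPreservingAt_iff_hasWinding
      (fun w hw => hgc' t w ht (hball t hxR w hw))
      (fun w hw h => hginj t ht _ _ (hball t hxR w hw) hpx h) hR4 le_rfl
  have hev := eventually_hasWinding_iff (C := C) (t₀ := t₀) (fun s => ?_) ?_ ?_ ?_
  · filter_upwards [hC, hev] with t h1 h2
    rw [h1, h2, hC.self_of_nhds]
  · obtain ⟨ht, hxt, hxR⟩ := hN.self_of_nhds
    have he : ContinuousAt (fun p : T × ℝ => e (x p.1)) (t₀, s) :=
      (e.continuousAt hxt).comp (f := fun p : T × ℝ => x p.1) (by fun_prop)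
    refine ContinuousAt.sub (f := fun p : T × ℝ =>
      g p.1 (e (x p.1) + (R / 4 : ℝ) * Complex.exp (p.2 * Complex.I))) ?_ ?_
    · refine ContinuousAt.comp (x := (t₀, s)) (g := fun p : T × ℂ => g p.1 p.2)
        (f := fun p : T × ℝ => (p.1, e (x p.1) + (R / 4 : ℝ) * Complex.exp (p.2 * Complex.I)))
        (hgc t₀ (e (x t₀) + (R / 4 : ℝ) * Complex.exp (s * Complex.I)) ht
        (hball t₀ hxR _ (circle_mem_closedBall _ hR4.le le_rfl s))) ?_
      exact continuousAt_fst.prodMk (he.add (by fun_prop))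
    · exact (hgc t₀ (e (x t₀)) ht (hball t₀ hxR _ (Metric.mem_closedBall_self hR4.le))).comp
        (f := fun p : T × ℝ => (p.1, e (x p.1))) (continuousAt_fst.prodMk he)
  · filter_upwards [hN] with t ⟨ht, hxt, hxR⟩
    exact continuous_circleLoop (fun w hw => hgc' t w ht (hball t hxR w hw)) hR4.le le_rfl
  · exact .of_forall fun t s => circleLoop_periodic (g t) _ _ s
  · filter_upwards [hN] with t ⟨ht, hxt, hxR⟩ s h0
    have h1 := hginj t ht _ _ (hball t hxR _ (circle_mem_closedBall _ hR4.le le_rfl s))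
      (hball t hxR _ (Metric.mem_closedBall_self hR4.le)) (sub_eq_zero.1 h0)
    have h2 := norm_ofReal_mul_exp hR4.le s
    rw [add_eq_left.1 h1, norm_zero] at h2
    exact hR4.ne h2

theorem isClopen_orientationPreservingAt [OrientedSurface X] [OrientedSurface Y]
    {T : Type*} [TopologicalSpace T] {F : T → X → Y} (hF : Continuous (Function.uncurry F))
    (hinj : ∀ t, Function.Injective (F t)) {x : T → X} (hx : Continuous x) :
    IsClopen {t | OrientationPreservingAt (F t) (x t)} := by
  have h := eventually_orientationPreservingAt_iff hF hinj hx
  refine ⟨isOpen_compl_iff.1 (isOpen_iff_mem_nhds.2 fun t ht => ?_),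
    isOpen_iff_mem_nhds.2 fun t ht => ?_⟩
  · filter_upwards [h t] with t' ht' h'
    exact ht (ht'.1 h')
  · filter_upwards [h t] with t' ht'
    exact ht'.2 ht

instance orientedSurface_complex : OrientedSurface ℂ where
  orientation_compat e he e' he' x _ := by
    rw [chartedSpaceSelf_atlas] at he he'
    subst he he'
    exact planarOrientationPreservingAt_id _

/-- At the origin the map, recentred at its value there, keeps the argument and only rescales along
rays. The points where it preserves orientation form a clopen set, and the plane is connected. -/
theorem planarOrientationPreservingAt_univBall (c : ℂ) {R : ℝ} (hR : 0 < R) (z : ℂ) :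
    PlanarOrientationPreservingAt (OpenPartialHomeomorph.univBall c R) z := by
  have hinj : Function.Injective (OpenPartialHomeomorph.univBall c R) := fun a b h =>
    (OpenPartialHomeomorph.univBall c R).injOn (by simp) (by simp) h
  have h := isClopen_orientationPreservingAt (T := ℂ)
    (F := fun _ => OpenPartialHomeomorph.univBall c R)
    ((OpenPartialHomeomorph.continuous_univBall c R).comp continuous_snd)
    (fun _ => hinj) continuous_id
  refine (Set.ext_iff.1 (h.eq_univ ⟨0, ?_⟩) z).2 trivial
  change PlanarOrientationPreservingAt (OpenPartialHomeomorph.univBall c R) 0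
  rw [planarOrientationPreservingAt_iff]
  filter_upwards [self_mem_nhdsWithin] with r hr
  have hr : 0 < r := hr
  have hval : ∀ s : ℝ, ∃ ρ : ℝ, 0 < ρ ∧ OpenPartialHomeomorph.univBall c R
      (0 + r * Complex.exp (s * Complex.I)) - OpenPartialHomeomorph.univBall c R 0 =
        ρ * Complex.exp (s * Complex.I) := fun s => by
    refine ⟨R * ((√(1 + r ^ 2))⁻¹ * r), by positivity, ?_⟩
    rw [OpenPartialHomeomorph.univBall_apply_zero, OpenPartialHomeomorph.univBall, dif_pos hR,
      zero_add]
    simp [OpenPartialHomeomorph.unitBallBall, OpenPartialHomeomorph.univUnitBall]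
    ring
  refine ⟨fun s => s, continuous_id, fun s => by simp, fun s => ?_⟩
  obtain ⟨ρ, hρ, h⟩ := hval s
  beta_reduce
  rw [h, norm_ofReal_mul_exp hρ.le]
  exact ⟨norm_pos_iff.1 (by rw [norm_ofReal_mul_exp hρ.le]; exact hρ), rfl⟩

theorem exists_isPositiveDisc [OrientedSurface X] (x : X) :
    ∃ φ : ℂ → X, IsPositiveDisc φ ∧ φ 0 = x := by
  have hx := mem_chart_source ℂ x
  set e := chartAt ℂ x
  obtain ⟨R, hR, hball⟩ := Metric.isOpen_iff.1 e.open_target _ (e.map_source hx)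
  set u := OpenPartialHomeomorph.univBall (e x) R
  have hu : ∀ z, u z ∈ e.target := fun z => hball (by
    rw [← OpenPartialHomeomorph.univBall_target _ hR]
    exact u.map_source (by simp [u]))
  have hcont : Continuous fun z => e.symm (u z) := continuous_iff_continuousAt.2 fun z =>
    (e.continuousAt_symm (hu z)).comp (OpenPartialHomeomorph.continuous_univBall _ _).continuousAt
  refine ⟨fun z => e.symm (u z), ⟨.of_continuous_injective_isOpenMap hcont ?_ ?_, fun z => ?_⟩, ?_⟩
  · intro a b h
    exact u.injOn (by simp [u]) (by simp [u]) (e.symm.injOn (hu a) (hu b) h)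
  · intro V hV
    have h1 : IsOpen (u '' V) := u.isOpen_image_of_subset_source hV (by simp [u])
    have h2 := e.symm.isOpen_image_of_subset_source h1
      (by rintro _ ⟨z, -, rfl⟩; exact hu z)
    rwa [Set.image_image] at h2
  · rw [orientationPreservingAt_iff_of_charts (chart_mem_atlas ℂ z) (chart_mem_atlas ℂ x)
      (mem_chart_source ℂ z) (e.map_target (hu z))
      (f := fun z => e.symm (u z)) (.of_forall fun _ => hcont.continuousAt)]
    refine (planarOrientationPreservingAt_univBall (e x) hR z).congr (.of_forall fun w => ?_)
    exact (e.right_inv (hu w)).symm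
  · simp only [u, OpenPartialHomeomorph.univBall_apply_zero]
    exact e.left_inv hx

/-- Every point is the centre of a positive disc, so the condition on discs can be tested pointwise
by cancelling the disc from a composition. -/
theorem mem_homeoPlus_iff [OrientedSurface X] {f : X ≃ₜ X} :
    f ∈ HomeoPlus X ↔ ∀ x, OrientationPreservingAt f x := by
  constructor
  · intro h x
    obtain ⟨φ, hφ, rfl⟩ := exists_isPositiveDisc x
    refine OrientationPreservingAt.of_comp_right (((h φ).1 hφ).2 0) (hφ.2 0)
      (.of_forall fun _ => f.continuous.continuousAt) (.of_forall fun y hy => f.injective hy)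
      (.of_forall fun _ => hφ.1.continuous.continuousAt)
  · intro h φ
    have hc : ∀ x, ∀ᶠ y in 𝓝 x, ContinuousAt f y := fun x =>
      .of_forall fun _ => f.continuous.continuousAt
    refine ⟨fun hφ => ⟨f.isOpenEmbedding.comp hφ.1, fun z => ?_⟩, fun hφ => ⟨?_, fun z => ?_⟩⟩
    · exact (h _).comp (hφ.2 z) (hc _) (.of_forall fun _ => hφ.1.continuous.continuousAt)
    · exact (IsOpenEmbedding.of_comp_iff φ f.isOpenEmbedding).1 hφ.1
    · have hφc : Continuous φ := ((IsOpenEmbedding.of_comp_iff φ f.isOpenEmbedding).1 hφ.1).continuous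
      exact OrientationPreservingAt.of_comp_left (hφ.2 z) (h _) (hc _)
        (.of_forall fun _ => hφc.continuousAt)

/-- A homeomorphism that preserves orientation at the points of a dense set is in `Homeo⁺`. -/
theorem mem_homeoPlus_of_dense [OrientedSurface X] {f : X ≃ₜ X} {D : Set X} (hD : Dense D)
    (h : ∀ x ∈ D, OrientationPreservingAt f x) : f ∈ HomeoPlus X := by
  rw [mem_homeoPlus_iff]
  have hcl := (isClopen_orientationPreservingAt (F := fun _ : X => f) (x := fun x => x)
    (f.continuous.comp continuous_snd) (fun _ => f.injective) continuous_id).1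
  exact fun x => closure_minimal h hcl (hD x)

/-- `Homeo⁺` is closed under isotopy. -/
theorem mem_homeoPlus_of_isotopy [OrientedSurface X] {F : unitInterval → X ≃ₜ X}
    (hF : Continuous fun p : unitInterval × X => F p.1 p.2) (h0 : F 0 ∈ HomeoPlus X)
    (t : unitInterval) : F t ∈ HomeoPlus X := by
  rw [mem_homeoPlus_iff] at h0 ⊢
  intro x
  have := isClopen_orientationPreservingAt (F := fun t => F t) (x := fun _ : unitInterval => x) hF
    (fun t => (F t).injective) continuous_const
  exact (Set.ext_iff.1 (this.eq_univ ⟨0, h0 x⟩) t).2 trivial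

/-- Invariance of domain for orientation preserving maps into a surface. -/
theorem OrientationPreservingAt.image_mem_nhds {a : ℂ → X} {z : ℂ} {V : Set ℂ}
    (h : OrientationPreservingAt a z) (ha : ∀ᶠ w in 𝓝 z, ContinuousAt a w) (hV : V ∈ 𝓝 z) :
    a '' V ∈ 𝓝 (a z) := by
  have hz := mem_chart_source ℂ (a z)
  set e := chartAt ℂ (a z)
  have hV' : V ∩ a ⁻¹' e.source ∈ 𝓝 z :=
    inter_mem hV (ha.self_of_nhds.preimage_mem_nhds (e.open_source.mem_nhds hz))
  have h1 : (fun w => e (a w)) '' (V ∩ a ⁻¹' e.source) ∈ 𝓝 (e (a z)) :=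
    PlanarOrientationPreservingAt.image_mem_nhds (g := fun w => e (a w)) h
      (eventually_continuousAt_reading (e := OpenPartialHomeomorph.refl ℂ) (x := z) trivial hz ha) hV'
  filter_upwards [(e.continuousAt hz).preimage_mem_nhds h1, e.open_source.mem_nhds hz] with y hy hys
  obtain ⟨w, hw, hwy⟩ := hy
  exact ⟨w, hw.1, e.injOn hw.2 hys hwy⟩

end Surfaces

/-! ### Bands and shears -/

/-- The part of a strip that lies over `[l, r]`, in `X`. -/
def bandSet {X : Type*} (α : ℝ → ℝ → X) (l r : ℝ) : Set X :=
  {y | ∃ u ∈ Set.Icc l r, ∃ x, α u x = y}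

/-- The part of a strip that lies over `(l, r)`, in `X`. -/
def openBandSet {X : Type*} (α : ℝ → ℝ → X) (l r : ℝ) : Set X :=
  {y | ∃ u ∈ Set.Ioo l r, ∃ x, α u x = y}

/-- An annulus in `X`, parametrized by the strip `[l, r] × ℝ` with period `1` in the second
variable, whose interior is open in `X`. -/
structure IsBand {X : Type*} [TopologicalSpace X] (α : ℝ → ℝ → X) (l r : ℝ) : Prop where
  lt : l < r
  cont : ContinuousOn (Function.uncurry α) (Set.Icc l r ×ˢ Set.univ)
  periodic : ∀ u x, α u (x + 1) = α u x
  inj : ∀ u ∈ Set.Icc l r, ∀ u' ∈ Set.Icc l r, ∀ x x', α u x = α u' x' →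
    u = u' ∧ ∃ n : ℤ, x' = x + n
  isOpen : IsOpen (openBandSet α l r)

/-- A family of lifts of circle homeomorphisms, from the identity to one full turn. -/
structure IsShear (Ψ : ℝ → ℝ → ℝ) (l r : ℝ) : Prop where
  cont : ContinuousOn (Function.uncurry Ψ) (Set.Icc l r ×ˢ Set.univ)
  mono : ∀ u ∈ Set.Icc l r, StrictMono (Ψ u)
  add_one : ∀ u ∈ Set.Icc l r, ∀ x, Ψ u (x + 1) = Ψ u x + 1
  left : ∀ x, Ψ l x = x
  right : ∀ x, Ψ r x = x + 1

/-- `f` is the shear `Ψ` in the band `α` and the identity outside of it. -/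
def IsBandMap {X : Type*} (α : ℝ → ℝ → X) (l r : ℝ) (Ψ : ℝ → ℝ → ℝ) (f : X → X) : Prop :=
  (∀ u ∈ Set.Icc l r, ∀ x, f (α u x) = α u (Ψ u x)) ∧ ∀ y, y ∉ bandSet α l r → f y = y

/-- A continuous closed map is a quotient map onto its range. Applied to the compact rectangle that
parametrizes a band, this gives continuity of functions defined through the non-unique band
coordinates. -/
theorem continuousOn_range_of_isClosedMap {A B C : Type*} [TopologicalSpace A] [TopologicalSpace B]
    [TopologicalSpace C] {p : A → B} (hp : IsClosedMap p) {f : B → C}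
    (h : Continuous fun a => f (p a)) : ContinuousOn f (Set.range p) := by
  rw [continuousOn_iff_isClosed]
  intro t ht
  refine ⟨p '' ((fun a => f (p a)) ⁻¹' t), hp _ (ht.preimage h), ?_⟩
  ext y
  constructor
  · rintro ⟨hy, a, rfl⟩
    exact ⟨⟨a, hy, rfl⟩, a, rfl⟩
  · rintro ⟨⟨a, ha, rfl⟩, -⟩
    exact ⟨ha, a, rfl⟩

theorem addCircle_coe_eq_iff {x y : ℝ} : (x : AddCircle (1 : ℝ)) = y ↔ ∃ n : ℤ, y = x + n := by
  rw [eq_comm, ← sub_eq_zero, ← AddCircle.coe_sub, AddCircle.coe_eq_zero_iff]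
  refine exists_congr fun n => ?_
  rw [zsmul_eq_mul, mul_one, eq_comm, sub_eq_iff_eq_add']

section Strips

variable {X : Type*} {α : ℝ → ℝ → X} {l r : ℝ}

theorem IsBandMap.unique {Ψ : ℝ → ℝ → ℝ} {f g : X → X} (hf : IsBandMap α l r Ψ f)
    (hg : IsBandMap α l r Ψ g) : f = g := by
  funext y
  by_cases hy : y ∈ bandSet α l r
  · obtain ⟨u, hu, x, rfl⟩ := hy
    rw [hf.1 u hu, hg.1 u hu]
  · rw [hf.2 y hy, hg.2 y hy]

theorem apply_add_int_of_periodic (hα : ∀ u x, α u (x + 1) = α u x) (u x : ℝ) (n : ℤ) :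
    α u (x + n) = α u x := by
  have h : Function.Periodic (α u) 1 := hα u
  simpa using h.int_mul n x

theorem openBandSet_subset : openBandSet α l r ⊆ bandSet α l r :=
  fun _ ⟨u, hu, x, h⟩ => ⟨u, Set.Ioo_subset_Icc_self hu, x, h⟩

end Strips

section Bands

variable {X : Type*} [TopologicalSpace X] {α : ℝ → ℝ → X} {l r : ℝ}

/-- The parametrization of a band by a compact rectangle. -/
theorem IsBand.exists_rectangle (hα : IsBand α l r) {y : X} (hy : y ∈ bandSet α l r) :
    ∃ p : Set.Icc l r × Set.Icc (0 : ℝ) 1, α p.1 p.2 = y := by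
  obtain ⟨u, hu, x, rfl⟩ := hy
  refine ⟨⟨⟨u, hu⟩, ⟨Int.fract x, Int.fract_nonneg x, (Int.fract_lt_one x).le⟩⟩, ?_⟩
  have := apply_add_int_of_periodic hα.periodic u (Int.fract x) ⌊x⌋
  rw [Int.fract_add_floor] at this
  exact this.symm

theorem IsBand.continuous_rectangle (hα : IsBand α l r) :
    Continuous fun p : Set.Icc l r × Set.Icc (0 : ℝ) 1 => α p.1 p.2 :=
  hα.cont.comp_continuous (f := fun p : Set.Icc l r × Set.Icc (0 : ℝ) 1 => ((p.1 : ℝ), (p.2 : ℝ)))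
    (by fun_prop) fun p => ⟨p.1.2, trivial⟩

theorem IsBand.range_rectangle (hα : IsBand α l r) :
    Set.range (fun p : Set.Icc l r × Set.Icc (0 : ℝ) 1 => α p.1 p.2) = bandSet α l r := by
  ext y
  exact ⟨fun ⟨p, hp⟩ => ⟨p.1, p.1.2, p.2, hp⟩, fun hy => hα.exists_rectangle hy⟩

theorem IsBand.isCompact (hα : IsBand α l r) : IsCompact (bandSet α l r) := by
  rw [← hα.range_rectangle]
  exact isCompact_range hα.continuous_rectangle

/-- Coordinates on a band. -/
theorem IsBand.exists_coords [T2Space X] (hα : IsBand α l r) :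
    ∃ (U : X → ℝ) (Θ : X → AddCircle (1 : ℝ)), ContinuousOn U (bandSet α l r) ∧
      ContinuousOn Θ (bandSet α l r) ∧ ∀ u ∈ Set.Icc l r, ∀ x, U (α u x) = u ∧ Θ (α u x) = x := by
  classical
  choose! p hp using fun y (hy : y ∈ bandSet α l r) => hy
  choose! hpu x hpx using hp
  have key : ∀ u ∈ Set.Icc l r, ∀ v, p (α u v) = u ∧ ((x (α u v) : ℝ) : AddCircle (1 : ℝ)) = v := by
    intro u hu v
    have hy : α u v ∈ bandSet α l r := ⟨u, hu, v, rfl⟩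
    obtain ⟨h1, n, h2⟩ := hα.inj _ (hpu _ hy) _ hu _ _ (hpx _ hy)
    refine ⟨h1, ?_⟩
    exact addCircle_coe_eq_iff.2 ⟨n, h2⟩
  have hcl : IsClosedMap fun p : Set.Icc l r × Set.Icc (0 : ℝ) 1 => α p.1 p.2 :=
    hα.continuous_rectangle.isClosedMap
  refine ⟨p, fun y => (x y : AddCircle (1 : ℝ)), ?_, ?_, key⟩
  · rw [← hα.range_rectangle]
    refine continuousOn_range_of_isClosedMap hcl ?_
    simp only [(key _ (Subtype.mem _) _).1]
    fun_prop
  · rw [← hα.range_rectangle]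
    refine continuousOn_range_of_isClosedMap hcl ?_
    simp only [(key _ (Subtype.mem _) _).2]
    exact (AddCircle.continuous_mk' 1).comp (by fun_prop)

theorem IsShear.add_int {Ψ : ℝ → ℝ → ℝ} (h : IsShear Ψ l r) {u : ℝ} (hu : u ∈ Set.Icc l r) (x : ℝ)
    (n : ℤ) : Ψ u (x + n) = Ψ u x + n := by
  have h1 : Function.Periodic (fun x => Ψ u x - x) 1 := fun x => by
    simp only [h.add_one u hu]; ring
  have := h1.int_mul n x
  simp only [mul_one] at this
  linarith

theorem surjective_of_continuous_add_one {f : ℝ → ℝ} (hf : Continuous f)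
    (h : ∀ (x : ℝ) (n : ℤ), f (x + n) = f x + n) : Function.Surjective f := by
  intro y
  have h0 := h 0
  have h1 := h0 ⌊y - f 0⌋
  have h2 := h0 (⌊y - f 0⌋ + 1)
  have h3 := Int.floor_le (y - f 0)
  have h4 := Int.lt_floor_add_one (y - f 0)
  have hy : y ∈ Set.Icc (f (0 + (⌊y - f 0⌋ : ℝ))) (f (0 + ((⌊y - f 0⌋ + 1 : ℤ) : ℝ))) :=
    ⟨by rw [h1]; linarith, by rw [h2]; push_cast; linarith⟩
  obtain ⟨x, -, hx⟩ := intermediate_value_Icc (by push_cast; linarith) hf.continuousOn hy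
  exact ⟨x, hx⟩

theorem IsShear.continuous {Ψ : ℝ → ℝ → ℝ} (h : IsShear Ψ l r) {u : ℝ} (hu : u ∈ Set.Icc l r) :
    Continuous (Ψ u) :=
  h.cont.comp_continuous (f := fun x => (u, x)) (by fun_prop) fun _ => ⟨hu, trivial⟩

theorem IsShear.surjective {Ψ : ℝ → ℝ → ℝ} (h : IsShear Ψ l r) {u : ℝ} (hu : u ∈ Set.Icc l r) :
    Function.Surjective (Ψ u) :=
  surjective_of_continuous_add_one (h.continuous hu) (h.add_int hu)

/-- Increasing functions that commute with the unit translation form a convex set, and the end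
conditions are affine; straight lines therefore give isotopies. -/
theorem IsShear.convexComb {Ψ Ψ' : ℝ → ℝ → ℝ} (h : IsShear Ψ l r) (h' : IsShear Ψ' l r)
    {s : ℝ} (hs : s ∈ Set.Icc (0 : ℝ) 1) :
    IsShear (fun u x => (1 - s) * Ψ u x + s * Ψ' u x) l r where
  cont := (h.cont.const_smul (1 - s)).add (h'.cont.const_smul s)
  mono u hu x y hxy := by
    have h1 := h.mono u hu hxy
    have h2 := h'.mono u hu hxy
    rcases hs.1.eq_or_lt with rfl | hs0
    · simpa using h1
    · have := mul_lt_mul_of_pos_left h2 hs0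
      have := mul_le_mul_of_nonneg_left h1.le (sub_nonneg.2 hs.2)
      beta_reduce
      linarith
  add_one u hu x := by rw [h.add_one u hu, h'.add_one u hu]; ring
  left x := by rw [h.left, h'.left]; ring
  right x := by rw [h.right, h'.right]; ring

theorem isShear_add {ψ : ℝ → ℝ} (hψ : Continuous ψ) (hl : ψ l = 0) (hr : ψ r = 1) :
    IsShear (fun u x => x + ψ u) l r where
  cont := by simp only [Function.uncurry_def]; fun_prop
  mono u _ x y hxy := by beta_reduce; linarith
  add_one u _ x := by ring
  left x := by rw [hl, add_zero]
  right x := by rw [hr]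

/-- A continuous family of shears of a band is realized by an isotopy. -/
theorem IsBand.exists_isotopy [T2Space X] (hα : IsBand α l r) {Ψ : unitInterval → ℝ → ℝ → ℝ}
    (hΨ : ∀ s, IsShear (Ψ s) l r)
    (hΨc : ContinuousOn (fun p : unitInterval × ℝ × ℝ => Ψ p.1 p.2.1 p.2.2)
      (Set.univ ×ˢ (Set.Icc l r ×ˢ Set.univ))) :
    ∃ F : unitInterval → X ≃ₜ X, (Continuous fun p : unitInterval × X => F p.1 p.2) ∧
      ∀ s, IsBandMap α l r (Ψ s) (F s) := by
  classical
  choose! p hp using fun y (hy : y ∈ bandSet α l r) => hy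
  choose! hpu v hpv using hp
  let f : unitInterval → X → X := fun s y => if y ∈ bandSet α l r then α (p y) (Ψ s (p y) (v y)) else y
  have hf : ∀ s, IsBandMap α l r (Ψ s) (f s) := by
    refine fun s => ⟨fun u hu x => ?_, fun y hy => if_neg hy⟩
    have hy : α u x ∈ bandSet α l r := ⟨u, hu, x, rfl⟩
    simp only [f, if_pos hy]
    obtain ⟨h1, n, h2⟩ := hα.inj _ (hpu _ hy) _ hu _ _ (hpv _ hy)
    conv_rhs => rw [h2, (hΨ s).add_int hu, apply_add_int_of_periodic hα.periodic]
    rw [h1]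
  -- At both ends the shear is an integer translation, hence trivial on the circle. So the two
  -- formulas agree on the overlap of the closed sets formed by the band and the complement of its
  -- interior.
  have hid : ∀ s y, y ∉ openBandSet α l r → f s y = y := by
    intro s y hy
    by_cases hyb : y ∈ bandSet α l r
    · obtain ⟨u, hu, x, rfl⟩ := hyb
      rw [(hf s).1 u hu]
      rcases hu.1.eq_or_lt with rfl | h1
      · rw [(hΨ s).left]
      rcases hu.2.eq_or_lt with rfl | h2
      · rw [(hΨ s).right, hα.periodic]
      exact absurd ⟨u, ⟨h1, h2⟩, x, rfl⟩ hy
    · exact (hf s).2 y hyb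
  have hcover : ∀ y, y ∈ bandSet α l r ∨ y ∉ openBandSet α l r := fun y => by
    by_cases hy : y ∈ openBandSet α l r
    exacts [Or.inl (openBandSet_subset hy), Or.inr hy]
  have hfc : Continuous fun q : unitInterval × X => f q.1 q.2 := by
    have h1 : ContinuousOn (fun q : unitInterval × X => f q.1 q.2)
        (Set.range (Prod.map (id : unitInterval → unitInterval)
          fun p : Set.Icc l r × Set.Icc (0 : ℝ) 1 => α p.1 p.2)) := by
      refine continuousOn_range_of_isClosedMap
        (continuous_id.prodMap hα.continuous_rectangle).isClosedMap ?_
      simp only [Prod.map_fst, Prod.map_snd, (hf _).1 _ (Subtype.mem _), id]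
      refine hα.cont.comp_continuous
        (f := fun q : unitInterval × Set.Icc l r × Set.Icc (0 : ℝ) 1 =>
          ((q.2.1 : ℝ), Ψ q.1 q.2.1 q.2.2)) ?_ fun q => ⟨q.2.1.2, trivial⟩
      refine Continuous.prodMk (by fun_prop) ?_
      exact hΨc.comp_continuous (f := fun q : unitInterval × Set.Icc l r × Set.Icc (0 : ℝ) 1 =>
        (q.1, (q.2.1 : ℝ), (q.2.2 : ℝ))) (by fun_prop) fun q => ⟨trivial, q.2.1.2, trivial⟩
    rw [Set.range_prodMap, Set.range_id, hα.range_rectangle] at h1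
    have h2 : ContinuousOn (fun q : unitInterval × X => f q.1 q.2)
        (Set.univ ×ˢ (openBandSet α l r)ᶜ) :=
      continuousOn_snd.congr fun q hq => hid q.1 q.2 hq.2
    rw [← continuousOn_univ]
    refine (h1.union_of_isClosed h2 (isClosed_univ.prod hα.isCompact.isClosed)
      (isClosed_univ.prod hα.isOpen.isClosed_compl)).mono fun q _ => ?_
    exact (hcover q.2).imp (fun h => ⟨trivial, h⟩) fun h => ⟨trivial, h⟩
  have hfs : ∀ s, Continuous (f s) := fun s => hfc.comp (Continuous.prodMk_right s)
  have hmaps : ∀ s y, f s y ∈ bandSet α l r ↔ y ∈ bandSet α l r := by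
    intro s y
    by_cases hy : y ∈ bandSet α l r
    · refine iff_of_true ?_ hy
      obtain ⟨u, hu, x, rfl⟩ := hy
      rw [(hf s).1 u hu]
      exact ⟨u, hu, _, rfl⟩
    · rw [(hf s).2 y hy]
  have hbij : ∀ s, Function.Bijective (f s) := by
    refine fun s => ⟨fun y y' h => ?_, fun y => ?_⟩
    · have h1 := hmaps s y
      rw [h, hmaps s y'] at h1
      by_cases hy : y ∈ bandSet α l r
      · have hy' := h1.2 hy
        obtain ⟨u, hu, x, rfl⟩ := hy
        obtain ⟨u', hu', x', rfl⟩ := hy'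
        rw [(hf s).1 u hu, (hf s).1 u' hu'] at h
        obtain ⟨rfl, n, h2⟩ := hα.inj _ hu _ hu' _ _ h
        rw [← (hΨ s).add_int hu] at h2
        rw [((hΨ s).mono u hu).injective h2, apply_add_int_of_periodic hα.periodic]
      · rwa [(hf s).2 y hy, (hf s).2 y' (mt h1.1 hy)] at h
    · by_cases hy : y ∈ bandSet α l r
      · obtain ⟨u, hu, x, rfl⟩ := hy
        obtain ⟨x', rfl⟩ := (hΨ s).surjective hu x
        exact ⟨α u x', (hf s).1 u hu x'⟩
      · exact ⟨y, (hf s).2 y hy⟩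
  -- The space itself need not be compact; since the band is, the map is closed, and this makes the
  -- inverse continuous.
  have hclosed : ∀ s, IsClosedMap (f s) := by
    intro s C hC
    have h1 : f s '' C = f s '' (C ∩ bandSet α l r) ∪ C ∩ (openBandSet α l r)ᶜ := by
      ext y
      constructor
      · rintro ⟨z, hz, rfl⟩
        rcases hcover z with h | h
        · exact Or.inl ⟨z, ⟨hz, h⟩, rfl⟩
        · rw [hid s z h]
          exact Or.inr ⟨hz, h⟩
      · rintro (⟨z, hz, rfl⟩ | hy)
        · exact ⟨z, hz.1, rfl⟩
        · exact ⟨y, hy.1, hid s y hy.2⟩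
    rw [h1]
    exact ((hα.isCompact.inter_left hC).image (hfs s)).isClosed.union
      (hC.inter hα.isOpen.isClosed_compl)
  refine ⟨fun s => (Equiv.ofBijective (f s) (hbij s)).toHomeomorphOfContinuousClosed (hfs s)
    (hclosed s), hfc, hf⟩

end Bands

/-- An isotopy is a path in `Homeo⁺`. -/
theorem joinedIn_of_isotopy {X : Type*} [TopologicalSpace X] [ChartedSpace ℂ X] [OrientedSurface X]
    {F : unitInterval → X ≃ₜ X} (hF : Continuous fun p : unitInterval × X => F p.1 p.2)
    {f g : HomeoPlus X} (h0 : F 0 = f.1) (h1 : F 1 = g.1) {P : Set (HomeoPlus X)}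
    (hP : ∀ s (e : HomeoPlus X), e.1 = F s → e ∈ P) : JoinedIn P f g := by
  have hmem := mem_homeoPlus_of_isotopy hF (h0 ▸ f.2)
  refine ⟨⟨⟨fun s => ⟨F s, hmem s⟩, ?_⟩, Subtype.ext h0, Subtype.ext h1⟩, fun s => hP s _ rfl⟩
  have hc : Continuous fun s => (⟨F s, (F s).continuous⟩ : C(X, X)) :=
    (ContinuousMap.curry (⟨_, hF⟩ : C(unitInterval × X, X))).continuous
  exact Continuous.subtype_mk (continuous_induced_rng.2 hc) _

/-- The isotopy is the straight line between the shears. The boundary point `α r 0` stays fixed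
because every shear makes a full turn there; this fixed point later singles out lifts. -/
theorem IsBand.joinedIn {X : Type*} [TopologicalSpace X] [ChartedSpace ℂ X] [OrientedSurface X]
    {α : ℝ → ℝ → X} {l r : ℝ} (hα : IsBand α l r) {Ψ Ψ' : ℝ → ℝ → ℝ} (hΨ : IsShear Ψ l r)
    (hΨ' : IsShear Ψ' l r) {f : HomeoPlus X} (hf : IsBandMap α l r Ψ f.1) :
    ∃ g : HomeoPlus X, IsBandMap α l r Ψ' g.1 ∧
      JoinedIn {e : HomeoPlus X | e.1 (α r 0) = α r 0} f g := by
  have hshear := fun s : unitInterval => hΨ.convexComb hΨ' s.2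
  obtain ⟨F, hF, hFb⟩ := hα.exists_isotopy hshear (by
    have h1 : ContinuousOn (fun p : unitInterval × ℝ × ℝ => Ψ p.2.1 p.2.2)
        (Set.univ ×ˢ (Set.Icc l r ×ˢ Set.univ)) :=
      hΨ.cont.comp continuousOn_snd fun p hp => hp.2
    have h2 : ContinuousOn (fun p : unitInterval × ℝ × ℝ => Ψ' p.2.1 p.2.2)
        (Set.univ ×ˢ (Set.Icc l r ×ˢ Set.univ)) :=
      hΨ'.cont.comp continuousOn_snd fun p hp => hp.2
    have h3 : Continuous fun p : unitInterval × ℝ × ℝ => (p.1 : ℝ) := by fun_prop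
    exact ((continuousOn_const.sub h3.continuousOn).mul h1).add (h3.continuousOn.mul h2))
  have h0 : F 0 = f.1 := Homeomorph.ext fun y =>
    congrFun (IsBandMap.unique (Ψ := Ψ) (by simpa using hFb 0) hf) y
  have hmem := mem_homeoPlus_of_isotopy hF (h0 ▸ f.2) 1
  refine ⟨⟨F 1, hmem⟩, by simpa using hFb 1, joinedIn_of_isotopy hF h0 rfl ?_⟩
  intro s e he
  change e.1 (α r 0) = α r 0
  rw [he, (hFb s).1 r ⟨hα.lt.le, le_rfl⟩]
  exact (congrArg (α r) ((hshear s).right 0)).trans (hα.periodic r 0)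

/-! ### Oriented bands -/

theorem hasWinding_circle {c : ℂ} (hc : c ≠ 0) :
    HasWinding (fun s => c * Complex.exp (s * Complex.I)) 1 := by
  refine ⟨fun s => c.arg + s, by fun_prop, fun s => by push_cast; ring, fun s => ⟨?_, ?_⟩⟩
  · exact mul_ne_zero hc (Complex.exp_ne_zero _)
  · beta_reduce
    rw [norm_mul, Complex.norm_exp_ofReal_mul_I, mul_one, Complex.ofReal_add, add_mul,
      Complex.exp_add, ← mul_assoc, Complex.norm_mul_exp_arg_mul_I]

/-- A map that nowhere reverses directions, up to a fixed rotation, preserves orientation. -/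
theorem planarOrientationPreservingAt_of_inner_pos {g : ℂ → ℂ} {z c : ℂ}
    (hg : ∀ᶠ w in 𝓝 z, ContinuousAt g w)
    (h : ∀ᶠ w in 𝓝 z, w ≠ z → 0 < (starRingEnd ℂ (c * (w - z)) * (g w - g z)).re) :
    PlanarOrientationPreservingAt g z := by
  rw [planarOrientationPreservingAt_iff]
  obtain ⟨R, hR, hgR⟩ := exists_closedBall_of_eventually (hg.and h)
  filter_upwards [Ioc_mem_nhdsGT hR] with r hr
  have hpos : ∀ s : ℝ, 0 < (starRingEnd ℂ (c * (r * Complex.exp (s * Complex.I))) *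
      (g (z + r * Complex.exp (s * Complex.I)) - g z)).re := fun s => by
    have := (hgR _ (circle_mem_closedBall z hr.1.le hr.2 s)).2 fun h0 => by
      have h2 := norm_ofReal_mul_exp hr.1.le s
      rw [add_eq_left.1 h0, norm_zero] at h2
      exact hr.1.ne h2
    rwa [add_sub_cancel_left] at this
  have hc : c ≠ 0 := fun h0 => by simpa [h0] using hpos 0
  have hr0 : (r : ℂ) ≠ 0 := by exact_mod_cast hr.1.ne'
  have h1 := hasWinding_circle (mul_ne_zero hc hr0)
  refine h1.of_segment (by fun_prop) (continuous_circleLoop (fun w hw => (hgR w hw).1) hr.1.le hr.2)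
    (fun s => by rw [exp_add_two_pi_mul_I]) (circleLoop_periodic g z r) fun s u hu h0 => ?_
  have h2 := hpos s
  rw [← mul_assoc] at h2
  set v := c * r * Complex.exp (s * Complex.I)
  set w := g (z + r * Complex.exp (s * Complex.I)) - g z
  have hv : v ≠ 0 := h1.ne_zero s
  have h3 := congrArg (fun x => (starRingEnd ℂ v * x).re) h0
  have h4 : (starRingEnd ℂ v * ((1 - u) * v + u * w)).re =
      (1 - u) * Complex.normSq v + u * (starRingEnd ℂ v * w).re := by
    simp [Complex.normSq_apply]; ring
  simp only [h4, mul_zero, Complex.zero_re] at h3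
  have h5 : 0 < Complex.normSq v := Complex.normSq_pos.2 hv
  rcases hu.1.eq_or_lt with rfl | hu0
  · simp at h3; exact hv h3
  · have := mul_pos hu0 h2
    have := mul_nonneg (sub_nonneg.2 hu.2) h5.le
    linarith

/-- With `v = w - z`, the remainder `exp v - 1 - v` has norm at most `‖v‖ ^ 2 < ‖v‖`, so the
increment of `exp` makes an acute angle with `exp z * v`. -/
theorem planarOrientationPreservingAt_exp (z : ℂ) :
    PlanarOrientationPreservingAt Complex.exp z := by
  refine planarOrientationPreservingAt_of_inner_pos (c := Complex.exp z)
    (.of_forall fun _ => Complex.continuous_exp.continuousAt) ?_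
  filter_upwards [Metric.ball_mem_nhds z one_pos] with w hw hne
  have h1 : ‖w - z‖ < 1 := by simpa [dist_eq_norm] using hw
  have h0 : 0 < ‖w - z‖ := norm_pos_iff.2 (sub_ne_zero.2 hne)
  set v := w - z with hv
  have h2 : Complex.exp w - Complex.exp z = Complex.exp z * (v + (Complex.exp v - 1 - v)) := by
    rw [show w = z + v by rw [hv]; ring, Complex.exp_add]; ring
  have h3 : starRingEnd ℂ (Complex.exp z * v) * (Complex.exp w - Complex.exp z) =
      (Complex.normSq (Complex.exp z) : ℂ) * (starRingEnd ℂ v * v + starRingEnd ℂ v * (Complex.exp v - 1 - v)) := by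
    rw [h2, Complex.normSq_eq_conj_mul_self, map_mul]; ring
  rw [h3, Complex.re_ofReal_mul]
  refine mul_pos (Complex.normSq_pos.2 (Complex.exp_ne_zero z)) ?_
  have h4 : ‖Complex.exp v - 1 - v‖ ≤ ‖v‖ ^ 2 := Complex.norm_exp_sub_one_sub_id_le h1.le
  have h5 : -(‖v‖ * ‖v‖ ^ 2) ≤ (starRingEnd ℂ v * (Complex.exp v - 1 - v)).re := by
    have := Complex.abs_re_le_norm (starRingEnd ℂ v * (Complex.exp v - 1 - v))
    rw [norm_mul, RCLike.norm_conj] at this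
    have h6 := mul_le_mul_of_nonneg_left h4 h0.le
    linarith [neg_le_of_abs_le this]
  rw [Complex.add_re, ← Complex.normSq_eq_conj_mul_self, Complex.ofReal_re, Complex.normSq_eq_norm_sq]
  nlinarith [mul_pos h0 h0]

/-- Polar coordinates `u + i x ↦ u exp (2π i x)`. -/
theorem planarOrientationPreservingAt_polar {z : ℂ} (hz : 0 < z.re) :
    PlanarOrientationPreservingAt
      (fun w => (w.re : ℂ) * Complex.exp ((2 * Real.pi * w.im : ℝ) * Complex.I)) z := by
  have hpos : ∀ᶠ w : ℂ in 𝓝 z, 0 < w.re :=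
    Complex.continuous_re.continuousAt.eventually (lt_mem_nhds hz)
  have hpi := Real.pi_pos
  -- Polar coordinates factor as `exp ∘ R`, and `R` is increasing in each coordinate separately, so
  -- it never reverses a direction.
  let R : ℂ → ℂ := fun w => ⟨Real.log w.re, 2 * Real.pi * w.im⟩
  have hRc : ∀ w : ℂ, 0 < w.re → ContinuousAt R w := fun w hw => by
    have h1 : ContinuousAt (fun w : ℂ => (Real.log w.re : ℂ) + (2 * Real.pi * w.im : ℝ) * Complex.I) w := by
      refine ContinuousAt.add ?_ (by fun_prop)
      exact Complex.continuous_ofReal.continuousAt.comp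
        ((Real.continuousAt_log hw.ne').comp Complex.continuous_re.continuousAt)
    refine h1.congr (.of_forall fun w => ?_)
    exact (Complex.mk_eq_add_mul_I _ _).symm
  have hR : PlanarOrientationPreservingAt R z := by
    refine planarOrientationPreservingAt_of_inner_pos (c := 1) (hpos.mono hRc) ?_
    filter_upwards [hpos] with w hw hne
    have h1 : (starRingEnd ℂ (1 * (w - z)) * (R w - R z)).re =
        (w.re - z.re) * (Real.log w.re - Real.log z.re) + 2 * Real.pi * ((w.im - z.im) * (w.im - z.im)) := by
      simp [R]; ring
    rw [h1]
    have hlog : w.re ≠ z.re → 0 < (w.re - z.re) * (Real.log w.re - Real.log z.re) := fun hne => by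
      rcases hne.lt_or_gt with h | h
      · exact mul_pos_of_neg_of_neg (sub_neg.2 h) (sub_neg.2 (Real.log_lt_log hw h))
      · exact mul_pos (sub_pos.2 h) (sub_pos.2 (Real.log_lt_log hz h))
    by_cases hre : w.re = z.re
    · have him : w.im - z.im ≠ 0 := fun h => hne (Complex.ext hre (sub_eq_zero.1 h))
      rw [hre, sub_self, zero_mul, zero_add]
      have := mul_self_pos.2 him
      positivity
    · have := hlog hre
      have := mul_self_nonneg (w.im - z.im)
      positivity
  refine ((planarOrientationPreservingAt_exp _).comp hR
    (.of_forall fun _ => Complex.continuous_exp.continuousAt) (hpos.mono hRc)).congr ?_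
  filter_upwards [hpos] with w hw
  simp only [R]
  rw [Complex.mk_eq_add_mul_I, Complex.exp_add, ← Complex.ofReal_exp, Real.exp_log hw]

/-- An annulus, parametrized by the strip `[1, 2] × ℝ`, with orientation preserving interior. -/
structure IsOrientedBand {X : Type*} [TopologicalSpace X] [ChartedSpace ℂ X] (α : ℝ → ℝ → X) :
    Prop where
  cont : ContinuousOn (Function.uncurry α) (Set.Icc 1 2 ×ˢ Set.univ)
  periodic : ∀ u x, α u (x + 1) = α u x
  inj : ∀ u ∈ Set.Icc (1 : ℝ) 2, ∀ u' ∈ Set.Icc (1 : ℝ) 2, ∀ x x', α u x = α u' x' →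
    u = u' ∧ ∃ n : ℤ, x' = x + n
  orient : ∀ ζ : ℂ, 1 < ζ.re → ζ.re < 2 → OrientationPreservingAt (fun w : ℂ => α w.re w.im) ζ

/-- The shear that turns a band into a Dehn twist. -/
def twistShear (u x : ℝ) : ℝ := x + (u - 1)

theorem isShear_twistShear : IsShear twistShear 1 2 :=
  isShear_add (by fun_prop) (by norm_num) (by norm_num)

theorem bandSet_flip {X : Type*} (α : ℝ → ℝ → X) :
    bandSet (fun u x => α (3 - u) (-x)) 1 2 = bandSet α 1 2 := by
  ext y
  constructor
  · rintro ⟨u, hu, x, rfl⟩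
    exact ⟨3 - u, ⟨by linarith [hu.2], by linarith [hu.1]⟩, -x, rfl⟩
  · rintro ⟨u, hu, x, rfl⟩
    exact ⟨3 - u, ⟨by linarith [hu.2], by linarith [hu.1]⟩, -x, by simp⟩

section OrientedBands

variable {X : Type*} [TopologicalSpace X] [ChartedSpace ℂ X] {α : ℝ → ℝ → X}

theorem IsOrientedBand.eventually_continuousAt (hα : IsOrientedBand α) {ζ : ℂ} (h1 : 1 < ζ.re)
    (h2 : ζ.re < 2) : ∀ᶠ w : ℂ in 𝓝 ζ, ContinuousAt (fun w : ℂ => α w.re w.im) w := by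
  filter_upwards [Complex.continuous_re.continuousAt.eventually (lt_mem_nhds h1),
    Complex.continuous_re.continuousAt.eventually (gt_mem_nhds h2)] with w hw1 hw2
  have := hα.cont.continuousAt (x := (w.re, w.im)) (prod_mem_nhds (Icc_mem_nhds hw1 hw2) univ_mem)
  exact ContinuousAt.comp (f := fun w : ℂ => (w.re, w.im)) this (by fun_prop)

/-- Invariance of domain, which holds here because the parametrization has local degree one. -/
theorem IsOrientedBand.isOpen_openBandSet (hα : IsOrientedBand α) {l r : ℝ} (hl : 1 ≤ l)
    (hr : r ≤ 2) : IsOpen (openBandSet α l r) := by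
  rw [isOpen_iff_mem_nhds]
  rintro _ ⟨u, hu, x, rfl⟩
  have h1 : 1 < (⟨u, x⟩ : ℂ).re := hl.trans_lt hu.1
  have h2 : (⟨u, x⟩ : ℂ).re < 2 := hu.2.trans_le hr
  have h3 := (hα.orient ⟨u, x⟩ h1 h2).image_mem_nhds (hα.eventually_continuousAt h1 h2)
    (Complex.continuous_re.continuousAt.preimage_mem_nhds (Ioo_mem_nhds hu.1 hu.2))
  refine mem_of_superset h3 ?_
  rintro _ ⟨w, hw, rfl⟩
  exact ⟨w.re, hw, w.im, rfl⟩

theorem IsOrientedBand.isBand (hα : IsOrientedBand α) {l r : ℝ} (hl : 1 ≤ l) (hlr : l < r)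
    (hr : r ≤ 2) : IsBand α l r where
  lt := hlr
  cont := hα.cont.mono (Set.prod_mono (Set.Icc_subset_Icc hl hr) subset_rfl)
  periodic := hα.periodic
  inj u hu u' hu' := hα.inj u ⟨hl.trans hu.1, hu.2.trans hr⟩ u' ⟨hl.trans hu'.1, hu'.2.trans hr⟩
  isOpen := hα.isOpen_openBandSet hl hr

/-- Turning an oriented band upside down. -/
theorem IsOrientedBand.flip (hα : IsOrientedBand α) :
    IsOrientedBand (fun u x => α (3 - u) (-x)) where
  cont := hα.cont.comp (f := fun p : ℝ × ℝ => (3 - p.1, -p.2)) (by fun_prop) fun p hp =>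
    ⟨⟨by linarith [hp.1.2], by linarith [hp.1.1]⟩, trivial⟩
  periodic u x := by
    rw [← hα.periodic (3 - u) (-(x + 1))]
    congr 1; ring
  inj u hu u' hu' x x' h := by
    obtain ⟨h1, n, h2⟩ := hα.inj _ ⟨by linarith [hu.2], by linarith [hu.1]⟩ _
      ⟨by linarith [hu'.2], by linarith [hu'.1]⟩ _ _ h
    exact ⟨by linarith, -n, by push_cast; linarith⟩
  orient ζ h1 h2 := by
    have h3 : 1 < (3 - ζ).re := by simp; linarith
    have h4 : (3 - ζ).re < 2 := by simp; linarith
    have hflip : OrientationPreservingAt (fun w : ℂ => 3 - w) ζ := by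
      refine planarOrientationPreservingAt_of_inner_pos (c := -1) (.of_forall fun w => ?_)
        (.of_forall fun w hne => ?_)
      · change ContinuousAt (fun w : ℂ => 3 - w) w
        fun_prop
      · change 0 < (starRingEnd ℂ (-1 * (w - ζ)) * ((3 - w) - (3 - ζ))).re
        have : starRingEnd ℂ (-1 * (w - ζ)) * ((3 - w) - (3 - ζ)) = Complex.normSq (w - ζ) := by
          rw [Complex.normSq_eq_conj_mul_self]; simp; ring
        rw [this, Complex.ofReal_re]
        exact Complex.normSq_pos.2 (sub_ne_zero.2 hne)
    refine ((hα.orient _ h3 h4).comp hflip (hα.eventually_continuousAt h3 h4)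
      (.of_forall fun w => by fun_prop)).congr (.of_forall fun w => ?_)
    simp

/-- The half turn reverses both coordinates of the annulus, so a left twist remains a left twist;
the two formulas differ by one full period. -/
theorem IsOrientedBand.flip_isBandMap (hα : IsOrientedBand α) {f : X → X}
    (hf : IsBandMap α 1 2 twistShear f) :
    IsBandMap (fun u x => α (3 - u) (-x)) 1 2 twistShear f := by
  refine ⟨fun u hu x => ?_, fun y hy => hf.2 y (bandSet_flip α ▸ hy)⟩
  rw [hf.1 _ ⟨by linarith [hu.2], by linarith [hu.1]⟩]
  refine Eq.trans ?_ (hα.periodic (3 - u) (-twistShear u x))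
  congr 1
  simp only [twistShear]; ring

/-- Pull the embedding back along `(u, x) ↦ u exp (2πix)`: the rotation by `2π(‖z‖ - 1)` becomes the
translation of `x` by `u - 1`. -/
theorem exists_orientedBand_of_isDehnTwistHomeo [OrientedSurface X] {c : Set X} {t : HomeoPlus X}
    (h : IsDehnTwistHomeo c t) : ∃ α : ℝ → ℝ → X, IsOrientedBand α ∧
      Set.range (α (3 / 2)) = c ∧ IsBandMap α 1 2 twistShear t.1 := by
  obtain ⟨a, hac, hai, hao, hcore, hin, hout⟩ := h
  have hpi := Real.pi_pos
  have hnorm : ∀ {u : ℝ}, 0 ≤ u → ∀ x : ℝ,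
      ‖(u : ℂ) * Complex.exp ((2 * Real.pi * x : ℝ) * Complex.I)‖ = u :=
    fun hu x => norm_ofReal_mul_exp hu _
  have hmem : ∀ {u : ℝ}, u ∈ Set.Icc (1 : ℝ) 2 → ∀ x : ℝ,
      (u : ℂ) * Complex.exp ((2 * Real.pi * x : ℝ) * Complex.I) ∈ closedAnnulus := fun hu x => by
    change 1 ≤ _ ∧ _ ≤ (2 : ℝ)
    rw [hnorm (zero_le_one.trans hu.1)]
    exact hu
  have hpolar : ∀ z : ℂ, z = (‖z‖ : ℂ) * Complex.exp ((2 * Real.pi * (z.arg / (2 * Real.pi)) : ℝ) * Complex.I) :=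
    fun z => by
      rw [mul_div_cancel₀ _ (by positivity), Complex.norm_mul_exp_arg_mul_I]
  refine ⟨fun u x => a (u * Complex.exp ((2 * Real.pi * x : ℝ) * Complex.I)),
    ⟨?_, fun u x => ?_, fun u hu u' hu' x x' heq => ?_, fun ζ h1 h2 => ?_⟩, ?_, fun u hu x => ?_, ?_⟩
  · exact hac.comp (f := fun p : ℝ × ℝ => (p.1 : ℂ) * Complex.exp ((2 * Real.pi * p.2 : ℝ) * Complex.I))
      (by fun_prop) fun p hp => hmem hp.1 _
  · congr 2
    rw [mul_add, mul_one, exp_add_two_pi_mul_I]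
  · have h1 := hai (hmem hu x) (hmem hu' x') heq
    have h2 := congrArg norm h1
    rw [hnorm (zero_le_one.trans hu.1), hnorm (zero_le_one.trans hu'.1)] at h2
    subst h2
    have h0 : (u : ℂ) ≠ 0 := by
      have : u ≠ 0 := (one_pos.trans_le hu.1).ne'
      exact_mod_cast this
    obtain ⟨n, hn⟩ := exp_mul_I_eq_iff.1 (mul_left_cancel₀ h0 h1)
    refine ⟨rfl, -n, ?_⟩
    have h3 : 2 * Real.pi * x = 2 * Real.pi * (x' + n) := by rw [hn]; ring
    have := mul_left_cancel₀ (by positivity) h3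
    push_cast; linarith
  · have hz : ∀ᶠ w in 𝓝 ((ζ.re : ℂ) * Complex.exp ((2 * Real.pi * ζ.im : ℝ) * Complex.I)),
        ContinuousAt a w := by
      have hn := hnorm (zero_le_one.trans h1.le) ζ.im
      filter_upwards [continuous_norm.continuousAt.eventually (lt_mem_nhds (hn.symm ▸ h1)),
        continuous_norm.continuousAt.eventually (gt_mem_nhds (hn.symm ▸ h2))] with w hw1 hw2
      exact hac.continuousAt (mem_of_superset (inter_mem
        (continuous_norm.continuousAt.preimage_mem_nhds (lt_mem_nhds hw1))
        (continuous_norm.continuousAt.preimage_mem_nhds (gt_mem_nhds hw2)))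
        fun w hw => ⟨hw.1.le, hw.2.le⟩)
    have h3 := hnorm (zero_le_one.trans h1.le) ζ.im
    refine OrientationPreservingAt.comp (g := a) (hao _ (by rw [h3]; exact h1) (by rw [h3]; exact h2))
      (planarOrientationPreservingAt_polar (one_pos.trans h1)) hz
      (.of_forall fun w => by fun_prop)
  · rw [← hcore]
    ext y
    constructor
    · rintro ⟨x, rfl⟩
      refine ⟨_, ?_, rfl⟩
      rw [mem_sphere_zero_iff_norm]
      exact hnorm (by norm_num) x
    · rintro ⟨z, hz, rfl⟩
      rw [mem_sphere_zero_iff_norm] at hz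
      refine ⟨z.arg / (2 * Real.pi), ?_⟩
      conv_rhs => rw [hpolar z, hz]
  · rw [hin _ (hmem hu x), hnorm (zero_le_one.trans hu.1)]
    congr 1
    rw [mul_assoc, ← Complex.exp_add, ← add_mul, ← Complex.ofReal_add]
    congr 4
    simp only [twistShear]; ring
  · intro y hy
    refine hout y ?_
    rintro ⟨z, hz, rfl⟩
    refine hy ⟨‖z‖, hz, z.arg / (2 * Real.pi), ?_⟩
    conv_rhs => rw [hpolar z]

end OrientedBands

/-! ### Uniqueness of Dehn twists -/

/-- In degree `0` one has `θ 0 = θ 1`, and the value halfway between `θ 0` and `θ (1 / 2)` would be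
taken in both halves of the period, contradicting injectivity modulo `1`. -/
theorem degree_ne_zero {θ : ℝ → ℝ} (hθ : Continuous θ) {d : ℤ} (hd : ∀ x, θ (x + 1) = θ x + d)
    (hinj : ∀ x y, θ x = θ y → ∃ n : ℤ, y = x + n) : d ≠ 0 := by
  rintro rfl
  have h1 : θ 1 = θ 0 := by simpa using hd 0
  have hne : θ 0 ≠ θ (1 / 2) := fun h => by
    obtain ⟨n, hn⟩ := hinj _ _ h
    have h2 : (1 : ℝ) = ((2 * n : ℤ) : ℝ) := by push_cast; linarith
    have h3 : (1 : ℤ) = 2 * n := by exact_mod_cast h2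
    omega
  have hm : (θ 0 + θ (1 / 2)) / 2 ∈ Set.uIcc (θ 0) (θ (1 / 2)) := by
    rw [Set.mem_uIcc]
    rcases le_total (θ 0) (θ (1 / 2)) with h | h
    · exact Or.inl ⟨by linarith, by linarith⟩
    · exact Or.inr ⟨by linarith, by linarith⟩
  obtain ⟨x, hx, hxm⟩ := intermediate_value_uIcc hθ.continuousOn hm
  obtain ⟨y, hy, hym⟩ := intermediate_value_uIcc (a := 1) (b := 1 / 2) hθ.continuousOn
    (by rwa [h1])
  rw [Set.uIcc_of_le (by norm_num)] at hx
  rw [Set.uIcc_of_ge (by norm_num)] at hy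
  have hx1 : x ≠ 1 / 2 := fun h => hne (by rw [h] at hxm; linarith)
  have hx0 : x ≠ 0 := fun h => hne (by rw [h] at hxm; linarith)
  obtain ⟨n, hn⟩ := hinj x y (hxm.trans hym.symm)
  have hx2 := lt_of_le_of_ne hx.2 hx1
  have hx3 := lt_of_le_of_ne hx.1 hx0.symm
  have h4 : ((0 : ℤ) : ℝ) < n := by push_cast; linarith [hy.1]
  have h5 : (n : ℝ) < ((1 : ℤ) : ℝ) := by push_cast; linarith [hy.2]
  have h6 := Int.cast_lt.1 h4
  have h7 := Int.cast_lt.1 h5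
  omega

theorem apply_add_int_of_degree {θ : ℝ → ℝ} {d : ℤ} (hd : ∀ x, θ (x + 1) = θ x + d) (x : ℝ)
    (n : ℤ) : θ (x + n) = θ x + n * d := by
  have h1 : Function.Periodic (fun x => θ x - d * x) 1 := fun x => by
    simp only [hd]; ring
  have := h1.int_mul n x
  simp only [mul_one] at this
  linarith

/-- The lift of a self-homeomorphism of the circle is monotone, with degree `1` if increasing. -/
theorem strictMono_or_strictAnti_of_circle {θ : ℝ → ℝ} (hθ : Continuous θ) {d : ℤ}
    (hd : ∀ x, θ (x + 1) = θ x + d)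
    (hinj : ∀ x y, ∀ n : ℤ, θ y = θ x + n → ∃ m : ℤ, y = x + m) :
    (StrictMono θ ∧ d = 1) ∨ StrictAnti θ := by
  have hd0 := degree_ne_zero hθ hd fun x y h => hinj x y 0 (by simp [h])
  have hi : Function.Injective θ := fun x y h => by
    obtain ⟨m, rfl⟩ := hinj x y 0 (by simp [h])
    rw [apply_add_int_of_degree hd, left_eq_add] at h
    have : m = 0 := by
      have h1 : ((m * d : ℤ) : ℝ) = 0 := by exact_mod_cast h
      exact (mul_eq_zero.1 (by exact_mod_cast h1)).resolve_right hd0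
    simp [this]
  rcases hθ.strictMono_of_inj hi with hm | ha
  · refine Or.inl ⟨hm, ?_⟩
    have h1 : θ 0 < θ (0 + 1) := hm (by norm_num)
    rw [hd] at h1
    have h2 : 0 < d := by
      have : (0 : ℝ) < d := by linarith
      exact_mod_cast this
    by_contra hne
    have h3 : (2 : ℝ) ≤ d := by
      have : 2 ≤ d := by omega
      exact_mod_cast this
    have hmem : θ 0 + 1 ∈ Set.Icc (θ 0) (θ (0 + 1)) := ⟨by linarith, by rw [hd]; linarith⟩
    obtain ⟨y, hy, hy1⟩ := intermediate_value_Icc (by norm_num) hθ.continuousOn hmem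
    obtain ⟨m, hm'⟩ := hinj 0 y 1 (by rw [hy1]; simp)
    rw [zero_add] at hm'
    subst hm'
    have h4 := hm.lt_iff_lt.1 (show θ 0 < θ m by linarith)
    have h5 := hm.lt_iff_lt.1 (show θ m < θ (0 + 1) by rw [hd]; linarith)
    have h6 : (0 : ℤ) < m := by exact_mod_cast h4
    have h7 : m < 1 := by
      have : (m : ℝ) < 1 := by linarith
      exact_mod_cast this
    omega
  · exact Or.inr ha

theorem pos_or_neg_of_isPreconnected {A : Type*} [TopologicalSpace A] {s : Set A}
    (hs : IsPreconnected s) {f : A → ℝ} (hf : ContinuousOn f s) (h0 : ∀ a ∈ s, f a ≠ 0) :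
    (∀ a ∈ s, 0 < f a) ∨ ∀ a ∈ s, f a < 0 := by
  by_contra! h
  obtain ⟨⟨a, ha, ha'⟩, b, hb, hb'⟩ := h
  obtain ⟨c, hc, hc'⟩ := hs.intermediate_value ha hb hf ⟨ha', hb'⟩
  exact h0 c hc hc'

theorem exp_mul_I_eq_mk (s : ℝ) :
    Complex.exp (s * Complex.I) = ⟨Real.cos s, Real.sin s⟩ :=
  Complex.ext (Complex.exp_ofReal_mul_I_re s) (Complex.exp_ofReal_mul_I_im s)

/-! ### Coordinate changes between two annuli with the same core -/

section Comparison

variable {X : Type*} [TopologicalSpace X] [ChartedSpace ℂ X] {α β : ℝ → ℝ → X}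

/-- A neighbourhood of the core circle of `α` lies in any neighbourhood of it. -/
theorem IsOrientedBand.exists_core_subset (hα : IsOrientedBand α) {V : Set X} (hV : IsOpen V)
    (hcore : Set.range (α (3 / 2)) ⊆ V) :
    ∃ η > 0, η < 1 / 2 ∧ ∀ u ∈ Set.Icc (3 / 2 - η) (3 / 2 + η), ∀ x, α u x ∈ V := by
  have h1 : ∀ᶠ u in 𝓝 (3 / 2 : ℝ), ∀ x ∈ Set.Icc (0 : ℝ) 1, α u x ∈ V := by
    refine isCompact_Icc.eventually_forall_of_forall_eventually fun x _ => ?_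
    have h2 : ContinuousAt (Function.uncurry α) (3 / 2, x) :=
      hα.cont.continuousAt (prod_mem_nhds (Icc_mem_nhds (by norm_num) (by norm_num)) univ_mem)
    exact h2.eventually (hV.mem_nhds (hcore ⟨x, rfl⟩))
  obtain ⟨ε, hε, h⟩ := Metric.nhds_basis_closedBall.eventually_iff.1 h1
  refine ⟨min ε (1 / 4), by positivity, (min_le_right _ _).trans_lt (by norm_num),
    fun u hu x => ?_⟩
  have h2 : u ∈ Metric.closedBall (3 / 2 : ℝ) ε := by
    rw [Metric.mem_closedBall, Real.dist_eq, abs_le]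
    have := min_le_left ε (1 / 4)
    exact ⟨by linarith [hu.1], by linarith [hu.2]⟩
  have h3 := h h2 (Int.fract x) ⟨Int.fract_nonneg x, (Int.fract_lt_one x).le⟩
  rwa [← apply_add_int_of_periodic hα.periodic u (Int.fract x) ⌊x⌋, Int.fract_add_floor] at h3

/-- The coordinates of `β` near the core of `α`, as a function of those of `α`. -/
theorem IsOrientedBand.exists_transition [OrientedSurface X] (hα : IsOrientedBand α)
    (hβ : IsOrientedBand β) {η : ℝ} (hη : 0 < η) (hη' : η < 1 / 2)
    (hsub : ∀ u ∈ Set.Icc (3 / 2 - η) (3 / 2 + η), ∀ x, α u x ∈ openBandSet β 1 2) :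
    ∃ g : C(ℂ, ℂ), (∀ ζ : ℂ, ζ.re ∈ Set.Icc (3 / 2 - η) (3 / 2 + η) →
      (g ζ).re ∈ Set.Ioo 1 2 ∧ α ζ.re ζ.im = β (g ζ).re (g ζ).im) ∧
      ∀ ζ, (g (ζ + Complex.I)).re = (g ζ).re := by
  have hβb := hβ.isBand le_rfl one_lt_two le_rfl
  obtain ⟨U, Θ, hU, hΘ, hUΘ⟩ := hβb.exists_coords
  -- Clamping the first coordinate extends the map to the simply connected plane, where the angular
  -- coordinate of `β` lifts from the circle to the line.
  let G : ℂ → X := fun ζ => α (max (3 / 2 - η) (min ζ.re (3 / 2 + η))) ζ.im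
  have hclamp : ∀ u : ℝ, max (3 / 2 - η) (min u (3 / 2 + η)) ∈ Set.Icc (3 / 2 - η) (3 / 2 + η) :=
    fun u => ⟨le_max_left _ _, max_le (by linarith) (min_le_right _ _)⟩
  have hGmem : ∀ ζ, G ζ ∈ openBandSet β 1 2 := fun ζ => hsub _ (hclamp _) _
  have hG : Continuous G := hα.cont.comp_continuous
    (f := fun ζ : ℂ => (max (3 / 2 - η) (min ζ.re (3 / 2 + η)), ζ.im))
    (by fun_prop) fun ζ => ⟨⟨by linarith [(hclamp ζ.re).1], by linarith [(hclamp ζ.re).2]⟩, trivial⟩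
  have hGb : ∀ ζ, G ζ ∈ bandSet β 1 2 := fun ζ => openBandSet_subset (hGmem ζ)
  obtain ⟨v₀, hv₀⟩ := QuotientAddGroup.mk_surjective (Θ (G 0))
  obtain ⟨V, ⟨-, hV⟩, -⟩ := (AddCircle.isCoveringMap_coe (1 : ℝ)).existsUnique_continuousMap_lifts
    (⟨fun ζ => Θ (G ζ), hΘ.comp_continuous hG hGb⟩ : C(ℂ, AddCircle (1 : ℝ))) 0 v₀ hv₀
  have hV' : ∀ ζ, (V ζ : AddCircle (1 : ℝ)) = Θ (G ζ) := fun ζ => congrFun hV ζ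
  have hUc : Continuous fun ζ => U (G ζ) := hU.comp_continuous hG hGb
  have hg : Continuous fun ζ => (U (G ζ) : ℂ) + V ζ * Complex.I :=
    (Complex.continuous_ofReal.comp hUc).add
      ((Complex.continuous_ofReal.comp V.continuous).mul continuous_const)
  refine ⟨⟨_, hg⟩, fun ζ hζ => ?_, fun ζ => ?_⟩
  · simp only [ContinuousMap.coe_mk, Complex.add_re, Complex.ofReal_re, Complex.mul_re,
      Complex.I_re, mul_zero, Complex.ofReal_im, Complex.I_im, mul_one, sub_self, add_zero,
      Complex.add_im, Complex.mul_im, zero_add]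
    have hGζ : G ζ = α ζ.re ζ.im := by
      simp only [G, min_eq_left hζ.2, max_eq_right hζ.1]
    obtain ⟨u, hu, x, hx⟩ := hGmem ζ
    obtain ⟨h1, h2⟩ := hUΘ u (Set.Ioo_subset_Icc_self hu) x
    rw [hx] at h1 h2
    rw [h1]
    refine ⟨hu, ?_⟩
    obtain ⟨n, hn⟩ := addCircle_coe_eq_iff.1 (h2.symm.trans (hV' ζ).symm)
    rw [hn, apply_add_int_of_periodic hβ.periodic, hx, hGζ]
  · have : G (ζ + Complex.I) = G ζ := by
      simp only [G, Complex.add_re, Complex.I_re, add_zero, Complex.add_im, Complex.I_im, hα.periodic]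
    simp [this]

/-- `g` expresses the coordinates of `β` near the common core through those of `α`; it preserves
the two sides of the core and the direction of the core. -/
structure IsAlignedTransition (α β : ℝ → ℝ → X) (η : ℝ) (g : C(ℂ, ℂ)) : Prop where
  pos : 0 < η
  lt : η < 1 / 2
  mem : ∀ ζ : ℂ, ζ.re ∈ Set.Icc (3 / 2 - η) (3 / 2 + η) → (g ζ).re ∈ Set.Ioo 1 2
  eq : ∀ ζ : ℂ, ζ.re ∈ Set.Icc (3 / 2 - η) (3 / 2 + η) → α ζ.re ζ.im = β (g ζ).re (g ζ).im
  periodic : ∀ ζ, (g (ζ + Complex.I)).re = (g ζ).re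
  core : ∀ ζ : ℂ, ζ.re = 3 / 2 → (g ζ).re = 3 / 2
  right : ∀ ζ : ℂ, ζ.re ∈ Set.Ioc (3 / 2) (3 / 2 + η) → 3 / 2 < (g ζ).re
  left : ∀ ζ : ℂ, ζ.re ∈ Set.Ico (3 / 2 - η) (3 / 2) → (g ζ).re < 3 / 2
  mono : StrictMono fun x : ℝ => (g ⟨3 / 2, x⟩).im
  add_one : ∀ x : ℝ, (g ⟨3 / 2, x + 1⟩).im = (g ⟨3 / 2, x⟩).im + 1

theorem convex_re_preimage {s : Set ℝ} (hs : Convex ℝ s) : Convex ℝ {ζ : ℂ | ζ.re ∈ s} :=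
  hs.linear_preimage Complex.reLm

/-- Only the core goes to the core, so each side of it goes to a single side, and by `hpos` the
right goes to the right. What remains, the fate of the left side and the direction along the core,
is decided by the local degree `1` of `g` at a core point. -/
theorem IsOrientedBand.isAlignedTransition [OrientedSurface X] (hα : IsOrientedBand α)
    (hβ : IsOrientedBand β) (hcore : Set.range (α (3 / 2)) = Set.range (β (3 / 2))) {η : ℝ}
    (hη : 0 < η) (hη' : η < 1 / 2) {g : C(ℂ, ℂ)}
    (hg : ∀ ζ : ℂ, ζ.re ∈ Set.Icc (3 / 2 - η) (3 / 2 + η) →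
      (g ζ).re ∈ Set.Ioo 1 2 ∧ α ζ.re ζ.im = β (g ζ).re (g ζ).im)
    (hper : ∀ ζ, (g (ζ + Complex.I)).re = (g ζ).re)
    (hpos : 3 / 2 < (g ⟨3 / 2 + η, 0⟩).re) : IsAlignedTransition α β η g := by
  have h32 : (3 / 2 : ℝ) ∈ Set.Icc (1 : ℝ) 2 := by constructor <;> norm_num
  have hIcc : ∀ u ∈ Set.Icc (3 / 2 - η) (3 / 2 + η), u ∈ Set.Icc (1 : ℝ) 2 := fun u hu =>
    ⟨by linarith [hu.1], by linarith [hu.2]⟩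
  have h32' : (3 / 2 : ℝ) ∈ Set.Icc (3 / 2 - η) (3 / 2 + η) := ⟨by linarith, by linarith⟩
  have hcoreg : ∀ ζ : ℂ, ζ.re = 3 / 2 → (g ζ).re = 3 / 2 := fun ζ hζ => by
    obtain ⟨h1, h2⟩ := hg ζ (hζ ▸ h32')
    have h3 : α ζ.re ζ.im ∈ Set.range (β (3 / 2)) := by rw [← hcore, hζ]; exact ⟨_, rfl⟩
    obtain ⟨x, hx⟩ := h3
    exact (hβ.inj _ h32 _ (Set.Ioo_subset_Icc_self h1) _ _ (hx.trans h2)).1.symm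
  have hcoreg' : ∀ ζ : ℂ, ζ.re ∈ Set.Icc (3 / 2 - η) (3 / 2 + η) → (g ζ).re = 3 / 2 →
      ζ.re = 3 / 2 := fun ζ hζ h => by
    obtain ⟨h1, h2⟩ := hg ζ hζ
    have h3 : α ζ.re ζ.im ∈ Set.range (α (3 / 2)) := by rw [hcore, h2, h]; exact ⟨_, rfl⟩
    obtain ⟨x, hx⟩ := h3
    exact (hα.inj _ h32 _ (hIcc _ hζ) _ _ hx).1.symm
  have hgc : Continuous fun ζ => (g ζ).re - 3 / 2 := by fun_prop
  have hright : ∀ ζ : ℂ, ζ.re ∈ Set.Ioc (3 / 2) (3 / 2 + η) → 0 < (g ζ).re - 3 / 2 := by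
    refine (pos_or_neg_of_isPreconnected (convex_re_preimage (convex_Ioc _ _)).isPreconnected
      hgc.continuousOn fun ζ hζ h => ?_).resolve_right fun h => ?_
    · exact hζ.1.ne' (hcoreg' ζ ⟨by linarith [hζ.1], hζ.2⟩ (by linarith))
    · have := h ⟨3 / 2 + η, 0⟩ ⟨by simpa using hη, le_rfl⟩
      linarith
  have hleft := pos_or_neg_of_isPreconnected (convex_re_preimage
      (convex_Ico (3 / 2 - η) (3 / 2))).isPreconnected hgc.continuousOn fun ζ hζ h =>
    hζ.2.ne (hcoreg' ζ ⟨hζ.1, by linarith [hζ.2]⟩ (by linarith))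
  set φ : ℝ → ℝ := fun x => (g ⟨3 / 2, x⟩).im with hφ
  have hmk : Continuous fun x : ℝ => (⟨3 / 2, x⟩ : ℂ) := by
    have : Continuous fun x : ℝ => ((3 / 2 : ℝ) : ℂ) + x * Complex.I := by fun_prop
    exact this.congr fun x => (Complex.mk_eq_add_mul_I _ _).symm
  have hφc : Continuous φ := Complex.continuous_im.comp (g.continuous.comp hmk)
  have hφeq : ∀ x, α (3 / 2) x = β (3 / 2) (φ x) := fun x => by
    have := (hg ⟨3 / 2, x⟩ h32').2
    rwa [hcoreg _ rfl] at this
  have hstep : ∀ x, ∃ n : ℤ, φ (x + 1) = φ x + n := fun x => by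
    refine (hβ.inj _ h32 _ h32 _ _ ?_).2
    rw [← hφeq, ← hφeq, hα.periodic]
  choose k hk using hstep
  have hkc := eq_of_continuous_intCast (f := fun x => φ (x + 1) - φ x) (by fun_prop) k
    fun x => by rw [hk]; ring
  have hd : ∀ x, φ (x + 1) = φ x + k 0 := fun x => by rw [hk, hkc x 0]
  have hinj : ∀ x y, ∀ n : ℤ, φ y = φ x + n → ∃ m : ℤ, y = x + m := fun x y n h => by
    refine (hα.inj _ h32 _ h32 _ _ ?_).2
    rw [hφeq, hφeq, h, apply_add_int_of_periodic hβ.periodic]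
  -- local degree at a core point
  set ζ₀ : ℂ := ⟨3 / 2, 0⟩ with hζ₀
  have hgo : PlanarOrientationPreservingAt g ζ₀ := by
    obtain ⟨h1, h2⟩ := hg ζ₀ h32'
    refine OrientationPreservingAt.of_comp_left (X := ℂ) (Y := ℂ)
      (g := fun w : ℂ => β w.re w.im) (f := g) ?_
      (hβ.orient _ h1.1 h1.2) (hβ.eventually_continuousAt h1.1 h1.2)
      (.of_forall fun w => g.continuous.continuousAt)
    refine (hα.orient ζ₀ (by norm_num [hζ₀]) (by norm_num [hζ₀])).congr ?_
    filter_upwards [Complex.continuous_re.continuousAt.preimage_mem_nhds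
      (Icc_mem_nhds (show 3 / 2 - η < ζ₀.re by simpa [hζ₀] using hη)
        (show ζ₀.re < 3 / 2 + η by simpa [hζ₀] using hη))] with w hw
    exact (hg w hw).2
  rw [planarOrientationPreservingAt_iff] at hgo
  obtain ⟨ρ, hρ, hρη⟩ := (hgo.and (Ioc_mem_nhdsGT hη)).exists
  have hcont := continuous_circleLoop (R := ρ) (z := ζ₀)
    (fun w _ => g.continuous.continuousAt) hρη.1.le le_rfl
  have hloop := circleLoop_periodic g ζ₀ ρ
  have hpt : ∀ s : ℝ, ζ₀ + ρ * Complex.exp (s * Complex.I) = ⟨3 / 2 + ρ * Real.cos s, ρ * Real.sin s⟩ :=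
    fun s => by
      rw [exp_mul_I_eq_mk]
      apply Complex.ext <;> simp [hζ₀]
  have hgζ₀ : (g ζ₀).re = 3 / 2 := hcoreg _ rfl
  have hρcos : ∀ s : ℝ, |ρ * Real.cos s| ≤ η := fun s => by
    rw [abs_mul, abs_of_pos hρη.1]
    exact (mul_le_of_le_one_right hρη.1.le (Real.abs_cos_le_one s)).trans hρη.2
  have hre_pos : ∀ s : ℝ, 0 < Real.cos s →
      0 < (g (ζ₀ + ρ * Complex.exp (s * Complex.I)) - g ζ₀).re := fun s hs => by
    rw [Complex.sub_re, hgζ₀, hpt]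
    have := mul_pos hρη.1 hs
    exact hright _ ⟨by simpa using this, by simpa using (le_abs_self _).trans (hρcos s)⟩
  have hre_zero : ∀ s : ℝ, Real.cos s = 0 →
      (g (ζ₀ + ρ * Complex.exp (s * Complex.I)) - g ζ₀).re = 0 := fun s hs => by
    rw [Complex.sub_re, hgζ₀, hpt, hcoreg _ (by simp [hs]), sub_self]
  have hleft_mem : ∀ s : ℝ, Real.cos s < 0 → 3 / 2 + ρ * Real.cos s ∈ Set.Ico (3 / 2 - η) (3 / 2) :=
    fun s hs => by
      have h1 := mul_neg_of_pos_of_neg hρη.1 hs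
      have h2 := neg_le_of_abs_le (hρcos s)
      exact ⟨by linarith, by linarith⟩
  -- Were both sides mapped to the right, the loop would stay in the closed right half plane minus
  -- the origin and have winding number `0`.
  replace hleft := hleft.resolve_left fun hl => by
    have h1 := hρ.of_segment (c' := fun _ => 1) hcont continuous_const hloop (fun _ => rfl)
      fun s u hu h0 => by
        have h2 : 0 ≤ (g (ζ₀ + ρ * Complex.exp (s * Complex.I)) - g ζ₀).re := by
          rcases lt_trichotomy (Real.cos s) 0 with h | h | h
          · rw [Complex.sub_re, hgζ₀, hpt]
            exact (hl _ (hleft_mem s h)).le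
          · exact (hre_zero s h).ge
          · exact (hre_pos s h).le
        have h3 := congrArg Complex.re h0
        rw [Complex.add_re, ← Complex.ofReal_one, ← Complex.ofReal_sub, Complex.re_ofReal_mul,
          Complex.re_ofReal_mul, Complex.ofReal_re, Complex.zero_re] at h3
        have h4 := mul_nonneg (sub_nonneg.2 hu.2) h2
        have h5 : u = 0 := by linarith [hu.1]
        rw [h5] at h0
        exact hρ.ne_zero s (by simpa using h0)
    exact one_ne_zero (h1.unique (hasWinding_const one_ne_zero))
  -- If `g` preserved the sides but reversed the core, the loop would never be opposite to `exp
  -- (-is)` and would have winding number `-1`.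
  have hmono := (strictMono_or_strictAnti_of_circle hφc hd hinj).resolve_right fun hanti => by
    have h1 := hρ.of_segment (c' := fun s => Complex.exp ((-s : ℝ) * Complex.I)) hcont (by fun_prop) hloop
      (fun s => exp_mul_I_eq_iff.2 ⟨-1, by push_cast; ring⟩) fun s u hu h0 => by
        have hexp : Complex.exp ((-s : ℝ) * Complex.I) = ⟨Real.cos s, -Real.sin s⟩ := by
          rw [exp_mul_I_eq_mk, Real.cos_neg, Real.sin_neg]
        rw [hexp, ← Complex.ofReal_one, ← Complex.ofReal_sub] at h0
        have h3 := congrArg Complex.re h0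
        have h3' := congrArg Complex.im h0
        rw [Complex.add_re, Complex.re_ofReal_mul, Complex.re_ofReal_mul, Complex.zero_re] at h3
        rw [Complex.add_im, Complex.im_ofReal_mul, Complex.im_ofReal_mul, Complex.zero_im] at h3'
        have hcomb : ∀ {a b : ℝ}, 0 < a → 0 < b → 0 < (1 - u) * a + u * b := fun ha hb => by
          rcases hu.1.eq_or_lt with rfl | hu0
          · simpa using ha
          · have := mul_pos hu0 hb
            have := mul_nonneg (sub_nonneg.2 hu.2) ha.le
            linarith
        rcases lt_trichotomy (Real.cos s) 0 with h | h | h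
        · have h4 : (g (ζ₀ + ρ * Complex.exp (s * Complex.I)) - g ζ₀).re < 0 := by
            rw [Complex.sub_re, hgζ₀, hpt]
            exact hleft _ (hleft_mem s h)
          have := hcomb (neg_pos.2 h4) (neg_pos.2 h)
          linarith
        · have h4 : (g (ζ₀ + ρ * Complex.exp (s * Complex.I)) - g ζ₀).im =
              φ (ρ * Real.sin s) - φ 0 := by
            rw [Complex.sub_im, hpt, h, mul_zero, add_zero]
          rw [h4] at h3'
          have h5 := Real.sin_sq_add_cos_sq s
          rw [h] at h5
          have h6 : Real.sin s = 1 ∨ Real.sin s = -1 := by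
            rw [← sq_eq_one_iff]; linarith
          rcases h6 with h6 | h6
          · rw [h6] at h3'
            have := hanti (show (0 : ℝ) < ρ * 1 by linarith [hρη.1])
            have := hcomb (show 0 < -(φ (ρ * 1) - φ 0) by linarith) (one_pos)
            simp only at h3'
            linarith
          · rw [h6] at h3'
            have := hanti (show ρ * -1 < (0 : ℝ) by linarith [hρη.1])
            have := hcomb (show 0 < φ (ρ * -1) - φ 0 by linarith) (one_pos)
            simp only at h3'
            linarith
        · exact (hcomb (hre_pos s h) h).ne' h3
    have h2 : HasWinding (fun s => Complex.exp ((-s : ℝ) * Complex.I)) (-1) :=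
      ⟨fun s => -s, continuous_neg, fun s => by push_cast; ring, fun s =>
        ⟨Complex.exp_ne_zero _, by
          beta_reduce; rw [Complex.norm_exp_ofReal_mul_I, Complex.ofReal_one, one_mul]⟩⟩
    have := h1.unique h2
    omega
  refine ⟨hη, hη', fun ζ hζ => (hg ζ hζ).1, fun ζ hζ => (hg ζ hζ).2, hper, hcoreg,
    fun ζ hζ => by linarith [hright ζ hζ], fun ζ hζ => by linarith [hleft ζ hζ], hmono.1, fun x => ?_⟩
  have := hd x
  rwa [hmono.2, Int.cast_one] at this

end Comparison

/-- The cut-off profile that increases from `0` to `1` on `[l, l + η]`. -/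
noncomputable def ramp (l η u : ℝ) : ℝ := min 1 (max 0 ((u - l) / η))

theorem continuous_ramp (l η : ℝ) : Continuous (ramp l η) := by
  unfold ramp
  fun_prop

theorem ramp_of_le {l η u : ℝ} (hη : 0 < η) (hu : u ≤ l) : ramp l η u = 0 := by
  rw [ramp, max_eq_left (div_nonpos_of_nonpos_of_nonneg (sub_nonpos.2 hu) hη.le),
    min_eq_right zero_le_one]

theorem ramp_of_ge {l η u : ℝ} (hη : 0 < η) (hu : l + η ≤ u) : ramp l η u = 1 := by
  have h : 1 ≤ (u - l) / η := by rw [le_div_iff₀ hη]; linarith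
  rw [ramp, max_eq_right (zero_le_one.trans h), min_eq_left h]

/-! ### Moving a twist across the common core of two annuli -/

section Gluing

variable {X : Type*} {α β : ℝ → ℝ → X} {η : ℝ} {g : C(ℂ, ℂ)}

/-- The band that agrees with `α` on the right of the core and with `β` on the left of it. -/
noncomputable def gluedBand (α β : ℝ → ℝ → X) (g : C(ℂ, ℂ)) (u x : ℝ) : X :=
  open Classical in if 3 / 2 ≤ u then α u x else β u (g ⟨3 / 2, x⟩).im

theorem gluedBand_of_le {u : ℝ} (hu : 3 / 2 ≤ u) (x : ℝ) : gluedBand α β g u x = α u x :=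
  if_pos hu

theorem gluedBand_of_lt {u : ℝ} (hu : u < 3 / 2) (x : ℝ) :
    gluedBand α β g u x = β u (g ⟨3 / 2, x⟩).im :=
  if_neg hu.not_ge

theorem continuous_mk_re_im : Continuous fun p : ℝ × ℝ => (⟨p.1, p.2⟩ : ℂ) :=
  Complex.equivRealProdCLM.symm.continuous

theorem continuous_core (g : C(ℂ, ℂ)) :
    Continuous fun x : ℝ => (g ⟨3 / 2, x⟩).im :=
  Complex.continuous_im.comp (g.continuous.comp
    (continuous_mk_re_im.comp (Continuous.prodMk_right (3 / 2 : ℝ))))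

theorem IsAlignedTransition.core_add_int (hg : IsAlignedTransition α β η g) (x : ℝ) (n : ℤ) :
    (g ⟨3 / 2, x + n⟩).im = (g ⟨3 / 2, x⟩).im + n := by
  have := apply_add_int_of_degree (θ := fun x => (g ⟨3 / 2, x⟩).im) (d := 1)
    (fun x => by simpa using hg.add_one x) x n
  simpa using this

theorem IsAlignedTransition.core_surjective (hg : IsAlignedTransition α β η g) :
    Function.Surjective fun x : ℝ => (g ⟨3 / 2, x⟩).im :=
  surjective_of_continuous_add_one (continuous_core g) hg.core_add_int

theorem IsAlignedTransition.core_eq (hg : IsAlignedTransition α β η g) (x : ℝ) :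
    α (3 / 2) x = β (3 / 2) (g ⟨3 / 2, x⟩).im := by
  have := hg.eq ⟨3 / 2, x⟩ ⟨by linarith [hg.pos], by linarith [hg.pos]⟩
  rwa [hg.core _ rfl] at this

/-- The right half of the glued band lies in the right half of `β`. -/
theorem IsAlignedTransition.exists_right (hg : IsAlignedTransition α β η g) {u : ℝ}
    (hu : u ∈ Set.Icc (3 / 2) (3 / 2 + η)) (x : ℝ) :
    ∃ u' ∈ Set.Ico (3 / 2 : ℝ) 2, ∃ x', α u x = β u' x' := by
  have hu' : u ∈ Set.Icc (3 / 2 - η) (3 / 2 + η) := ⟨by linarith [hu.1, hg.pos], hu.2⟩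
  refine ⟨_, ⟨?_, (hg.mem ⟨u, x⟩ hu').2⟩, _, hg.eq ⟨u, x⟩ hu'⟩
  rcases hu.1.eq_or_lt with h | h
  · exact (hg.core _ h.symm).ge
  · exact (hg.right _ ⟨h, hu.2⟩).le

variable [TopologicalSpace X] [ChartedSpace ℂ X]

/-- The right half of `α` lies on the right side of `β`, so the two halves do not overlap, and the
reparametrization of `β` makes them match on the core. -/
theorem IsAlignedTransition.isBand_gluedBand [OrientedSurface X] (hα : IsOrientedBand α)
    (hβ : IsOrientedBand β) (hg : IsAlignedTransition α β η g) :
    IsBand (gluedBand α β g) (3 / 2 - η) (3 / 2 + η) := by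
  have hη := hg.pos
  have hη' := hg.lt
  refine ⟨by linarith, ?_, fun u x => ?_, fun u hu u' hu' x x' h => ?_, ?_⟩
  · have h1 : ContinuousOn (Function.uncurry (gluedBand α β g))
        (Set.Icc (3 / 2) (3 / 2 + η) ×ˢ Set.univ) :=
      (hα.cont.mono (Set.prod_mono (Set.Icc_subset_Icc (by norm_num) (by linarith))
        subset_rfl)).congr fun p hp => gluedBand_of_le hp.1.1 _
    have h2 : ContinuousOn (Function.uncurry (gluedBand α β g))
        (Set.Icc (3 / 2 - η) (3 / 2) ×ˢ Set.univ) := by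
      have hc := (continuous_core g)
      refine (hβ.cont.comp (f := fun p : ℝ × ℝ => (p.1, (g ⟨3 / 2, p.2⟩).im))
        (s := Set.Icc (3 / 2 - η) (3 / 2) ×ˢ Set.univ)
        (continuous_fst.prodMk (hc.comp continuous_snd)).continuousOn
        fun p hp => ⟨⟨by linarith [hp.1.1], by linarith [hp.1.2]⟩, trivial⟩).congr fun p hp => ?_
      rcases hp.1.2.eq_or_lt with h | h
      · obtain ⟨u, x⟩ := p
        simp only at h
        subst h
        exact (gluedBand_of_le le_rfl x).trans (hg.core_eq x)
      · exact gluedBand_of_lt h _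
    refine (h1.union_of_isClosed h2 (isClosed_Icc.prod isClosed_univ)
      (isClosed_Icc.prod isClosed_univ)).mono fun p hp => ?_
    rcases le_total (3 / 2) p.1 with h | h
    · exact Or.inl ⟨⟨h, hp.1.2⟩, trivial⟩
    · exact Or.inr ⟨⟨hp.1.1, h⟩, trivial⟩
  · rcases le_or_gt (3 / 2) u with h | h
    · rw [gluedBand_of_le h, gluedBand_of_le h, hα.periodic]
    · rw [gluedBand_of_lt h, gluedBand_of_lt h, hg.add_one, hβ.periodic]
  · have hIcc : ∀ v ∈ Set.Icc (3 / 2 - η) (3 / 2 + η), v ∈ Set.Icc (1 : ℝ) 2 := fun v hv =>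
      ⟨by linarith [hv.1], by linarith [hv.2]⟩
    have hne : ∀ v ∈ Set.Icc (3 / 2 - η) (3 / 2 + η), ∀ w ∈ Set.Icc (3 / 2 - η) (3 / 2 + η),
        3 / 2 ≤ v → w < 3 / 2 → ∀ y y', α v y ≠ β w y' := by
      intro v hv w hw h1 h2 y y' heq
      obtain ⟨v', hv', z, hz⟩ := hg.exists_right ⟨h1, hv.2⟩ y
      have := (hβ.inj v' ⟨by linarith [hv'.1], hv'.2.le⟩ w (hIcc w hw) _ _ (hz.symm.trans heq)).1
      linarith [hv'.1]
    rcases le_or_gt (3 / 2) u with h1 | h1 <;> rcases le_or_gt (3 / 2) u' with h2 | h2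
    · rw [gluedBand_of_le h1, gluedBand_of_le h2] at h
      exact hα.inj u (hIcc u hu) u' (hIcc u' hu') _ _ h
    · rw [gluedBand_of_le h1, gluedBand_of_lt h2] at h
      exact absurd h (hne u hu u' hu' h1 h2 _ _)
    · rw [gluedBand_of_lt h1, gluedBand_of_le h2] at h
      exact absurd h.symm (hne u' hu' u hu h2 h1 _ _)
    · rw [gluedBand_of_lt h1, gluedBand_of_lt h2] at h
      obtain ⟨h3, n, hn⟩ := hβ.inj u (hIcc u hu) u' (hIcc u' hu') _ _ h
      rw [← hg.core_add_int] at hn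
      exact ⟨h3, n, hg.mono.injective hn⟩
  -- For openness at the core, the right half of `α` is enlarged slightly to the left; if the
  -- enlargement is small, the added points already belong to the left half of `β`.
  · have hev : ∀ᶠ u in 𝓝 (3 / 2 : ℝ), ∀ x ∈ Set.Icc (0 : ℝ) 1, 3 / 2 - η < (g ⟨u, x⟩).re := by
      refine isCompact_Icc.eventually_forall_of_forall_eventually fun x _ => ?_
      have hc : Continuous fun p : ℝ × ℝ => (g ⟨p.1, p.2⟩).re :=
        Complex.continuous_re.comp (g.continuous.comp continuous_mk_re_im)
      refine hc.continuousAt.eventually (lt_mem_nhds ?_)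
      beta_reduce
      rw [hg.core _ rfl]
      linarith
    obtain ⟨ε, hε, hball⟩ := Metric.nhds_basis_ball.eventually_iff.1 hev
    have hlow : ∀ u ∈ Set.Ioo (3 / 2 - min ε η) (3 / 2), ∀ x, 3 / 2 - η < (g ⟨u, x⟩).re := by
      intro u hu x
      have h1 : u ∈ Metric.ball (3 / 2 : ℝ) ε := by
        rw [Metric.mem_ball, Real.dist_eq, abs_lt]
        exact ⟨by linarith [hu.1, min_le_left ε η], by linarith [hu.2]⟩
      have h2 := hball h1 (Int.fract x) ⟨Int.fract_nonneg x, (Int.fract_lt_one x).le⟩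
      have h3 : Function.Periodic (fun x : ℝ => (g ⟨u, x⟩).re) 1 := fun x => by
        have := hg.periodic ⟨u, x⟩
        have h4 : (⟨u, x⟩ : ℂ) + Complex.I = ⟨u, x + 1⟩ := by apply Complex.ext <;> simp
        rwa [h4] at this
      have h4 := h3.int_mul ⌊x⌋ (Int.fract x)
      simp only [mul_one, Int.fract_add_floor] at h4
      rwa [h4]
    have hmin : 0 < min ε η := lt_min hε hη
    have hset : openBandSet (gluedBand α β g) (3 / 2 - η) (3 / 2 + η) =
        openBandSet α (3 / 2 - min ε η) (3 / 2 + η) ∪ openBandSet β (3 / 2 - η) (3 / 2) := by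
      ext y
      constructor
      · rintro ⟨u, hu, x, rfl⟩
        rcases le_or_gt (3 / 2) u with h | h
        · rw [gluedBand_of_le h]
          exact Or.inl ⟨u, ⟨by linarith, hu.2⟩, x, rfl⟩
        · rw [gluedBand_of_lt h]
          exact Or.inr ⟨u, ⟨hu.1, h⟩, _, rfl⟩
      · rintro (⟨u, hu, x, rfl⟩ | ⟨u, hu, x, rfl⟩)
        · rcases le_or_gt (3 / 2) u with h | h
          · exact ⟨u, ⟨by linarith, hu.2⟩, x, gluedBand_of_le h x⟩
          · have h1 : u ∈ Set.Ico (3 / 2 - η) (3 / 2) :=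
              ⟨by linarith [hu.1, min_le_right ε η], h⟩
            have h2 := hg.left ⟨u, x⟩ h1
            obtain ⟨x', hx'⟩ := hg.core_surjective (g ⟨u, x⟩).im
            refine ⟨(g ⟨u, x⟩).re, ⟨hlow u ⟨hu.1, h⟩ x, by linarith⟩, x', ?_⟩
            rw [gluedBand_of_lt h2]
            refine (congrArg _ hx').trans (hg.eq ⟨u, x⟩ ⟨h1.1, by linarith⟩).symm
        · obtain ⟨x', rfl⟩ := hg.core_surjective x
          exact ⟨u, ⟨hu.1, by linarith [hu.2]⟩, x', gluedBand_of_lt hu.2 x'⟩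
    rw [hset]
    exact (hα.isOpen_openBandSet (by linarith [min_le_right ε η]) (by linarith)).union
      (hβ.isOpen_openBandSet (by linarith) (by norm_num))

/-- Moving a twist from `α` to `β` through the glued band. -/
theorem IsAlignedTransition.joinedIn_twists [OrientedSurface X] (hα : IsOrientedBand α)
    (hβ : IsOrientedBand β) (hg : IsAlignedTransition α β η g) {s t : HomeoPlus X}
    (hs : IsBandMap α 1 2 twistShear s.1) (ht : IsBandMap β 1 2 twistShear t.1) :
    ∃ (f₁ f₂ : HomeoPlus X) (x₁ x₂ x₃ : X), JoinedIn {e : HomeoPlus X | e.1 x₁ = x₁} s f₁ ∧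
      JoinedIn {e : HomeoPlus X | e.1 x₂ = x₂} f₁ f₂ ∧
      JoinedIn {e : HomeoPlus X | e.1 x₃ = x₃} f₂ t ∧
      (∀ y, y ∉ bandSet α 1 2 → f₁.1 y = y) ∧ ∀ y, y ∉ bandSet β 1 2 → f₂.1 y = y := by
  have hη := hg.pos
  have hη' := hg.lt
  have hglue := hg.isBand_gluedBand hα hβ
  have hαb := hα.isBand le_rfl one_lt_two le_rfl
  have hβb := hβ.isBand le_rfl one_lt_two le_rfl
  have hIcc : ∀ v ∈ Set.Icc (3 / 2 - η) (3 / 2 + η), v ∈ Set.Icc (1 : ℝ) 2 := fun v hv =>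
    ⟨by linarith [hv.1], by linarith [hv.2]⟩
  -- the twist on the right half of the core of `α`
  have hshear₁ : IsShear (fun u x => x + ramp (3 / 2) η u) 1 2 :=
    isShear_add (continuous_ramp _ _) (ramp_of_le hη (by norm_num)) (ramp_of_ge hη (by linarith))
  obtain ⟨f₁, hf₁, hj₁⟩ := hαb.joinedIn isShear_twistShear hshear₁ hs
  -- The map `f₁` moves only points of the right half, which `α` and the glued band share, so it is
  -- also a shear of the glued band.
  have hfix₁ : ∀ y, (∀ u ∈ Set.Ico (3 / 2) (3 / 2 + η), ∀ x, α u x ≠ y) → f₁.1 y = y := by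
    intro y hy
    by_cases hyb : y ∈ bandSet α 1 2
    · obtain ⟨u, hu, x, rfl⟩ := hyb
      rw [hf₁.1 u hu]
      rcases lt_or_ge u (3 / 2) with h | h
      · beta_reduce
        rw [ramp_of_le hη h.le, add_zero]
      · beta_reduce
        rw [ramp_of_ge hη (not_lt.1 fun h' => hy u ⟨h, h'⟩ x rfl), hα.periodic]
    · exact hf₁.2 y hyb
  have hshear₁' : IsShear (fun u x => x + ramp (3 / 2) η u) (3 / 2 - η) (3 / 2 + η) :=
    isShear_add (continuous_ramp _ _) (ramp_of_le hη (by linarith)) (ramp_of_ge hη le_rfl)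
  have hf₁' : IsBandMap (gluedBand α β g) (3 / 2 - η) (3 / 2 + η)
      (fun u x => x + ramp (3 / 2) η u) f₁.1 := by
    refine ⟨fun u hu x => ?_, fun y hy => hfix₁ y fun u hu x h => hy ?_⟩
    · rcases le_or_gt (3 / 2) u with h | h
      · rw [gluedBand_of_le h, gluedBand_of_le h]
        exact hf₁.1 u (hIcc u hu) x
      · beta_reduce
        rw [ramp_of_le hη h.le, add_zero]
        refine hfix₁ _ fun v hv y hvy => ?_
        rw [← gluedBand_of_le (α := α) (β := β) (g := g) hv.1] at hvy
        have := (hglue.inj v ⟨by linarith [hv.1], hv.2.le⟩ u hu _ _ hvy).1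
        linarith [hv.1]
    · exact ⟨u, ⟨by linarith [hu.1], hu.2.le⟩, x, (gluedBand_of_le hu.1 x).trans h⟩
  -- the twist on the left half of the core of `β`
  have hshear₂ : IsShear (fun u x => x + ramp (3 / 2 - η) η u) (3 / 2 - η) (3 / 2 + η) :=
    isShear_add (continuous_ramp _ _) (ramp_of_le hη le_rfl) (ramp_of_ge hη (by linarith))
  obtain ⟨f₂, hf₂, hj₂⟩ := hglue.joinedIn hshear₁' hshear₂ hf₁'
  have hfix₂ : ∀ y, (∀ u ∈ Set.Ico (3 / 2 - η) (3 / 2), ∀ x, β u (g ⟨3 / 2, x⟩).im ≠ y) →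
      f₂.1 y = y := by
    intro y hy
    by_cases hyb : y ∈ bandSet (gluedBand α β g) (3 / 2 - η) (3 / 2 + η)
    · obtain ⟨u, hu, x, rfl⟩ := hyb
      rw [hf₂.1 u hu]
      beta_reduce
      rcases lt_or_ge u (3 / 2) with h | h
      · exact absurd (gluedBand_of_lt h x).symm (hy u ⟨hu.1, h⟩ x)
      · rw [ramp_of_ge hη (by linarith), hglue.periodic]
    · exact hf₂.2 y hyb
  -- The left half of the glued band is `β` reparametrized by `e`; in the coordinates of `β` itself
  -- the map `f₂` is the ramp translation conjugated by `e`, which is still a shear.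
  let e : ℝ ≃o ℝ := hg.mono.orderIsoOfSurjective _ hg.core_surjective
  have he : ∀ x, e x = (g ⟨3 / 2, x⟩).im := fun x => rfl
  have hes : ∀ x, e.symm (x + 1) = e.symm x + 1 := fun x => by
    rw [e.symm_apply_eq, he, hg.add_one, ← he, e.apply_symm_apply]
  have hec : Continuous e := e.continuous
  have hesc : Continuous e.symm := e.symm.continuous
  have hshear₂' : IsShear (fun u x => e (e.symm x + ramp (3 / 2 - η) η u)) 1 2 := by
    have hr := continuous_ramp (3 / 2 - η) η
    refine ⟨?_, fun u _ x y hxy => ?_, fun u _ x => ?_, fun x => ?_, fun x => ?_⟩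
    · simp only [Function.uncurry_def]
      exact (hec.comp ((hesc.comp continuous_snd).add (hr.comp continuous_fst))).continuousOn
    · exact e.strictMono (add_lt_add_left (e.symm.strictMono hxy) _)
    · rw [hes, add_right_comm, he, hg.add_one, he]
    · rw [ramp_of_le hη (by linarith), add_zero, e.apply_symm_apply]
    · rw [ramp_of_ge hη (by linarith), ← hes, e.apply_symm_apply]
  have hf₂' : IsBandMap β 1 2 (fun u x => e (e.symm x + ramp (3 / 2 - η) η u)) f₂.1 := by
    refine ⟨fun u hu x => ?_, fun y hy => hfix₂ y fun u hu x h => hy ?_⟩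
    · obtain ⟨x', rfl⟩ := e.surjective x
      beta_reduce
      rw [e.symm_apply_apply]
      have hout : u ∉ Set.Ico (3 / 2 - η) (3 / 2) → f₂.1 (β u (e x')) = β u (e x') := fun hnot =>
        hfix₂ _ fun v hv y hvy => hnot <| by
          rwa [← (hβ.inj v ⟨by linarith [hv.1], by linarith [hv.2]⟩ u hu _ _ hvy).1]
      rcases lt_or_ge u (3 / 2 - η) with h1 | h1
      · rw [hout fun h => absurd h.1 h1.not_ge, ramp_of_le hη h1.le, add_zero]
      · rcases lt_or_ge u (3 / 2) with h2 | h2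
        · have := hf₂.1 u ⟨h1, by linarith⟩ x'
          rwa [gluedBand_of_lt h2, gluedBand_of_lt h2] at this
        · rw [hout fun h => absurd h.2 h2.not_gt, ramp_of_ge hη (by linarith), he, he, hg.add_one,
            hβ.periodic]
    · exact ⟨u, ⟨by linarith [hu.1], by linarith [hu.2]⟩, _, h⟩
  obtain ⟨f₃, hf₃, hj₃⟩ := hβb.joinedIn hshear₂' isShear_twistShear hf₂'
  have hft : f₃ = t := Subtype.ext (Homeomorph.ext fun y => congrFun (hf₃.unique ht) y)
  subst hft
  exact ⟨f₁, f₂, _, _, _, hj₁, hj₂, hj₃, hf₁.2, hf₂'.2⟩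

/-- Any two twist homeomorphisms about the same curve are isotopic, through isotopies with fixed
points between homeomorphisms with support in one of the two annuli. -/
theorem IsOrientedBand.joinedIn_twists [OrientedSurface X] (hα : IsOrientedBand α)
    (hβ : IsOrientedBand β) (hcore : Set.range (α (3 / 2)) = Set.range (β (3 / 2)))
    {s t : HomeoPlus X} (hs : IsBandMap α 1 2 twistShear s.1)
    (ht : IsBandMap β 1 2 twistShear t.1) :
    ∃ (f₁ f₂ : HomeoPlus X) (x₁ x₂ x₃ : X), JoinedIn {e : HomeoPlus X | e.1 x₁ = x₁} s f₁ ∧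
      JoinedIn {e : HomeoPlus X | e.1 x₂ = x₂} f₁ f₂ ∧
      JoinedIn {e : HomeoPlus X | e.1 x₃ = x₃} f₂ t ∧
      (∀ y, y ∉ bandSet α 1 2 → f₁.1 y = y) ∧ ∀ y, y ∉ bandSet β 1 2 → f₂.1 y = y := by
  have h32 : (3 / 2 : ℝ) ∈ Set.Ioo (1 : ℝ) 2 := by constructor <;> norm_num
  have hsub : Set.range (α (3 / 2)) ⊆ openBandSet β 1 2 := by
    rw [hcore]
    rintro _ ⟨x, rfl⟩
    exact ⟨3 / 2, h32, x, rfl⟩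
  obtain ⟨η, hη, hη', hV⟩ := hα.exists_core_subset (hβ.isOpen_openBandSet le_rfl le_rfl) hsub
  obtain ⟨g, hg, hper⟩ := hα.exists_transition hβ hη hη' hV
  have hright : (3 / 2 + η) ∈ Set.Icc (3 / 2 - η) (3 / 2 + η) := ⟨by linarith, le_rfl⟩
  -- If the right side of `α` goes to the right side of `β`, the annuli are aligned. Equality would
  -- put a point off the core on the core. Otherwise `β` is turned upside down, which changes
  -- neither its image nor its twist.
  rcases lt_trichotomy (3 / 2) (g ⟨3 / 2 + η, 0⟩).re with h | h | h
  · exact (hα.isAlignedTransition hβ hcore hη hη' hg hper h).joinedIn_twists hα hβ hs ht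
  · obtain ⟨h1, h2⟩ := hg ⟨3 / 2 + η, 0⟩ hright
    have h3 : α (3 / 2 + η) 0 ∈ Set.range (α (3 / 2)) := by
      rw [← h] at h2
      rw [hcore]
      exact ⟨_, h2.symm⟩
    obtain ⟨x, hx⟩ := h3
    have := (hα.inj _ (Set.Ioo_subset_Icc_self h32) _ ⟨by linarith, by linarith⟩ _ _ hx).1
    linarith
  · have hflip : Continuous fun ζ => 3 - g ζ := by fun_prop
    have hcore' : Set.range (α (3 / 2)) = Set.range fun x => β (3 - 3 / 2) (-x) := by
      rw [hcore]
      norm_num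
      exact ((Equiv.neg ℝ).surjective.range_comp (β (3 / 2))).symm
    have := (hα.isAlignedTransition hβ.flip hcore' hη hη' (g := ⟨_, hflip⟩) (fun ζ hζ => ?_)
      (fun ζ => ?_) ?_).joinedIn_twists hα hβ.flip hs (hβ.flip_isBandMap ht)
    · simpa only [bandSet_flip] using this
    · obtain ⟨h1, h2⟩ := hg ζ hζ
      simp only [ContinuousMap.coe_mk, Complex.sub_re, Complex.sub_im, Complex.re_ofNat,
        Complex.im_ofNat, zero_sub, neg_neg, sub_sub_cancel]
      exact ⟨⟨by linarith [h1.2], by linarith [h1.1]⟩, h2⟩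
    · simp [hper]
    · simp only [ContinuousMap.coe_mk, Complex.sub_re, Complex.re_ofNat]
      linarith

end Gluing

/-! ### Isotopies and mapping classes -/

theorem mapClass_eq_iff {X : Type*} [TopologicalSpace X] [ChartedSpace ℂ X] {f g : HomeoPlus X} :
    mapClass f = mapClass g ↔ Joined f g := by
  rw [mapClass, mapClass, QuotientGroup.eq]
  change Joined 1 (f⁻¹ * g) ↔ Joined f g
  constructor <;> intro h
  · simpa using h.map (homeoPlus_continuous_mul_left f)
  · simpa using h.map (homeoPlus_continuous_mul_left f⁻¹)

theorem continuous_homeoPlus_toContinuousMap (X : Type*) [TopologicalSpace X] [ChartedSpace ℂ X] :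
    Continuous fun f : HomeoPlus X => (⟨f.1, f.1.continuous⟩ : C(X, X)) :=
  (continuous_induced_dom (f := fun f : X ≃ₜ X => (⟨f, f.continuous⟩ : C(X, X)))).comp
    continuous_subtype_val

theorem tendsto_homeoPlus_iff {X ι : Type*} [TopologicalSpace X] [ChartedSpace ℂ X] {l : Filter ι}
    {F : ι → HomeoPlus X} {f : HomeoPlus X} :
    Tendsto F l (𝓝 f) ↔
      Tendsto (fun i => (⟨(F i).1, (F i).1.continuous⟩ : C(X, X))) l (𝓝 ⟨f.1, f.1.continuous⟩) := by
  refine ⟨fun h => ((continuous_homeoPlus_toContinuousMap X).tendsto f).comp h, fun h => ?_⟩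
  rw [tendsto_subtype_rng, nhds_induced, tendsto_comap_iff]
  exact h

/-- On a locally compact space composition is jointly continuous for the compact-open topology. This
allows limits to be taken factor by factor. -/
theorem continuousMul_homeoPlus (X : Type*) [TopologicalSpace X] [ChartedSpace ℂ X]
    [LocallyCompactSpace X] : ContinuousMul (HomeoPlus X) := by
  refine ⟨continuous_iff_continuousAt.2 fun p => tendsto_homeoPlus_iff.2 ?_⟩
  have hc := continuous_homeoPlus_toContinuousMap X
  exact ((hc.comp continuous_fst).compCM (hc.comp continuous_snd)).tendsto p

/-- Homeomorphisms that eventually agree with `f` on every compact set converge to `f`. -/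
theorem tendsto_homeoPlus_of_eventually_eqOn {X ι : Type*} [TopologicalSpace X] [ChartedSpace ℂ X]
    {l : Filter ι} {F : ι → HomeoPlus X} {f : HomeoPlus X}
    (h : ∀ C : Set X, IsCompact C → ∀ᶠ i in l, ∀ x ∈ C, (F i).1 x = f.1 x) :
    Tendsto F l (𝓝 f) := by
  rw [tendsto_homeoPlus_iff, ContinuousMap.tendsto_nhds_compactOpen]
  intro C hC U _ hCU
  filter_upwards [h C hC] with i hi x hx
  change (F i).1 x ∈ U
  rw [hi x hx]
  exact hCU hx

/-! ### Lifts to an infinite cyclic cover -/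

section Lifts

variable {L S : Type*} [TopologicalSpace L] [ChartedSpace ℂ L] [TopologicalSpace S]
  [ChartedSpace ℂ S] {q : L → S} {h : L ≃ₜ L}

theorem IsInfiniteCyclicCover.apply_zpow (hq : IsInfiniteCyclicCover q h) (n : ℤ) (y : L) :
    q ((h ^ n) y) = q y :=
  ((hq.fiber_eq_orbit y _).2 ⟨n, rfl⟩).symm

theorem IsInfiniteCyclicCover.eq_of_comp_eq (hq : IsInfiniteCyclicCover q h) {A : Type*}
    [TopologicalSpace A] [PreconnectedSpace A] {f g : A → L} (hf : Continuous f) (hg : Continuous g)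
    (hfg : ∀ a, q (f a) = q (g a)) (a : A) (ha : f a = g a) : f = g :=
  hq.isCoveringMap.eq_of_comp_eq hf hg (funext hfg) a ha

/-- By unique lifting a deck transformation with a fixed point is the identity, and `h` has infinite
order. -/
theorem IsInfiniteCyclicCover.eq_zero_of_fixed [PreconnectedSpace L]
    (hq : IsInfiniteCyclicCover q h) {n : ℤ} {y : L} (hy : (h ^ n) y = y) : n = 0 := by
  refine hq.infinite_order n (Homeomorph.ext fun z => ?_)
  exact congrFun (hq.eq_of_comp_eq (f := h ^ n) (g := fun z => z) (h ^ n).continuous continuous_id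
    (hq.apply_zpow n) y hy) z

theorem IsInfiniteCyclicCover.zpow_injective [PreconnectedSpace L]
    (hq : IsInfiniteCyclicCover q h) {m n : ℤ} {y : L} (hy : (h ^ m) y = (h ^ n) y) : m = n := by
  refine sub_eq_zero.1 (hq.eq_zero_of_fixed (y := (h ^ n) y) ?_)
  rw [← Homeomorph.mul_apply, ← zpow_add, sub_add_cancel, hy]

theorem IsHomeoLift.mul {f' g' : HomeoPlus L} {f g : HomeoPlus S} (hf : IsHomeoLift q f' f)
    (hg : IsHomeoLift q g' g) : IsHomeoLift q (f' * g') (f * g) := fun x =>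
  (hf (g'.1 x)).trans (congrArg f.1 (hg x))

theorem IsHomeoLift.inv {f' : HomeoPlus L} {f : HomeoPlus S} (hf : IsHomeoLift q f' f) :
    IsHomeoLift q f'⁻¹ f⁻¹ := fun x => by
  have h := hf (f'.1.symm x)
  rw [f'.1.apply_symm_apply] at h
  exact (f.1.symm_apply_eq.2 h).symm

theorem IsHomeoLift.zpow {f' : HomeoPlus L} {f : HomeoPlus S} (hf : IsHomeoLift q f' f) (n : ℤ) :
    IsHomeoLift q (f' ^ n) (f ^ n) := by
  induction n with
  | zero => exact fun _ => rfl
  | succ n ih => rw [zpow_add_one, zpow_add_one]; exact ih.mul hf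
  | pred n ih => rw [zpow_sub_one, zpow_sub_one]; exact ih.mul hf.inv

theorem IsHomeoLift.list_prod {ι : Type*} {f' : ι → HomeoPlus L} {f : ι → HomeoPlus S}
    (hf : ∀ i, IsHomeoLift q (f' i) (f i)) (l : List ι) :
    IsHomeoLift q (l.map f').prod (l.map f).prod := by
  induction l with
  | nil => exact fun _ => rfl
  | cons i l ih => simpa only [List.map_cons, List.prod_cons] using (hf i).mul ih

variable [OrientedSurface L] [OrientedSurface S]

/-- Lifts of orientation preserving homeomorphisms preserve orientation. -/
theorem IsInfiniteCyclicCover.mem_homeoPlus (hq : IsInfiniteCyclicCover q h) {f' : L ≃ₜ L}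
    {f : HomeoPlus S} (hf : ∀ y, q (f' y) = f.1 (q y)) : f' ∈ HomeoPlus L := by
  rw [mem_homeoPlus_iff]
  intro y
  have hqc := hq.isCoveringMap.continuous
  have h1 : OrientationPreservingAt (fun y => f.1 (q y)) y :=
    (mem_homeoPlus_iff.1 f.2 (q y)).comp (hq.orientationPreserving y)
      (.of_forall fun _ => f.1.continuous.continuousAt) (.of_forall fun _ => hqc.continuousAt)
  exact (h1.congr (.of_forall fun y => (hf y).symm)).of_comp_left (hq.orientationPreserving _)
    (.of_forall fun _ => hqc.continuousAt) (.of_forall fun _ => f'.continuous.continuousAt)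

/-- Isotopies of the base lift to isotopies of the cover. -/
theorem IsInfiniteCyclicCover.exists_lift_of_path [CompactSpace S]
    (hq : IsInfiniteCyclicCover q h) {f g : HomeoPlus S} (p : Path f g) {f' : HomeoPlus L}
    (hf : IsHomeoLift q f' f) : ∃ g' : HomeoPlus L, IsHomeoLift q g' g ∧ mapClass g' = mapClass f' ∧
      ∀ y, (∀ s, (p s).1 (q y) = q y) → g'.1 y = f'.1 y := by
  have hcov := hq.isCoveringMap
  have hH : Continuous fun a : unitInterval × S => (p a.1).1 a.2 :=
    ContinuousMap.continuous_uncurry_of_continuous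
      ⟨_, (continuous_homeoPlus_toContinuousMap S).comp p.continuous⟩
  -- The track of the isotopy is a continuous bijection of a compact Hausdorff space, so the inverse
  -- homeomorphisms also vary continuously.
  let E : unitInterval × S ≃ unitInterval × S :=
    { toFun := fun a => (a.1, (p a.1).1 a.2)
      invFun := fun a => (a.1, (p a.1).1.symm a.2)
      left_inv := fun a => by simp
      right_inv := fun a => by simp }
  have hE : Continuous E := continuous_fst.prodMk hH
  have hH' : Continuous fun a : unitInterval × S => (p a.1).1.symm a.2 :=
    continuous_snd.comp (hE.homeoOfEquivCompactToT2).symm.continuous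
  have hpq : Continuous fun a : unitInterval × L => (a.1, q a.2) :=
    continuous_fst.prodMk (hcov.continuous.comp continuous_snd)
  let H₁ : C(unitInterval × L, S) := ⟨fun a => (p a.1).1 (q a.2), hH.comp hpq⟩
  let H₂ : C(unitInterval × L, S) := ⟨fun a => (p a.1).1.symm (q a.2), hH'.comp hpq⟩
  have h₁0 : ∀ y, H₁ (0, y) = q ((⟨f'.1, f'.1.continuous⟩ : C(L, L)) y) := fun y => by
    simpa [H₁] using (hf y).symm
  have h₂0 : ∀ y, H₂ (0, y) = q ((⟨f'.1.symm, f'.1.symm.continuous⟩ : C(L, L)) y) := fun y => by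
    simpa [H₂] using (hf.inv y).symm
  let G₁ := hcov.liftHomotopy H₁ _ h₁0
  let G₂ := hcov.liftHomotopy H₂ _ h₂0
  have hG₁ : ∀ s y, q (G₁ (s, y)) = (p s).1 (q y) := fun s y =>
    congrFun (hcov.liftHomotopy_lifts H₁ _ h₁0) (s, y)
  have hG₂ : ∀ s y, q (G₂ (s, y)) = (p s).1.symm (q y) := fun s y =>
    congrFun (hcov.liftHomotopy_lifts H₂ _ h₂0) (s, y)
  have hG₁0 : ∀ y, G₁ (0, y) = f'.1 y := fun y => hcov.liftHomotopy_zero H₁ _ h₁0 y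
  have hG₂0 : ∀ y, G₂ (0, y) = f'.1.symm y := fun y => hcov.liftHomotopy_zero H₂ _ h₂0 y
  -- For fixed `y` this path lies over a constant path and starts at `y`, so it is constant: the
  -- lifts of the isotopy and of its inverse are mutually inverse.
  have hleft : ∀ s y, G₂ (s, G₁ (s, y)) = y := fun s y => by
    refine congrFun (hq.eq_of_comp_eq (f := fun s => G₂ (s, G₁ (s, y))) (g := fun _ => y)
      (by fun_prop) continuous_const (fun s => ?_) 0 ?_) s
    · rw [hG₂, hG₁, Homeomorph.symm_apply_apply]
    · rw [hG₁0, hG₂0, Homeomorph.symm_apply_apply]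
  have hright : ∀ s y, G₁ (s, G₂ (s, y)) = y := fun s y => by
    refine congrFun (hq.eq_of_comp_eq (f := fun s => G₁ (s, G₂ (s, y))) (g := fun _ => y)
      (by fun_prop) continuous_const (fun s => ?_) 0 ?_) s
    · rw [hG₁, hG₂, Homeomorph.apply_symm_apply]
    · rw [hG₂0, hG₁0, Homeomorph.apply_symm_apply]
  let F : unitInterval → L ≃ₜ L := fun s =>
    { toFun := fun y => G₁ (s, y)
      invFun := fun y => G₂ (s, y)
      left_inv := hleft s
      right_inv := hright s
      continuous_toFun := by fun_prop
      continuous_invFun := by fun_prop }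
  have hmem : F 1 ∈ HomeoPlus L := hq.mem_homeoPlus (f := p 1) (hG₁ 1)
  refine ⟨⟨F 1, hmem⟩, fun y => ?_, (mapClass_eq_iff.2 ?_).symm, fun y hy => ?_⟩
  · exact (hG₁ 1 y).trans (congrArg (fun e : HomeoPlus S => e.1 (q y)) p.target)
  · exact (joinedIn_of_isotopy (F := F) (P := Set.univ) G₁.continuous
      (Homeomorph.ext hG₁0) rfl fun _ _ _ => trivial).joined
  -- Over a point fixed throughout the isotopy the lifted path covers a constant path, so it does
  -- not move.
  · refine Eq.trans ?_ (hG₁0 y)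
    refine congrFun (hq.eq_of_comp_eq (f := fun s => G₁ (s, y)) (g := fun _ => G₁ (0, y))
      (by fun_prop) continuous_const (fun s => ?_) 0 rfl) 1
    rw [hG₁, hG₁, hy, hy]

/-- Two lifts of isotopic homeomorphisms that fix the points over a common fixed point of the
isotopy are isotopic. -/
theorem IsInfiniteCyclicCover.mapClass_eq_of_joinedIn [CompactSpace S] [PreconnectedSpace L]
    (hq : IsInfiniteCyclicCover q h) {f g : HomeoPlus S} {x : S}
    (hfg : JoinedIn {e : HomeoPlus S | e.1 x = x} f g) {f' g' : HomeoPlus L}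
    (hf : IsHomeoLift q f' f) (hg : IsHomeoLift q g' g)
    (hf' : ∀ y, f.1 (q y) = q y → f'.1 y = y) (hg' : ∀ y, g.1 (q y) = q y → g'.1 y = y) :
    mapClass f' = mapClass g' := by
  obtain ⟨p, hp⟩ := hfg
  obtain ⟨y, rfl⟩ := hq.surjective x
  obtain ⟨g'', hlift, hclass, hfix⟩ := hq.exists_lift_of_path p hf
  have h1 : g''.1 y = g'.1 y := by
    rw [hfix y hp, hf' y (by simpa using hp 0), hg' y (by simpa using hp 1)]
  have h2 : g'' = g' := Subtype.ext (Homeomorph.ext fun z => congrFun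
    (hq.eq_of_comp_eq (f := g''.1) (g := g'.1) g''.1.continuous g'.1.continuous
      (fun z => (hlift z).trans (hg z).symm) y h1) z)
  rw [← hclass, h2]

end Lifts

/-! ### Lifts supported on some of the sheets over a set with a section -/

/-- `σ` is a section of `q` over the regular closed set `K`. -/
structure IsSectionOn {L S : Type*} [TopologicalSpace L] [TopologicalSpace S] (q : L → S)
    (K : Set S) (σ : S → L) : Prop where
  isClosed : IsClosed K
  subset_closure_interior : K ⊆ closure (interior K)
  continuousOn : ContinuousOn σ K
  apply_eq : ∀ x ∈ K, q (σ x) = x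

/-- The index `n` of the sheet `h ^ n '' (σ '' K)` that contains `y`. -/
noncomputable def sheet {L S : Type*} [TopologicalSpace L] (q : L → S) (h : L ≃ₜ L) (σ : S → L)
    (y : L) : ℤ :=
  Classical.epsilon fun n : ℤ => (h ^ n) (σ (q y)) = y

/-- The lift of `f : S → S` on the sheets over `K` with index in `N`, extended by the identity. -/
noncomputable def sheetMap {L S : Type*} [TopologicalSpace L] (q : L → S) (h : L ≃ₜ L) (σ : S → L)
    (K : Set S) (N : Set ℤ) (f : S → S) (y : L) : L :=
  open Classical in
  if q y ∈ K ∧ sheet q h σ y ∈ N then (h ^ sheet q h σ y) (σ (f (q y))) else y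

section

variable {L S : Type*} [TopologicalSpace L] {q : L → S} {h : L ≃ₜ L} {σ : S → L} {K : Set S}
  {N : Set ℤ} {f : S → S}

theorem sheetMap_of_notMem {y : L} (hy : q y ∉ K) : sheetMap q h σ K N f y = y :=
  if_neg fun h => hy h.1

theorem sheetMap_of_sheet_notMem {y : L} (hy : sheet q h σ y ∉ N) : sheetMap q h σ K N f y = y :=
  if_neg fun h => hy h.2

theorem sheetMap_of_mem {y : L} (hy : q y ∈ K) (hn : sheet q h σ y ∈ N) :
    sheetMap q h σ K N f y = (h ^ sheet q h σ y) (σ (f (q y))) :=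
  if_pos ⟨hy, hn⟩

end

/-- The orientation preserving homeomorphisms that fix every point outside of `K`. -/
def fixingOff {X : Type*} [TopologicalSpace X] [ChartedSpace ℂ X] (K : Set X) :
    Subgroup (HomeoPlus X) where
  carrier := {f | ∀ x ∉ K, f.1 x = x}
  one_mem' := fun _ _ => rfl
  mul_mem' := fun {f _} hf hg x hx => (congrArg f.1 (hg x hx)).trans (hf x hx)
  inv_mem' := fun {f} hf x hx => f.1.symm_apply_eq.2 (hf x hx).symm

theorem apply_mem_of_mem_fixingOff {X : Type*} [TopologicalSpace X] [ChartedSpace ℂ X] {K : Set X}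
    {f : HomeoPlus X} (hf : f ∈ fixingOff K) {x : X} (hx : x ∈ K) : f.1 x ∈ K := by
  by_contra h
  have h1 := f.1.injective (hf _ h)
  rw [h1] at h
  exact h hx

section SheetMap

variable {L S : Type*} [TopologicalSpace L] [ChartedSpace ℂ L] [TopologicalSpace S]
  [ChartedSpace ℂ S] {q : L → S} {h : L ≃ₜ L} {σ : S → L} {K : Set S} {M N : Set ℤ} {f g : S → S}

theorem IsInfiniteCyclicCover.sheet_spec (hq : IsInfiniteCyclicCover q h) (hσ : IsSectionOn q K σ)
    {y : L} (hy : q y ∈ K) : (h ^ sheet q h σ y) (σ (q y)) = y :=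
  Classical.epsilon_spec ((hq.fiber_eq_orbit (σ (q y)) y).1 (hσ.apply_eq _ hy))

/-- Where `f` fixes `q y`, the formula returns `h ^ n (σ (q y)) = y`, whatever set of sheets is
used. -/
theorem IsInfiniteCyclicCover.sheetMap_eq_self (hq : IsInfiniteCyclicCover q h)
    (hσ : IsSectionOn q K σ) {y : L} (hy : f (q y) = q y) : sheetMap q h σ K N f y = y := by
  by_cases h1 : q y ∈ K ∧ sheet q h σ y ∈ N
  · rw [sheetMap_of_mem h1.1 h1.2, hy, hq.sheet_spec hσ h1.1]
  · exact if_neg h1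

variable [PreconnectedSpace L]

theorem IsInfiniteCyclicCover.sheet_eq (hq : IsInfiniteCyclicCover q h) (hσ : IsSectionOn q K σ)
    {x : S} (hx : x ∈ K) (n : ℤ) : sheet q h σ ((h ^ n) (σ x)) = n := by
  have h1 : q ((h ^ n) (σ x)) = x := (hq.apply_zpow n _).trans (hσ.apply_eq x hx)
  have h2 := hq.sheet_spec hσ (y := (h ^ n) (σ x)) (by rwa [h1])
  rw [h1] at h2
  exact hq.zpow_injective h2

theorem IsInfiniteCyclicCover.sheetMap_zpow_apply (hq : IsInfiniteCyclicCover q h)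
    (hσ : IsSectionOn q K σ) {x : S} (hx : x ∈ K) {n : ℤ} (hn : n ∈ N) :
    sheetMap q h σ K N f ((h ^ n) (σ x)) = (h ^ n) (σ (f x)) := by
  have h1 : q ((h ^ n) (σ x)) = x := (hq.apply_zpow n _).trans (hσ.apply_eq x hx)
  have h2 := hq.sheet_eq hσ hx n
  rw [sheetMap_of_mem (by rwa [h1]) (by rwa [h2]), h1, h2]

/-- For `y'` near `y` and over `K`, the points `h ^ (-n) y'` and `σ (q y')` are both near `σ (q y)`
and have the same image; as `q` is locally injective, they coincide. -/
theorem IsInfiniteCyclicCover.eventually_sheet_eq (hq : IsInfiniteCyclicCover q h)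
    (hσ : IsSectionOn q K σ) {y : L} (hy : q y ∈ K) :
    ∀ᶠ y' in 𝓝 y, q y' ∈ K → sheet q h σ y' = sheet q h σ y := by
  have hqc := hq.isCoveringMap.continuous
  set n := sheet q h σ y with hn
  have hspec : (h ^ n) (σ (q y)) = y := hq.sheet_spec hσ hy
  obtain ⟨U, hU, hyU, hinj⟩ := hq.isCoveringMap.isLocalHomeomorph.isLocallyInjective (σ (q y))
  have h1 : Tendsto (fun y' => (h ^ n).symm y') (𝓝 y) (𝓝 (σ (q y))) := by
    have := (h ^ n).symm.continuous.tendsto y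
    rwa [(h ^ n).symm_apply_eq.2 hspec.symm] at this
  have h2 : Tendsto (fun y' => σ (q y')) (𝓝[q ⁻¹' K] y) (𝓝 (σ (q y))) :=
    ((hσ.continuousOn _ hy).comp hqc.continuousWithinAt fun _ hz => hz)
  refine (eventually_nhdsWithin_iff (s := q ⁻¹' K)).1 ?_
  filter_upwards [(h1.mono_left nhdsWithin_le_nhds) (hU.mem_nhds hyU), h2 (hU.mem_nhds hyU),
    self_mem_nhdsWithin] with y' h3 h4 h5
  have h6 : q ((h ^ n).symm y') = q (σ (q y')) := by
    rw [hσ.apply_eq _ h5, ← hq.apply_zpow n, Homeomorph.apply_symm_apply]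
  have h7 := (h ^ n).symm_apply_eq.1 (hinj h3 h4 h6)
  rw [h7]
  exact hq.sheet_eq hσ h5 n

theorem IsInfiniteCyclicCover.sheetMap_comp (hq : IsInfiniteCyclicCover q h)
    (hσ : IsSectionOn q K σ) (hg : ∀ x ∈ K, g x ∈ K) (y : L) :
    sheetMap q h σ K N f (sheetMap q h σ K N g y) = sheetMap q h σ K N (f ∘ g) y := by
  by_cases h1 : q y ∈ K ∧ sheet q h σ y ∈ N
  · rw [sheetMap_of_mem h1.1 h1.2, sheetMap_of_mem h1.1 h1.2,
      hq.sheetMap_zpow_apply hσ (hg _ h1.1) h1.2]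
    rfl
  · rw [show sheetMap q h σ K N g y = y from if_neg h1, sheetMap, sheetMap, if_neg h1, if_neg h1]

/-- The copy of `f` preserves each sheet, so copies on disjoint sets of sheets do not interact. -/
theorem IsInfiniteCyclicCover.sheetMap_union (hq : IsInfiniteCyclicCover q h)
    (hσ : IsSectionOn q K σ) (hf : ∀ x ∈ K, f x ∈ K) (hMN : Disjoint M N) (y : L) :
    sheetMap q h σ K M f (sheetMap q h σ K N f y) = sheetMap q h σ K (M ∪ N) f y := by
  by_cases h1 : q y ∈ K
  · by_cases h2 : sheet q h σ y ∈ N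
    · rw [sheetMap_of_mem h1 h2, sheetMap_of_mem h1 (Or.inr h2), sheetMap_of_sheet_notMem]
      rw [hq.sheet_eq hσ (hf _ h1)]
      exact hMN.notMem_of_mem_right h2
    · rw [sheetMap_of_sheet_notMem h2]
      by_cases h3 : sheet q h σ y ∈ M
      · rw [sheetMap_of_mem h1 h3, sheetMap_of_mem h1 (Or.inl h3)]
      · rw [sheetMap_of_sheet_notMem h3, sheetMap_of_sheet_notMem fun h => h.elim h3 h2]
  · rw [sheetMap_of_notMem h1, sheetMap_of_notMem h1, sheetMap_of_notMem h1]

theorem IsInfiniteCyclicCover.eventually_sheetMap_eq (hq : IsInfiniteCyclicCover q h)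
    (hσ : IsSectionOn q K σ) {y : L} (hy : q y ∈ interior K) :
    sheetMap q h σ K N f =ᶠ[𝓝 y] sheetMap q h σ K Set.univ f ∨
      sheetMap q h σ K N f =ᶠ[𝓝 y] id := by
  have hK : ∀ᶠ y' in 𝓝 y, q y' ∈ K := hq.isCoveringMap.continuous.continuousAt.eventually
    (mem_interior_iff_mem_nhds.1 hy)
  have hs := hq.eventually_sheet_eq hσ (interior_subset hy)
  by_cases hn : sheet q h σ y ∈ N
  · left
    filter_upwards [hK, hs] with y' h1 h2
    rw [sheetMap_of_mem h1 (by rwa [h2 h1]), sheetMap_of_mem h1 (Set.mem_univ _)]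
  · right
    filter_upwards [hK, hs] with y' h1 h2
    exact sheetMap_of_sheet_notMem (by rwa [h2 h1])

variable [T2Space S]

/-- The surface is covered by the closed set over `K`, where the sheet index is locally constant,
and the closed set over the fixed points of `f`, where the map is the identity. -/
theorem IsInfiniteCyclicCover.continuous_sheetMap (hq : IsInfiniteCyclicCover q h)
    (hσ : IsSectionOn q K σ) (hf : Continuous f) (hfK : ∀ x ∈ K, f x ∈ K)
    (hoff : ∀ x ∉ K, f x = x) : Continuous (sheetMap q h σ K N f) := by
  have hqc := hq.isCoveringMap.continuous
  rw [← continuousOn_univ]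
  have hcover : (Set.univ : Set L) = q ⁻¹' K ∪ {y | f (q y) = q y} := by
    refine (Set.eq_univ_of_forall fun y => ?_).symm
    by_cases hy : q y ∈ K
    · exact Or.inl hy
    · exact Or.inr (hoff _ hy)
  rw [hcover]
  refine ContinuousOn.union_of_isClosed (fun y hy => ?_) ?_ (hσ.isClosed.preimage hqc)
    (isClosed_eq (hf.comp hqc) hqc)
  · have hs : ∀ᶠ y' in 𝓝[q ⁻¹' K] y, sheet q h σ y' = sheet q h σ y :=
      eventually_nhdsWithin_iff.2 (hq.eventually_sheet_eq hσ hy)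
    by_cases hn : sheet q h σ y ∈ N
    · have h1 : ContinuousWithinAt (fun y' => (h ^ sheet q h σ y) (σ (f (q y')))) (q ⁻¹' K) y :=
        (h ^ sheet q h σ y).continuous.continuousAt.comp_continuousWithinAt
          ((hσ.continuousOn _ (hfK _ hy)).comp (f := fun y => f (q y))
            (hf.comp hqc).continuousWithinAt fun z hz => hfK _ hz)
      refine h1.congr_of_eventuallyEq ?_ (sheetMap_of_mem hy hn)
      filter_upwards [hs, self_mem_nhdsWithin] with y' h2 h3
      rw [sheetMap_of_mem (K := K) h3 (by rwa [h2]), h2]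
    · refine continuousWithinAt_id.congr_of_eventuallyEq ?_ (sheetMap_of_sheet_notMem hn)
      filter_upwards [hs] with y' h2
      exact sheetMap_of_sheet_notMem (by rwa [h2])
  · exact continuousOn_id.congr fun y hy => hq.sheetMap_eq_self hσ hy

end SheetMap

/-! ### Partial lifts as orientation preserving homeomorphisms -/

section SheetLift

variable {L S : Type*} [TopologicalSpace L] [ChartedSpace ℂ L] [TopologicalSpace S]
  [ChartedSpace ℂ S] {q : L → S} {h : L ≃ₜ L} {σ : S → L} {K : Set S} [PreconnectedSpace L]
  [OrientedSurface S]

/-- `sheetMap` as a homeomorphism. -/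
noncomputable def sheetHomeo (hq : IsInfiniteCyclicCover q h) (hσ : IsSectionOn q K σ) (N : Set ℤ)
    (f : fixingOff K) : L ≃ₜ L where
  toFun := sheetMap q h σ K N f.1.1
  invFun := sheetMap q h σ K N (f⁻¹).1.1
  left_inv y := by
    rw [hq.sheetMap_comp hσ fun x hx => apply_mem_of_mem_fixingOff f.2 hx]
    exact hq.sheetMap_eq_self hσ (f.1.1.symm_apply_apply _)
  right_inv y := by
    rw [hq.sheetMap_comp hσ fun x hx => apply_mem_of_mem_fixingOff (f⁻¹).2 hx]
    exact hq.sheetMap_eq_self hσ (f.1.1.apply_symm_apply _)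
  continuous_toFun := hq.continuous_sheetMap hσ f.1.1.continuous
    (fun x hx => apply_mem_of_mem_fixingOff f.2 hx) f.2
  continuous_invFun := hq.continuous_sheetMap hσ (f⁻¹).1.1.continuous
    (fun x hx => apply_mem_of_mem_fixingOff (f⁻¹).2 hx) (f⁻¹).2

theorem sheetHomeo_univ_lifts (hq : IsInfiniteCyclicCover q h) (hσ : IsSectionOn q K σ)
    (f : fixingOff K) (y : L) : q (sheetHomeo hq hσ Set.univ f y) = f.1.1 (q y) := by
  change q (sheetMap q h σ K Set.univ f.1.1 y) = f.1.1 (q y)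
  by_cases hy : q y ∈ K
  · rw [sheetMap_of_mem hy (Set.mem_univ _), hq.apply_zpow,
      hσ.apply_eq _ (apply_mem_of_mem_fixingOff f.2 hy)]
  · rw [sheetMap_of_notMem hy, f.2 _ hy]

variable [OrientedSurface L]

/-- Away from the preimage of the boundary of `K`, the map agrees locally with the identity or with
the full lift, both orientation preserving. These points are dense because `K` is regular closed and
`q` is open. -/
theorem sheetHomeo_mem (hq : IsInfiniteCyclicCover q h) (hσ : IsSectionOn q K σ) (N : Set ℤ)
    (f : fixingOff K) : sheetHomeo hq hσ N f ∈ HomeoPlus L := by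
  have huniv : sheetHomeo hq hσ Set.univ f ∈ HomeoPlus L :=
    hq.mem_homeoPlus (sheetHomeo_univ_lifts hq hσ f)
  have hqc := hq.isCoveringMap.continuous
  have hdense : Dense (interior K ∪ Kᶜ) := fun x => by
    by_cases hx : x ∈ K
    · exact closure_mono Set.subset_union_left (hσ.subset_closure_interior hx)
    · exact subset_closure (Or.inr hx)
  refine mem_homeoPlus_of_dense
    (hdense.preimage hq.isCoveringMap.isLocalHomeomorph.isOpenMap) fun y hy => ?_
  rcases hy with hy | hy
  · rcases hq.eventually_sheetMap_eq (N := N) (f := f.1.1) hσ hy with h1 | h1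
    · exact (mem_homeoPlus_iff.1 huniv y).congr h1.symm
    · exact (orientationPreservingAt_id y).congr h1.symm
  · refine (orientationPreservingAt_id y).congr ?_
    filter_upwards [(hσ.isClosed.isOpen_compl.preimage hqc).mem_nhds hy] with y' hy'
    exact (sheetMap_of_notMem hy').symm

/-- The lift of a homeomorphism supported on `K` on the sheets over `K` with index in `N`. -/
noncomputable def sheetLift (hq : IsInfiniteCyclicCover q h) (hσ : IsSectionOn q K σ) (N : Set ℤ) :
    fixingOff K →* HomeoPlus L where
  toFun f := ⟨sheetHomeo hq hσ N f, sheetHomeo_mem hq hσ N f⟩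
  map_one' := Subtype.ext (Homeomorph.ext fun _ => hq.sheetMap_eq_self hσ rfl)
  map_mul' _ g := Subtype.ext (Homeomorph.ext fun y =>
    (hq.sheetMap_comp hσ (fun _ hx => apply_mem_of_mem_fixingOff g.2 hx) y).symm)

theorem sheetLift_apply (hq : IsInfiniteCyclicCover q h) (hσ : IsSectionOn q K σ) (N : Set ℤ)
    (f : fixingOff K) (y : L) : (sheetLift hq hσ N f).1 y = sheetMap q h σ K N f.1.1 y :=
  rfl

theorem isHomeoLift_sheetLift_univ (hq : IsInfiniteCyclicCover q h) (hσ : IsSectionOn q K σ)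
    (f : fixingOff K) : IsHomeoLift q (sheetLift hq hσ Set.univ f) f.1 :=
  sheetHomeo_univ_lifts hq hσ f

theorem prod_map_sheetLift (hq : IsInfiniteCyclicCover q h) (hσ : IsSectionOn q K σ)
    (f : fixingOff K) {l : List ℤ} (hl : l.Nodup) :
    (l.map fun n => sheetLift hq hσ {n} f).prod = sheetLift hq hσ {n | n ∈ l} f := by
  induction l with
  | nil =>
    exact Subtype.ext (Homeomorph.ext fun y =>
      (sheetMap_of_sheet_notMem (N := {n | n ∈ ([] : List ℤ)}) (by simp)).symm)
  | cons n l ih =>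
    rw [List.nodup_cons] at hl
    rw [List.map_cons, List.prod_cons, ih hl.2]
    refine Subtype.ext (Homeomorph.ext fun y => ?_)
    refine (hq.sheetMap_union hσ (fun _ hx => apply_mem_of_mem_fixingOff f.2 hx)
      (Set.disjoint_singleton_left.2 hl.1) y).trans ?_
    rw [sheetLift_apply]
    congr 1
    ext m
    simp

/-- Every point has a neighbourhood that meets at most one sheet, so a compact set meets finitely
many, and eventually all of them belong to `N i`. -/
theorem tendsto_sheetLift (hq : IsInfiniteCyclicCover q h) (hσ : IsSectionOn q K σ)
    (f : fixingOff K) {ι : Type*} {l : Filter ι} {N : ι → Set ℤ} (hN : ∀ n, ∀ᶠ i in l, n ∈ N i) :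
    Tendsto (fun i => sheetLift hq hσ (N i) f) l (𝓝 (sheetLift hq hσ Set.univ f)) := by
  refine tendsto_homeoPlus_of_eventually_eqOn fun C hC => ?_
  simp only [sheetLift_apply]
  refine hC.induction_on (p := fun C => ∀ᶠ i in l, ∀ x ∈ C,
    sheetMap q h σ K (N i) f.1.1 x = sheetMap q h σ K Set.univ f.1.1 x) (by simp)
    (fun s t hst ht => ht.mono fun i hi x hx => hi x (hst hx)) (fun s t hs ht => ?_)
    (fun y _ => ?_)
  · filter_upwards [hs, ht] with i h1 h2 x hx
    exact hx.elim (h1 x) (h2 x)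
  · by_cases hy : q y ∈ K
    · refine ⟨_, mem_nhdsWithin_of_mem_nhds (hq.eventually_sheet_eq hσ hy), ?_⟩
      filter_upwards [hN (sheet q h σ y)] with i hi x hx
      by_cases hxK : q x ∈ K
      · rw [sheetMap_of_mem hxK (by rwa [hx hxK]), sheetMap_of_mem hxK (Set.mem_univ _)]
      · rw [sheetMap_of_notMem hxK, sheetMap_of_notMem hxK]
    · refine ⟨_, mem_nhdsWithin_of_mem_nhds ((hσ.isClosed.isOpen_compl.preimage
        hq.isCoveringMap.continuous).mem_nhds hy), .of_forall fun i x hx => ?_⟩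
      rw [sheetMap_of_notMem hx, sheetMap_of_notMem hx]

end SheetLift

/-! ### The annuli over an annulus whose core lifts -/

/-- A periodic parametrization of a simple closed curve. -/
theorem IsSimpleClosedCurve.exists_parametrization {X : Type*} [TopologicalSpace X] {c : Set X}
    (hc : IsSimpleClosedCurve c) : ∃ P : ℝ → X, Continuous P ∧
      (∀ x y, P x = P y ↔ ∃ n : ℤ, y = x + n) ∧ Set.range P = c := by
  obtain ⟨p, hp, rfl⟩ := hc
  have hpi := Real.pi_pos
  refine ⟨fun x => p (Circle.exp (2 * Real.pi * x)), by fun_prop, fun x y => ?_, ?_⟩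
  · rw [hp.injective.eq_iff, eq_comm, Circle.exp_eq_exp]
    refine exists_congr fun n => ⟨fun h => ?_, fun h => ?_⟩
    · have : 2 * Real.pi * (y - (x + n)) = 0 := by linarith
      rcases mul_eq_zero.1 this with h1 | h1
      · linarith
      · linarith
    · rw [h]; ring
  · ext y
    constructor
    · rintro ⟨x, rfl⟩
      exact ⟨_, rfl⟩
    · rintro ⟨z, rfl⟩
      obtain ⟨s, rfl⟩ := Circle.exp_surjective z
      exact ⟨s / (2 * Real.pi), by field_simp⟩

/-- The rescaled function `x ↦ θ (d x) / d²` commutes with integer translations, which reduces the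
claim to degree one, also for negative `d`. -/
theorem surjective_of_degree {θ : ℝ → ℝ} (hθ : Continuous θ) {d : ℤ} (hd0 : d ≠ 0)
    (hd : ∀ x, θ (x + 1) = θ x + d) : Function.Surjective θ := by
  have hd0' : (d : ℝ) ≠ 0 := Int.cast_ne_zero.2 hd0
  intro y
  obtain ⟨x, hx⟩ := surjective_of_continuous_add_one (f := fun x => θ (d * x) / (d * d))
    (by fun_prop) (fun x n => by
      have := apply_add_int_of_degree hd (d * x) (d * n)
      rw [mul_add, ← Int.cast_mul, this]
      push_cast
      field_simp) (y / (d * d))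
  refine ⟨d * x, ?_⟩
  beta_reduce at hx
  field_simp at hx
  exact hx

theorem IsOrientedBand.bandSet_subset_closure_interior {X : Type*} [TopologicalSpace X]
    [ChartedSpace ℂ X] {α : ℝ → ℝ → X} (hα : IsOrientedBand α) :
    bandSet α 1 2 ⊆ closure (interior (bandSet α 1 2)) := by
  rintro _ ⟨u, hu, x, rfl⟩
  have h1 : openBandSet α 1 2 ⊆ interior (bandSet α 1 2) :=
    interior_maximal openBandSet_subset (hα.isOpen_openBandSet le_rfl le_rfl)
  have hcl : closure (Set.Ioo (1 : ℝ) 2) = Set.Icc 1 2 := closure_Ioo (by norm_num)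
  have h2 : ContinuousOn (fun u => α u x) (closure (Set.Ioo (1 : ℝ) 2)) := by
    rw [hcl]
    exact hα.cont.comp (f := fun u => (u, x)) (by fun_prop) fun u hu => ⟨hu, trivial⟩
  refine closure_mono ?_ (h2.image_closure ⟨u, hcl ▸ hu, rfl⟩)
  rintro _ ⟨v, hv, rfl⟩
  exact h1 ⟨v, hv, x, rfl⟩

theorem apply_add_int_of_equivariant {L : Type*} [TopologicalSpace L] {h : L ≃ₜ L} {A : ℝ × ℝ → L} {m : ℤ}
    (hm : ∀ u x, A (u, x + 1) = (h ^ m) (A (u, x))) (u x : ℝ) (n : ℤ) :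
    A (u, x + n) = (h ^ (m * n)) (A (u, x)) := by
  induction n with
  | zero => simp
  | succ n ih =>
    rw [mul_add, mul_one, add_comm (m * n), zpow_add, Homeomorph.mul_apply, ← ih, ← hm]
    push_cast
    rw [add_assoc]
  | pred n ih =>
    apply (h ^ m).injective
    rw [← hm, ← Homeomorph.mul_apply, ← zpow_add]
    convert ih using 3
    · push_cast; ring
    · ring

section

variable {L S : Type*} [TopologicalSpace L] [ChartedSpace ℂ L] [TopologicalSpace S]
  [ChartedSpace ℂ S] {q : L → S} {h : L ≃ₜ L} {α : ℝ → ℝ → S}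

/-- The universal cover of an annulus in the base maps to the cover. -/
theorem IsInfiniteCyclicCover.exists_strip (hq : IsInfiniteCyclicCover q h)
    (hα : IsOrientedBand α) : ∃ A : ℝ × ℝ → L, Continuous A ∧
      (∀ u ∈ Set.Icc (1 : ℝ) 2, ∀ x, q (A (u, x)) = α u x) ∧
      ∃ m : ℤ, ∀ u x, A (u, x + 1) = (h ^ m) (A (u, x)) := by
  let c : ℝ → ℝ := fun u => max 1 (min 2 u)
  have hc : ∀ u, c u ∈ Set.Icc (1 : ℝ) 2 := fun u =>
    ⟨le_max_left _ _, max_le one_le_two (min_le_left _ _)⟩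
  let f : C(ℝ × ℝ, S) := ⟨fun p => α (c p.1) p.2, hα.cont.comp_continuous
    (f := fun p : ℝ × ℝ => (c p.1, p.2)) (by fun_prop) fun p => ⟨hc _, trivial⟩⟩
  obtain ⟨y, hy⟩ := hq.surjective (f (0, 0))
  obtain ⟨A, ⟨-, hA⟩, -⟩ := hq.isCoveringMap.existsUnique_continuousMap_lifts f (0, 0) y hy
  have hA' : ∀ u x, q (A (u, x)) = α (c u) x := fun u x => congrFun hA (u, x)
  refine ⟨A, A.continuous, fun u hu x => ?_, ?_⟩
  · rw [hA']
    simp only [c, min_eq_right hu.2, max_eq_right hu.1]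
  obtain ⟨m, hm⟩ := (hq.fiber_eq_orbit (A (0, 0)) (A (0, 0 + 1))).1
    (by rw [hA', hA', hα.periodic])
  refine ⟨m, fun u x => ?_⟩
  exact congrFun (hq.eq_of_comp_eq (f := fun p : ℝ × ℝ => A (p.1, p.2 + 1))
    (g := fun p => (h ^ m) (A p)) (by fun_prop) (by fun_prop) (fun p => by
      rw [hq.apply_zpow, hA', hα.periodic, ← hA']) (0, 0) hm.symm) (u, x)

variable [PreconnectedSpace L] [T2Space S]

/-- A simple closed curve over the core of an annulus is a translate of the lifted core, which is
closed. -/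
theorem IsInfiniteCyclicCover.curve_over_core (hq : IsInfiniteCyclicCover q h)
    (hα : IsOrientedBand α) {A : ℝ × ℝ → L} (hAc : Continuous A)
    (hA : ∀ u ∈ Set.Icc (1 : ℝ) 2, ∀ x, q (A (u, x)) = α u x) {m : ℤ}
    (hm : ∀ u x, A (u, x + 1) = (h ^ m) (A (u, x))) {c : Set L} (hc : IsSimpleClosedCurve c)
    (hcq : c ⊆ q ⁻¹' Set.range (α (3 / 2))) :
    m = 0 ∧ ∃ n : ℤ, c = Set.range fun x => (h ^ n) (A (3 / 2, x)) := by
  have h32 : (3 / 2 : ℝ) ∈ Set.Icc (1 : ℝ) 2 := by constructor <;> norm_num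
  have hqc := hq.isCoveringMap.continuous
  obtain ⟨P, hPc, hP, rfl⟩ := hc.exists_parametrization
  obtain ⟨U, Θ, -, hΘc, hΘ⟩ := (hα.isBand le_rfl one_lt_two le_rfl).exists_coords
  have hPq : ∀ x, ∃ z, α (3 / 2) z = q (P x) := fun x => hcq ⟨x, rfl⟩
  let ψ : C(ℝ, AddCircle (1 : ℝ)) := ⟨fun x => Θ (q (P x)), hΘc.comp_continuous (by fun_prop)
    fun x => (hPq x).elim fun z hz => ⟨3 / 2, h32, z, hz⟩⟩
  obtain ⟨θ₀, hθ₀⟩ := QuotientAddGroup.mk_surjective (ψ 0)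
  obtain ⟨θ, ⟨-, hθ⟩, -⟩ := (AddCircle.isCoveringMap_coe (1 : ℝ)).existsUnique_continuousMap_lifts
    ψ 0 θ₀ hθ₀
  have hθ' : ∀ x, ((θ x : ℝ) : AddCircle (1 : ℝ)) = Θ (q (P x)) := fun x => congrFun hθ x
  have hAθ : ∀ x, q (A (3 / 2, θ x)) = q (P x) := fun x => by
    obtain ⟨z, hz⟩ := hPq x
    have h1 := hθ' x
    rw [← hz, (hΘ _ h32 z).2] at h1
    obtain ⟨n, hn⟩ := addCircle_coe_eq_iff.1 h1
    rw [hA _ h32, ← hz, hn, apply_add_int_of_periodic hα.periodic]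
  obtain ⟨n, hn⟩ := (hq.fiber_eq_orbit _ _).1 (hAθ 0)
  have hlift : ∀ x, (h ^ n) (A (3 / 2, θ x)) = P x := congrFun
    (hq.eq_of_comp_eq (f := fun x => (h ^ n) (A (3 / 2, θ x))) (by fun_prop) hPc
      (fun x => (hq.apply_zpow n _).trans (hAθ x)) 0 hn)
  have hper : ∀ x, P (x + 1) = P x := fun x => ((hP x (x + 1)).2 ⟨1, by simp⟩).symm
  have hint : ∀ x, ∃ k : ℤ, θ (x + 1) = θ x + k := fun x =>
    addCircle_coe_eq_iff.1 (by rw [hθ', hθ', hper])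
  choose k hk using hint
  have hd : ∀ x, θ (x + 1) = θ x + k 0 := fun x => by
    rw [hk, eq_of_continuous_intCast (f := fun x => θ (x + 1) - θ x) (by fun_prop) k
      (fun x => by rw [hk]; ring) x 0]
  have hd0 : k 0 ≠ 0 := degree_ne_zero θ.continuous hd fun x y hxy =>
    (hP x y).1 (by rw [← hlift, ← hlift, hxy])
  refine ⟨?_, n, ?_⟩
  -- The curve closes up after one period while the strip coordinate advances by the degree `k 0`,
  -- so `h ^ (m * k 0)` has a fixed point; since `k 0 ≠ 0`, this gives `m = 0`.
  · have h1 : A (3 / 2, θ (0 + 1)) = A (3 / 2, θ 0) := by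
      apply (h ^ n).injective
      rw [hlift, hlift, hper]
    rw [hd, apply_add_int_of_equivariant hm] at h1
    exact (mul_eq_zero.1 (hq.eq_zero_of_fixed h1)).resolve_right hd0
  · ext y
    constructor
    · rintro ⟨x, rfl⟩
      exact ⟨θ x, hlift x⟩
    · rintro ⟨z, rfl⟩
      obtain ⟨x, rfl⟩ := surjective_of_degree θ.continuous hd0 hd z
      exact ⟨x, (hlift x).symm⟩

/-- If the preimage of the core is a union of simple closed curves, then the annulus has a section,
and the curves are the translates of the lifted core. -/
theorem IsInfiniteCyclicCover.exists_section (hq : IsInfiniteCyclicCover q h)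
    (hα : IsOrientedBand α) {c : ℤ → Set L}
    (hc : IsPreimageFamily q (Set.range (α (3 / 2))) c) :
    ∃ σ : S → L, IsSectionOn q (bandSet α 1 2) σ ∧ ∃ ν : ℤ → ℤ, Function.Bijective ν ∧
      ∀ i, c i = Set.range fun x => (h ^ ν i) (σ (α (3 / 2) x)) := by
  classical
  have h32 : (3 / 2 : ℝ) ∈ Set.Icc (1 : ℝ) 2 := by constructor <;> norm_num
  have hband := hα.isBand le_rfl one_lt_two le_rfl
  obtain ⟨hcurve, hdisj, hunion⟩ := hc
  obtain ⟨A, hAc, hA, m, hm⟩ := hq.exists_strip hα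
  have hcore := fun i => hq.curve_over_core hα hAc hA hm (hcurve i)
    (hunion ▸ Set.subset_iUnion c i)
  have hm0 : m = 0 := (hcore 0).1
  choose ν hν using fun i => (hcore i).2
  -- With `m = 0` the strip map is periodic and descends to a section over the annulus.
  have hper : ∀ u x (n : ℤ), A (u, x + n) = A (u, x) := fun u x n => by
    rw [apply_add_int_of_equivariant hm, hm0, zero_mul, zpow_zero]
    rfl
  choose! u hu using fun y (hy : y ∈ bandSet α 1 2) => hy
  choose! hu12 v hv using hu
  let σ : S → L := fun y => A (u y, v y)
  have hσ : ∀ w ∈ Set.Icc (1 : ℝ) 2, ∀ x, σ (α w x) = A (w, x) := fun w hw x => by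
    have hy : α w x ∈ bandSet α 1 2 := ⟨w, hw, x, rfl⟩
    obtain ⟨h1, n, h2⟩ := hband.inj _ (hu12 _ hy) _ hw _ _ (hv _ hy)
    change A (u (α w x), v (α w x)) = A (w, x)
    rw [h1, ← hper w _ n, ← h2]
  have hsec : IsSectionOn q (bandSet α 1 2) σ := by
    refine ⟨hband.isCompact.isClosed, hα.bandSet_subset_closure_interior, ?_, ?_⟩
    · rw [← hband.range_rectangle]
      refine continuousOn_range_of_isClosedMap hband.continuous_rectangle.isClosedMap ?_
      simp only [hσ _ (Subtype.mem _)]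
      fun_prop
    · rintro _ ⟨w, hw, x, rfl⟩
      rw [hσ w hw, hA w hw]
  -- The numbering `ν` is injective since distinct curves are disjoint, and surjective since every
  -- translate of the lifted core lies over the core, hence meets one of the curves.
  refine ⟨σ, hsec, ν, ⟨fun i j hij => ?_, fun n => ?_⟩, fun i => ?_⟩
  · by_contra hne
    have h1 : c i = c j := by rw [hν i, hν j, hij]
    have h2 : Disjoint (c i) (c j) := hdisj hne
    rw [h1, disjoint_self, Set.bot_eq_empty, hν j] at h2
    exact (Set.range_nonempty _).ne_empty h2
  · have h1 : (h ^ n) (A (3 / 2, 0)) ∈ q ⁻¹' Set.range (α (3 / 2)) :=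
      ⟨0, by rw [hq.apply_zpow, hA _ h32]⟩
    rw [hunion, Set.mem_iUnion] at h1
    obtain ⟨i, hi⟩ := h1
    rw [hν i] at hi
    obtain ⟨x, hx⟩ := hi
    refine ⟨i, hq.zpow_injective (y := A (3 / 2, 0)) (Eq.trans ?_ hx)⟩
    have h2 := congrArg q hx
    beta_reduce at h2
    rw [hq.apply_zpow, hq.apply_zpow, hA _ h32, hA _ h32] at h2
    rw [← hσ _ h32, ← h2, hσ _ h32]
  · rw [hν i]
    simp only [hσ _ h32]

end

section

variable {L S : Type*} [TopologicalSpace L] [ChartedSpace ℂ L] [TopologicalSpace S]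
  [ChartedSpace ℂ S] {q : L → S} {h : L ≃ₜ L} {α : ℝ → ℝ → S} {σ : S → L}

/-- Composing with `q` gives back `α`, so injectivity descends from `α`, and the local degree
follows by cancelling the degree of `q`. -/
theorem IsInfiniteCyclicCover.isOrientedBand (hq : IsInfiniteCyclicCover q h)
    (hα : IsOrientedBand α) (hσ : IsSectionOn q (bandSet α 1 2) σ) (n : ℤ) :
    IsOrientedBand fun u x => (h ^ n) (σ (α u x)) where
  cont := (h ^ n).continuous.comp_continuousOn
    (hσ.continuousOn.comp hα.cont fun p hp => ⟨p.1, hp.1, p.2, rfl⟩)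
  periodic u x := by rw [hα.periodic]
  inj u hu u' hu' x x' heq := by
    refine hα.inj u hu u' hu' x x' ?_
    have := congrArg q heq
    rwa [hq.apply_zpow, hq.apply_zpow, hσ.apply_eq _ ⟨u, hu, x, rfl⟩,
      hσ.apply_eq _ ⟨u', hu', x', rfl⟩] at this
  orient ζ h1 h2 := by
    have hev : ∀ᶠ w : ℂ in 𝓝 ζ, 1 < w.re ∧ w.re < 2 :=
      (Complex.continuous_re.continuousAt.eventually (lt_mem_nhds h1)).and
        (Complex.continuous_re.continuousAt.eventually (gt_mem_nhds h2))
    have hqα : (fun w : ℂ => α w.re w.im) =ᶠ[𝓝 ζ]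
        fun w : ℂ => q ((h ^ n) (σ (α w.re w.im))) := by
      filter_upwards [hev] with w hw
      rw [hq.apply_zpow, hσ.apply_eq _ ⟨_, ⟨hw.1.le, hw.2.le⟩, _, rfl⟩]
    refine OrientationPreservingAt.of_comp_left (g := q)
      (f := fun w : ℂ => (h ^ n) (σ (α w.re w.im))) ((hα.orient ζ h1 h2).congr hqα)
      (hq.orientationPreserving _)
      (.of_forall fun _ => hq.isCoveringMap.continuous.continuousAt) ?_
    filter_upwards [hα.eventually_continuousAt h1 h2, hev] with w hwc hw
    have hK : bandSet α 1 2 ∈ 𝓝 (α w.re w.im) := mem_of_superset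
      ((hα.isOpen_openBandSet le_rfl le_rfl).mem_nhds ⟨_, hw, _, rfl⟩) openBandSet_subset
    exact (h ^ n).continuous.continuousAt.comp
      (ContinuousAt.comp (f := fun w : ℂ => α w.re w.im) (hσ.continuousOn.continuousAt hK) hwc)

variable [OrientedSurface L] [OrientedSurface S] [PreconnectedSpace L]

/-- The lift of a Dehn twist on one sheet is the Dehn twist about the lifted curve. -/
theorem IsInfiniteCyclicCover.mapClass_sheetLift (hq : IsInfiniteCyclicCover q h)
    (hα : IsOrientedBand α) (hσ : IsSectionOn q (bandSet α 1 2) σ) (n : ℤ)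
    {t : fixingOff (bandSet α 1 2)} (ht : IsBandMap α 1 2 twistShear t.1.1) {c : Set L}
    (hc : c = Set.range fun x => (h ^ n) (σ (α (3 / 2) x))) {T : MapClassGroup L}
    (hT : IsDehnTwist c T) : mapClass (sheetLift hq hσ {n} t) = T := by
  obtain ⟨s, hs, rfl⟩ := hT
  obtain ⟨β, hβ, hβc, hβs⟩ := exists_orientedBand_of_isDehnTwistHomeo hs
  have hmap : IsBandMap (fun u x => (h ^ n) (σ (α u x))) 1 2 twistShear
      (sheetLift hq hσ {n} t).1 := by
    refine ⟨fun u hu x => ?_, fun y hy => ?_⟩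
    · rw [sheetLift_apply, hq.sheetMap_zpow_apply hσ ⟨u, hu, x, rfl⟩ (Set.mem_singleton n),
        ht.1 u hu]
    · rw [sheetLift_apply]
      by_cases hK : q y ∈ bandSet α 1 2
      · refine sheetMap_of_sheet_notMem fun hn => hy ?_
        have h1 := hq.sheet_spec hσ hK
        rw [Set.mem_singleton_iff.1 hn] at h1
        obtain ⟨u, hu, x, hx⟩ := hK
        exact ⟨u, hu, x, by beta_reduce; rw [hx, h1]⟩
      · exact sheetMap_of_notMem hK
  obtain ⟨f₁, f₂, x₁, x₂, x₃, h1, h2, h3, -, -⟩ :=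
    (hq.isOrientedBand hα hσ n).joinedIn_twists hβ (by rw [hβc, hc]) hmap hβs
  exact mapClass_eq_iff.2 ((h1.joined.trans h2.joined).trans h3.joined)

end

/-! ### Limits of products of twists -/

/-- In `windowProd` the range is turned into a list of integers by the coercion of the list monad;
here it is rewritten as a plain map on natural numbers. -/
theorem windowProd_eq {G : Type*} [Group G] (T : ℤ → G) (k : ℕ) :
    windowProd T k = ((List.range (2 * k + 1)).map fun j : ℕ => T ((j : ℤ) - (k : ℤ))).prod := by
  simp only [windowProd, List.bind_eq_flatMap, List.pure_def, ← List.map_eq_flatMap, List.map_map,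
    Function.comp_def]

theorem map_windowProd {G H : Type*} [Group G] [Group H] (φ : G →* H) (T : ℤ → G) (k : ℕ) :
    φ (windowProd T k) = windowProd (fun i => φ (T i)) k := by
  rw [windowProd_eq, windowProd_eq, map_list_prod, List.map_map]
  rfl

theorem mapClass_zpow {X : Type*} [TopologicalSpace X] [ChartedSpace ℂ X] (f : HomeoPlus X)
    (n : ℤ) : mapClass (f ^ n) = mapClass f ^ n :=
  map_zpow (QuotientGroup.mk' (isotopicToOne X)) f n

theorem mapClass_prod_ofFn {X : Type*} [TopologicalSpace X] [ChartedSpace ℂ X] {r : ℕ}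
    (f : Fin r → HomeoPlus X) :
    mapClass (List.ofFn f).prod = (List.ofFn fun j => mapClass (f j)).prod := by
  refine (map_list_prod (QuotientGroup.mk' (isotopicToOne X)) _).trans ?_
  rw [List.map_ofFn]
  rfl

theorem continuous_mapClass (X : Type*) [TopologicalSpace X] [ChartedSpace ℂ X] :
    Continuous (mapClass : HomeoPlus X → MapClassGroup X) :=
  continuous_quotient_mk'

theorem prod_ofFn_apply_eq {X : Type*} [TopologicalSpace X] [ChartedSpace ℂ X] {r : ℕ}
    {f : Fin r → HomeoPlus X} {x : X} (hf : ∀ j, (f j).1 x = x) : (List.ofFn f).prod.1 x = x := by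
  let H : Subgroup (HomeoPlus X) :=
    { carrier := {e | e.1 x = x}
      one_mem' := rfl
      mul_mem' := fun {a _} ha hb => (congrArg a.1 hb).trans ha
      inv_mem' := fun {a} ha => a.1.symm_apply_eq.2 ha.symm }
  refine H.list_prod_mem fun e he => ?_
  obtain ⟨j, rfl⟩ := (List.mem_ofFn' _ _).1 he
  exact hf j

section

variable {L S : Type*} [TopologicalSpace L] [ChartedSpace ℂ L] [TopologicalSpace S]
  [ChartedSpace ℂ S] {q : L → S} {h : L ≃ₜ L} [OrientedSurface L] [OrientedSurface S]
  [PreconnectedSpace L]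

/-- A twist homeomorphism about a curve with preimage `γ'` has a lift that fixes the points over
fixed points, and whose powers are limits of products of twists about the curves `γ' i`. -/
theorem IsInfiniteCyclicCover.exists_lift_twist (hq : IsInfiniteCyclicCover q h) {γ : Set S}
    {γ' : ℤ → Set L} (hγ : IsPreimageFamily q γ γ') {T : ℤ → MapClassGroup L}
    (hT : ∀ i, IsDehnTwist (γ' i) (T i)) {t : HomeoPlus S} (ht : IsDehnTwistHomeo γ t) :
    ∃ t' : HomeoPlus L, IsHomeoLift q t' t ∧
      (∀ (n : ℤ) (y : L), (t ^ n).1 (q y) = q y → (t' ^ n).1 y = y) ∧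
      ∀ n : ℤ, ∃ G : ℕ → HomeoPlus L, (∀ k, mapClass (G k) = windowProd (fun i => T i ^ n) k) ∧
        Tendsto G atTop (𝓝 (t' ^ n)) := by
  obtain ⟨α, hα, rfl, hαt⟩ := exists_orientedBand_of_isDehnTwistHomeo ht
  obtain ⟨σ, hσ, ν, hν, hγν⟩ := hq.exists_section hα hγ
  let τ : fixingOff (bandSet α 1 2) := ⟨t, hαt.2⟩
  refine ⟨sheetLift hq hσ Set.univ τ, isHomeoLift_sheetLift_univ hq hσ τ, fun n y hy => ?_,
    fun n => ⟨fun k => windowProd (fun i => sheetLift hq hσ {ν i} (τ ^ n)) k, fun k => ?_, ?_⟩⟩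
  · rw [← map_zpow]
    exact hq.sheetMap_eq_self hσ hy
  · refine (map_windowProd (QuotientGroup.mk' (isotopicToOne L)) _ k).trans ?_
    congr 1
    funext i
    rw [map_zpow, map_zpow]
    exact congrArg (· ^ n) (hq.mapClass_sheetLift hα hσ (ν i) hαt (hγν i) (hT i))
  -- A window of curves corresponds to a finite set of sheets through `ν`, whose injectivity
  -- excludes repetitions.
  · have hwin : ∀ k : ℕ, windowProd (fun i => sheetLift hq hσ {ν i} (τ ^ n)) k =
        sheetLift hq hσ
          {m | m ∈ (List.range (2 * k + 1)).map fun j : ℕ => ν ((j : ℤ) - (k : ℤ))} (τ ^ n) := by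
      intro k
      rw [← prod_map_sheetLift, List.map_map, windowProd_eq]
      · rfl
      · refine List.nodup_range.map fun a b hab => ?_
        have := hν.1 hab
        omega
    simp only [hwin]
    rw [← map_zpow]
    refine tendsto_sheetLift hq hσ (τ ^ n) fun m => ?_
    obtain ⟨i, rfl⟩ := hν.2 m
    filter_upwards [eventually_ge_atTop i.natAbs] with k hk
    -- Position `i + k` of the window carries the index `i`, once `k ≥ |i|`.
    refine List.mem_map.2 ⟨(i + k).toNat, List.mem_range.2 (by omega), ?_⟩
    congr 1
    omega

/-- The class of the lift that fixes the points over fixed points does not depend on the choice of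
the twist homeomorphism. -/
theorem IsInfiniteCyclicCover.mapClass_lift_twist_eq [CompactSpace S]
    (hq : IsInfiniteCyclicCover q h) {γ : Set S} {γ' : ℤ → Set L} (hγ : IsPreimageFamily q γ γ')
    {s t : HomeoPlus S} (hs : IsDehnTwistHomeo γ s) (ht : IsDehnTwistHomeo γ t)
    {s' t' : HomeoPlus L} (hs' : IsHomeoLift q s' s) (ht' : IsHomeoLift q t' t)
    (hsfix : ∀ y, s.1 (q y) = q y → s'.1 y = y) (htfix : ∀ y, t.1 (q y) = q y → t'.1 y = y) :
    mapClass s' = mapClass t' := by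
  obtain ⟨α, hα, rfl, hαs⟩ := exists_orientedBand_of_isDehnTwistHomeo hs
  obtain ⟨β, hβ, hβc, hβt⟩ := exists_orientedBand_of_isDehnTwistHomeo ht
  obtain ⟨σ, hσ, -⟩ := hq.exists_section hα hγ
  obtain ⟨ρ, hρ, -⟩ := hq.exists_section hβ (hβc.symm ▸ hγ)
  obtain ⟨f₁, f₂, x₁, x₂, x₃, h1, h2, h3, hf₁, hf₂⟩ := hα.joinedIn_twists hβ hβc.symm hαs hβt
  -- The three isotopies have different fixed points. The intermediate maps are supported in one of
  -- the two annuli, so they have lifts that are the identity over all their fixed points, and these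
  -- link the three comparisons.
  have hlift₁ := isHomeoLift_sheetLift_univ hq hσ ⟨f₁, hf₁⟩
  have hlift₂ := isHomeoLift_sheetLift_univ hq hρ ⟨f₂, hf₂⟩
  have hfix₁ : ∀ y, f₁.1 (q y) = q y → (sheetLift hq hσ Set.univ ⟨f₁, hf₁⟩).1 y = y :=
    fun y hy => hq.sheetMap_eq_self hσ hy
  have hfix₂ : ∀ y, f₂.1 (q y) = q y → (sheetLift hq hρ Set.univ ⟨f₂, hf₂⟩).1 y = y :=
    fun y hy => hq.sheetMap_eq_self hρ hy
  exact ((hq.mapClass_eq_of_joinedIn h1 hs' hlift₁ hsfix hfix₁).trans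
    (hq.mapClass_eq_of_joinedIn h2 hlift₁ hlift₂ hfix₁ hfix₂)).trans
    (hq.mapClass_eq_of_joinedIn h3 hlift₂ ht' hfix₂ htfix)

end

/-! ### The limits of window products as lifts of twists and of their products -/

theorem mainTheorem8 {L S : Type*}
    [TopologicalSpace S] [ChartedSpace ℂ S] [OrientedSurface S] [CompactSpace S] [ConnectedSpace S]
    [TopologicalSpace L] [ChartedSpace ℂ L] [OrientedSurface L] [ConnectedSpace L]
    (q : L → S) (h : L ≃ₜ L) (hq : IsInfiniteCyclicCover q h) :
    -- a single liftable twist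
    (∀ (γ : Set S) (Tγ : MapClassGroup S) (γ' : ℤ → Set L) (T : ℤ → MapClassGroup L),
      IsEssentialCurve γ → IsDehnTwist γ Tγ → Tγ ∈ LMod q → IsPreimageFamily q γ γ' →
      (∀ i, IsDehnTwist (γ' i) (T i)) →
      ∃ T' : MapClassGroup L,
        Tendsto (fun k => windowProd T k) atTop (𝓝 T') ∧
        ∀ t : HomeoPlus S, IsDehnTwistHomeo γ t →
          ∃ t' : HomeoPlus L, IsHomeoLift q t' t ∧ mapClass t' = T' ∧
            ∀ x : L, t.1 (q x) = q x → t'.1 x = x) ∧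
    -- a product of powers of liftable twists
    (∀ (r : ℕ) (n : Fin r → ℤ) (γ : Fin r → Set S) (Tγ : Fin r → MapClassGroup S)
      (γ' : Fin r → ℤ → Set L) (T : Fin r → ℤ → MapClassGroup L),
      (∀ j, IsEssentialCurve (γ j)) → (∀ j, IsDehnTwist (γ j) (Tγ j)) → (∀ j, Tγ j ∈ LMod q) →
      (∀ j, IsPreimageFamily q (γ j) (γ' j)) → (∀ j i, IsDehnTwist (γ' j i) (T j i)) →
      ∃ F' : MapClassGroup L,
        Tendsto (fun k => (List.ofFn fun j => windowProd (fun i => T j i ^ n j) k).prod)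
          atTop (𝓝 F') ∧
        -- the limit is a lift of the product, whichever representative is taken
        (∀ f : HomeoPlus S, mapClass f = (List.ofFn fun j => Tγ j ^ n j).prod →
          ∃ f' : HomeoPlus L, IsHomeoLift q f' f ∧ mapClass f' = F') ∧
        -- it is the lift that fixes a given point over a common fixed point of the twists
        (∀ (t : Fin r → HomeoPlus S) (x₀ : S) (x₀' : L) (f : HomeoPlus S),
          (∀ j, IsDehnTwistHomeo (γ j) (t j)) → (∀ j, (t j ^ n j).1 x₀ = x₀) → q x₀' = x₀ →
          JoinedIn {e : HomeoPlus S | e.1 x₀ = x₀} (List.ofFn fun j => t j ^ n j).prod f →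
          (∃! f' : HomeoPlus L, IsHomeoLift q f' f ∧ f'.1 x₀' = x₀') ∧
          ∀ f' : HomeoPlus L, IsHomeoLift q f' f → f'.1 x₀' = x₀' → mapClass f' = F')) := by
  have hcont := continuous_mapClass L
  have : LocallyCompactSpace L := ChartedSpace.locallyCompactSpace ℂ L
  have := continuousMul_homeoPlus L
  refine ⟨?_, ?_⟩
  · rintro γ _ γ' T - ⟨t₀, ht₀, rfl⟩ - hγ hT
    obtain ⟨t₀', hlift₀, hfix₀, hlim⟩ := hq.exists_lift_twist hγ hT ht₀
    obtain ⟨G, hG, hGlim⟩ := hlim 1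
    simp only [zpow_one] at hG hGlim
    refine ⟨mapClass t₀', ?_, fun t ht => ?_⟩
    · simpa only [Function.comp_def, hG] using (hcont.tendsto t₀').comp hGlim
    · obtain ⟨t', hlift, hfix, -⟩ := hq.exists_lift_twist hγ hT ht
      -- The limit was computed with the reference twist `t₀`; the lift for any other twist `t` has
      -- the same class.
      have hfix := hfix 1
      have hfix₀ := hfix₀ 1
      simp only [zpow_one] at hfix hfix₀
      exact ⟨t', hlift, hq.mapClass_lift_twist_eq hγ ht ht₀ hlift hlift₀ hfix hfix₀, hfix⟩
  · intro r n γ Tγ γ' T _ hTγ _ hγ hT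
    choose t₀ ht₀ hTγ using hTγ
    choose t₀' hlift₀ hfix₀ hlim using fun j => hq.exists_lift_twist (hγ j) (hT j) (ht₀ j)
    choose G hG hGlim using fun j => hlim j (n j)
    have hprod : ∀ {t : Fin r → HomeoPlus S} {t' : Fin r → HomeoPlus L},
        (∀ j, IsHomeoLift q (t' j) (t j)) → IsHomeoLift q (List.ofFn fun j => t' j ^ n j).prod
          (List.ofFn fun j => t j ^ n j).prod := fun {t t'} ht => by
      rw [List.ofFn_eq_map, List.ofFn_eq_map]
      exact IsHomeoLift.list_prod (fun j => (ht j).zpow (n j)) _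
    refine ⟨mapClass (List.ofFn fun j => t₀' j ^ n j).prod, ?_, fun f hf => ?_,
      fun t x₀ x₀' f ht hx₀ hx₀' hf => ?_⟩
    -- The limit is taken among homeomorphisms, where multiplication is continuous, and only then
    -- passed to mapping classes.
    · have h1 := tendsto_list_prod (List.finRange r) fun j _ => hGlim j
      simp only [← List.ofFn_eq_map] at h1
      have h2 := (hcont.tendsto _).comp h1
      simpa only [Function.comp_def, mapClass_prod_ofFn, hG] using h2
    · have h1 : mapClass (List.ofFn fun j => t₀ j ^ n j).prod = mapClass f := by
        rw [hf, mapClass_prod_ofFn]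
        simp only [mapClass_zpow, hTγ]
      -- An isotopy from the product of the reference twists to `f` lifts, starting at the product
      -- of their lifts.
      obtain ⟨p⟩ := mapClass_eq_iff.1 h1
      obtain ⟨f', hf', hclass, -⟩ := hq.exists_lift_of_path p (hprod hlift₀)
      exact ⟨f', hf', hclass⟩
    · choose t' hlift hfix _ using fun j => hq.exists_lift_twist (hγ j) (hT j) (ht j)
      obtain ⟨p, hp⟩ := hf
      -- The isotopy starts at the product of the given twists `t j`, whose lifts fix `x₀'`; as it
      -- fixes `x₀`, its lift keeps `x₀'` fixed to the end.
      obtain ⟨f', hf', hclass, hfixf⟩ := hq.exists_lift_of_path p (hprod hlift)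
      have hf'x : f'.1 x₀' = x₀' := by
        rw [hfixf x₀' fun s => by rw [hx₀']; exact hp s]
        exact prod_ofFn_apply_eq fun j => hfix j (n j) x₀' (by rw [hx₀', hx₀ j])
      have huniq : ∀ g' : HomeoPlus L, IsHomeoLift q g' f → g'.1 x₀' = x₀' → g' = f' :=
        fun g' hg' hg'x => Subtype.ext (Homeomorph.ext fun y => congrFun
          (hq.eq_of_comp_eq g'.1.continuous f'.1.continuous
            (fun z => (hg' z).trans (hf' z).symm) x₀' (hg'x.trans hf'x.symm)) y)
      refine ⟨⟨f', ⟨hf', hf'x⟩, fun g' hg' => huniq g' hg'.1 hg'.2⟩, fun g' hg' hg'x => ?_⟩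
      -- The classes of the products are compared factor by factor, since each lifted twist has the
      -- class of the lift of the reference twist about the same curve.
      rw [huniq g' hg' hg'x, hclass, mapClass_prod_ofFn, mapClass_prod_ofFn]
      congr 2
      funext j
      have hfix₁ := hfix j 1
      have hfix₂ := hfix₀ j 1
      simp only [zpow_one] at hfix₁ hfix₂
      rw [mapClass_zpow, mapClass_zpow,
        hq.mapClass_lift_twist_eq (hγ j) (ht j) (ht₀ j) (hlift j) (hlift₀ j) hfix₁ hfix₂]
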